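/- Let $H$ be a Hopf algebra with bijective antipode over a field $k$, with comultiplication $\Delta$. Let $C=H/I$, where $I$ is simultaneously a coideal and a left ideal of $H$; thus $C$ is a coalgebra and a left $H$-module, and the canonical surjection $\pi:H\to C$ is a left $H$-linear homomorphism of coalgebras. View $H$ as a left $C$-comodule via $(\pi\otimes\mathrm{id})\Delta$ and as a right $C$-comodule via $(\mathrm{id}\otimes\pi)\Delta$, and let $$A={}^{\mathrm{co}\,C}H=\{h\in H\mid(\pi\otimes\mathrm{id})\Delta(h)=\pi(1)\otimes h\},$$ which is a subalgebra of $H$ acting on $H$ on the left and on the right by multiplication. Write $\square_C$ for the cotensor product over $C$. We say that $H$ is left (right) coflat over $C$ if the functor $?\,\square_C H$ on right $C$-comodules (respectively $H\,\square_C\,?$ on left $C$-comodules) is exact, and faithfully coflat if moreover this functor takes nonzero comodules to nonzero spaces. Likewise, $H$ is left (right) flat over $A$ if the functor $?\otimes_A H$ on right $A$-modules (respectively $H\otimes_A\,?$ on left $A$-modules) is exact, and faithfully flat if moreover this functor takes nonzero modules to nonzero spaces. **Theorem 7.4.** Suppose that $H$ is left coflat over $C$ and right flat over $A$. Then $H$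 is left faithfully coflat over $C$ and left faithfully flat over $A$. If, in addition, either $C$ has a right coideal $R\neq C$ (a subspace with $\Delta_C(R)\subseteq R\otimes C$) of finite codimension, or all simple left $A$-modules are finite dimensional over $k$, then $H$ is also right faithfully coflat over $C$ and right faithfully flat over $A$. -/

import Mathlib

open scoped TensorProduct

universe u v

noncomputable section

namespace Takeuchi

/-! ### Tensor products and flatness over a noncommutative algebra

`A` is an algebra over `k`.  A left `A`-module is a `Module A`, a right `A`-module is a
`Module Aᵐᵒᵖ`.  Every `A`-module has exactly one compatible `k`-module structure; it is carried
along by `[Module k N] [IsScalarTower k A N]`. -/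

section Flat

variable (k : Type u) [Field k] (A : Type v) [Ring A] [Algebra k A]

/-- The relations `(m · a) ⊗ n = m ⊗ (a · n)` inside `M ⊗ₖ N`, for `M` a right and `N` a left
`A`-module. -/
def balancedRel (M N : Type v) [AddCommGroup M] [Module k M] [Module Aᵐᵒᵖ M]
    [AddCommGroup N] [Module k N] [Module A N] : Submodule k (M ⊗[k] N) :=
  Submodule.span k {t | ∃ (m : M) (a : A) (n : N),
    t = (MulOpposite.op a • m) ⊗ₜ[k] n - m ⊗ₜ[k] (a • n)}

/-- The tensor product `M ⊗_A N` of a right `A`-module `M` and a left `A`-module `N`. -/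
abbrev TensorOver (M N : Type v) [AddCommGroup M] [Module k M] [Module Aᵐᵒᵖ M]
    [AddCommGroup N] [Module k N] [Module A N] : Type v :=
  (M ⊗[k] N) ⧸ balancedRel k A M N

/-- The map `M ⊗_A N → M ⊗_A N'` induced by a homomorphism `g : N → N'` of left `A`-modules. -/
def TensorOver.mapRight (M : Type v) [AddCommGroup M] [Module k M] [Module Aᵐᵒᵖ M]
    {N N' : Type v} [AddCommGroup N] [Module k N] [Module A N] [IsScalarTower k A N]
    [AddCommGroup N'] [Module k N'] [Module A N'] [IsScalarTower k A N'] (g : N →ₗ[A] N') :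
    TensorOver k A M N →ₗ[k] TensorOver k A M N' :=
  Submodule.mapQ _ _ ((g.restrictScalars k).lTensor M) (by
    rw [balancedRel, Submodule.span_le]
    rintro _ ⟨m, a, n, rfl⟩
    refine Submodule.subset_span ⟨m, a, g n, ?_⟩
    simp)

/-- The map `M ⊗_A N → M' ⊗_A N` induced by a homomorphism `f : M → M'` of right `A`-modules. -/
def TensorOver.mapLeft {M M' : Type v}
    [AddCommGroup M] [Module k M] [Module Aᵐᵒᵖ M] [IsScalarTower k Aᵐᵒᵖ M]
    [AddCommGroup M'] [Module k M'] [Module Aᵐᵒᵖ M'] [IsScalarTower k Aᵐᵒᵖ M']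
    (N : Type v) [AddCommGroup N] [Module k N] [Module A N] (f : M →ₗ[Aᵐᵒᵖ] M') :
    TensorOver k A M N →ₗ[k] TensorOver k A M' N :=
  Submodule.mapQ _ _ ((f.restrictScalars k).rTensor N) (by
    rw [balancedRel, Submodule.span_le]
    rintro _ ⟨m, a, n, rfl⟩
    refine Submodule.subset_span ⟨f m, a, n, ?_⟩
    simp)

/-- A right `A`-module `M` is flat: the functor `M ⊗_A ?` on left `A`-modules is exact.
Test modules live in the universe of `A`; this suffices, since flatness is
detected by left ideals of `A`. -/
def IsRightFlat (M : Type v) [AddCommGroup M] [Module k M] [Module Aᵐᵒᵖ M] : Prop :=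
  ∀ (N₁ N₂ N₃ : Type v)
    [AddCommGroup N₁] [Module k N₁] [Module A N₁] [IsScalarTower k A N₁]
    [AddCommGroup N₂] [Module k N₂] [Module A N₂] [IsScalarTower k A N₂]
    [AddCommGroup N₃] [Module k N₃] [Module A N₃] [IsScalarTower k A N₃]
    (f : N₁ →ₗ[A] N₂) (g : N₂ →ₗ[A] N₃), Function.Exact f g →
    Function.Exact (TensorOver.mapRight k A M f) (TensorOver.mapRight k A M g)

/-- A right `A`-module `M` is faithfully flat: it is flat, and `M ⊗_A N ≠ 0` for every nonzero
left `A`-module `N`. -/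
def IsRightFaithfullyFlat (M : Type v) [AddCommGroup M] [Module k M] [Module Aᵐᵒᵖ M] : Prop :=
  IsRightFlat k A M ∧
  ∀ (N : Type v) [AddCommGroup N] [Module k N] [Module A N] [IsScalarTower k A N],
    Nontrivial N → Nontrivial (TensorOver k A M N)

/-- A left `A`-module `N` is flat: the functor `? ⊗_A N` on right `A`-modules is exact. -/
def IsLeftFlat (N : Type v) [AddCommGroup N] [Module k N] [Module A N] : Prop :=
  ∀ (M₁ M₂ M₃ : Type v)
    [AddCommGroup M₁] [Module k M₁] [Module Aᵐᵒᵖ M₁] [IsScalarTower k Aᵐᵒᵖ M₁]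
    [AddCommGroup M₂] [Module k M₂] [Module Aᵐᵒᵖ M₂] [IsScalarTower k Aᵐᵒᵖ M₂]
    [AddCommGroup M₃] [Module k M₃] [Module Aᵐᵒᵖ M₃] [IsScalarTower k Aᵐᵒᵖ M₃]
    (f : M₁ →ₗ[Aᵐᵒᵖ] M₂) (g : M₂ →ₗ[Aᵐᵒᵖ] M₃), Function.Exact f g →
    Function.Exact (TensorOver.mapLeft k A N f) (TensorOver.mapLeft k A N g)

/-- A left `A`-module `N` is faithfully flat: it is flat, and `M ⊗_A N ≠ 0` for every nonzero
right `A`-module `M`. -/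
def IsLeftFaithfullyFlat (N : Type v) [AddCommGroup N] [Module k N] [Module A N] : Prop :=
  IsLeftFlat k A N ∧
  ∀ (M : Type v) [AddCommGroup M] [Module k M] [Module Aᵐᵒᵖ M] [IsScalarTower k Aᵐᵒᵖ M],
    Nontrivial M → Nontrivial (TensorOver k A M N)

end Flat

section Subalgebra

variable {k : Type u} [Field k] {H : Type v} [Ring H] [Algebra k H]

/-- `H` as a right module over a subalgebra `A`, by right multiplication: `op a • h = h * a`.
(The left module structure, by left multiplication, is Mathlib's.) -/
instance rightModule (A : Subalgebra k H) : Module (↥A)ᵐᵒᵖ H :=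
  Module.compHom H (A.val.toRingHom.op : (↥A)ᵐᵒᵖ →+* Hᵐᵒᵖ)

theorem op_smul_eq_mul (A : Subalgebra k H) (a : A) (h : H) :
    MulOpposite.op a • h = h * (a : H) := rfl

instance rightModule_isScalarTower (A : Subalgebra k H) : IsScalarTower k (↥A)ᵐᵒᵖ H where
  smul_assoc r a h := by
    induction a using MulOpposite.rec' with
    | _ a => rw [← MulOpposite.op_smul, op_smul_eq_mul, op_smul_eq_mul]; simp

end Subalgebra

/-! ### Comodules, cotensor products and coflatness -/

section Comodule

variable (k : Type u) [Field k] (C : Type v) [AddCommGroup C] [Module k C] [Coalgebra k C]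

/-- A right `C`-comodule structure `ρ : V → V ⊗ C` on a vector space `V`. -/
structure RightCoaction (V : Type v) [AddCommGroup V] [Module k V] where
  /-- the structure map -/
  coact : V →ₗ[k] V ⊗[k] C
  coassoc : (TensorProduct.assoc k V C C).toLinearMap ∘ₗ coact.rTensor C ∘ₗ coact =
    (Coalgebra.comul (R := k) (A := C)).lTensor V ∘ₗ coact
  counit_coact : (TensorProduct.rid k V).toLinearMap ∘ₗ
    (Coalgebra.counit (R := k) (A := C)).lTensor V ∘ₗ coact = LinearMap.id

/-- A left `C`-comodule structure `ρ : V → C ⊗ V` on a vector space `V`. -/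
structure LeftCoaction (V : Type v) [AddCommGroup V] [Module k V] where
  /-- the structure map -/
  coact : V →ₗ[k] C ⊗[k] V
  coassoc : (TensorProduct.assoc k C C V).toLinearMap ∘ₗ
    (Coalgebra.comul (R := k) (A := C)).rTensor V ∘ₗ coact = coact.lTensor C ∘ₗ coact
  counit_coact : (TensorProduct.lid k V).toLinearMap ∘ₗ
    (Coalgebra.counit (R := k) (A := C)).rTensor V ∘ₗ coact = LinearMap.id

variable {k C}

/-- `f : V → W` is a homomorphism of right `C`-comodules. -/
def RightCoaction.IsColinear {V W : Type v} [AddCommGroup V] [Module k V] [AddCommGroup W]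
    [Module k W] (ρ : RightCoaction k C V) (σ : RightCoaction k C W) (f : V →ₗ[k] W) : Prop :=
  σ.coact ∘ₗ f = f.rTensor C ∘ₗ ρ.coact

/-- `f : V → W` is a homomorphism of left `C`-comodules. -/
def LeftCoaction.IsColinear {V W : Type v} [AddCommGroup V] [Module k V] [AddCommGroup W]
    [Module k W] (ρ : LeftCoaction k C V) (σ : LeftCoaction k C W) (f : V →ₗ[k] W) : Prop :=
  σ.coact ∘ₗ f = f.lTensor C ∘ₗ ρ.coact

/-- The cotensor product `V □_C M ⊆ V ⊗ M` of a right comodule `V` and a left comodule `M`: the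
equalizer of the two maps `V ⊗ M ⇉ V ⊗ (C ⊗ M)` given by the coactions. -/
def cotensor {V M : Type v} [AddCommGroup V] [Module k V] [AddCommGroup M] [Module k M]
    (ρ : RightCoaction k C V) (σ : LeftCoaction k C M) : Submodule k (V ⊗[k] M) :=
  LinearMap.eqLocus ((TensorProduct.assoc k V C M).toLinearMap ∘ₗ ρ.coact.rTensor M)
    (σ.coact.lTensor V)

/-- The map `V □_C M → W □_C M` induced by a homomorphism `f : V → W` of right comodules. -/
def cotensorMapLeft {V W M : Type v} [AddCommGroup V] [Module k V] [AddCommGroup W] [Module k W]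
    [AddCommGroup M] [Module k M] (ρ : RightCoaction k C V) (τ : RightCoaction k C W)
    (σ : LeftCoaction k C M) (f : V →ₗ[k] W) (hf : ρ.IsColinear τ f) :
    cotensor ρ σ →ₗ[k] cotensor τ σ :=
  (f.rTensor M).restrict (by
    intro x hx
    simp only [cotensor, LinearMap.mem_eqLocus, LinearMap.comp_apply,
      LinearEquiv.coe_coe] at hx ⊢
    have h1 : (τ.coact.rTensor M) (f.rTensor M x) =
        ((f.rTensor C).rTensor M) (ρ.coact.rTensor M x) := by
      rw [← LinearMap.comp_apply, ← LinearMap.comp_apply, ← LinearMap.rTensor_comp,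
        ← LinearMap.rTensor_comp, hf]
    have h2 : ∀ y : (V ⊗[k] C) ⊗[k] M, TensorProduct.assoc k W C M ((f.rTensor C).rTensor M y) =
        f.rTensor (C ⊗[k] M) (TensorProduct.assoc k V C M y) := by
      intro y
      rw [← LinearEquiv.coe_coe, ← LinearEquiv.coe_coe, ← LinearMap.comp_apply,
        ← LinearMap.comp_apply]
      congr 1
      ext a b c
      simp
    rw [h1, h2, hx, ← LinearMap.comp_apply, ← LinearMap.comp_apply, LinearMap.rTensor_comp_lTensor,
      LinearMap.lTensor_comp_rTensor])

/-- The map `V □_C M → V □_C N` induced by a homomorphism `f : M → N` of left comodules. -/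
def cotensorMapRight {V M N : Type v} [AddCommGroup V] [Module k V] [AddCommGroup M] [Module k M]
    [AddCommGroup N] [Module k N] (ρ : RightCoaction k C V) (σ : LeftCoaction k C M)
    (τ : LeftCoaction k C N) (f : M →ₗ[k] N) (hf : σ.IsColinear τ f) :
    cotensor ρ σ →ₗ[k] cotensor ρ τ :=
  (f.lTensor V).restrict (by
    intro x hx
    simp only [cotensor, LinearMap.mem_eqLocus, LinearMap.comp_apply,
      LinearEquiv.coe_coe] at hx ⊢
    have h1 : (τ.coact.lTensor V) (f.lTensor V x) =
        ((f.lTensor C).lTensor V) (σ.coact.lTensor V x) := by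
      rw [← LinearMap.comp_apply, ← LinearMap.comp_apply, ← LinearMap.lTensor_comp,
        ← LinearMap.lTensor_comp, hf]
    have h2 : ∀ y : (V ⊗[k] C) ⊗[k] M, (f.lTensor C).lTensor V (TensorProduct.assoc k V C M y) =
        TensorProduct.assoc k V C N (f.lTensor (V ⊗[k] C) y) := by
      intro y
      rw [← LinearEquiv.coe_coe, ← LinearEquiv.coe_coe, ← LinearMap.comp_apply,
        ← LinearMap.comp_apply]
      congr 1
      ext a b c
      simp
    rw [h1, ← hx, h2, ← LinearMap.comp_apply (ρ.coact.rTensor N),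
      ← LinearMap.comp_apply (f.lTensor (V ⊗[k] C)), LinearMap.rTensor_comp_lTensor,
      LinearMap.lTensor_comp_rTensor])

/-- A left `C`-comodule `M` is coflat: the functor `? □_C M` on right `C`-comodules is exact.
Test comodules live in the universe of `C`; this suffices, since coflatness is detected by
finite-dimensional comodules. -/
def LeftCoaction.IsCoflat {M : Type v} [AddCommGroup M] [Module k M]
    (σ : LeftCoaction k C M) : Prop :=
  ∀ (V₁ V₂ V₃ : Type v) [AddCommGroup V₁] [Module k V₁] [AddCommGroup V₂] [Module k V₂]
    [AddCommGroup V₃] [Module k V₃] (ρ₁ : RightCoaction k C V₁) (ρ₂ : RightCoaction k C V₂)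
    (ρ₃ : RightCoaction k C V₃) (f : V₁ →ₗ[k] V₂) (g : V₂ →ₗ[k] V₃)
    (hf : ρ₁.IsColinear ρ₂ f) (hg : ρ₂.IsColinear ρ₃ g), Function.Exact f g →
    Function.Exact (cotensorMapLeft ρ₁ ρ₂ σ f hf) (cotensorMapLeft ρ₂ ρ₃ σ g hg)

/-- A left `C`-comodule `M` is faithfully coflat: it is coflat, and `V □_C M ≠ 0` for every
nonzero right `C`-comodule `V`. -/
def LeftCoaction.IsFaithfullyCoflat {M : Type v} [AddCommGroup M] [Module k M]
    (σ : LeftCoaction k C M) : Prop :=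
  σ.IsCoflat ∧ ∀ (V : Type v) [AddCommGroup V] [Module k V] (ρ : RightCoaction k C V),
    Nontrivial V → Nontrivial (cotensor ρ σ)

/-- A right `C`-comodule `V` is coflat: the functor `V □_C ?` on left `C`-comodules is exact. -/
def RightCoaction.IsCoflat {V : Type v} [AddCommGroup V] [Module k V]
    (ρ : RightCoaction k C V) : Prop :=
  ∀ (M₁ M₂ M₃ : Type v) [AddCommGroup M₁] [Module k M₁] [AddCommGroup M₂] [Module k M₂]
    [AddCommGroup M₃] [Module k M₃] (σ₁ : LeftCoaction k C M₁) (σ₂ : LeftCoaction k C M₂)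
    (σ₃ : LeftCoaction k C M₃) (f : M₁ →ₗ[k] M₂) (g : M₂ →ₗ[k] M₃)
    (hf : σ₁.IsColinear σ₂ f) (hg : σ₂.IsColinear σ₃ g), Function.Exact f g →
    Function.Exact (cotensorMapRight ρ σ₁ σ₂ f hf) (cotensorMapRight ρ σ₂ σ₃ g hg)

/-- A right `C`-comodule `V` is faithfully coflat: it is coflat, and `V □_C M ≠ 0` for every
nonzero left `C`-comodule `M`. -/
def RightCoaction.IsFaithfullyCoflat {V : Type v} [AddCommGroup V] [Module k V]
    (ρ : RightCoaction k C V) : Prop :=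
  ρ.IsCoflat ∧ ∀ (M : Type v) [AddCommGroup M] [Module k M] (σ : LeftCoaction k C M),
    Nontrivial M → Nontrivial (cotensor ρ σ)

/-- A right coideal of a coalgebra `C`: a subspace `R` with `Δ(R) ⊆ R ⊗ C`. -/
def IsRightCoideal (R : Submodule k C) : Prop :=
  ∀ x ∈ R, Coalgebra.comul (R := k) x ∈ LinearMap.range (R.subtype.rTensor C)

variable {H : Type v} [AddCommGroup H] [Module k H] [Coalgebra k H]

/-- For a coalgebra homomorphism `π : H → C`, the left `C`-comodule structure
`(π ⊗ id) ∘ Δ` on `H`. -/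
def leftCoactionOf (π : H →ₗc[k] C) : LeftCoaction k C H where
  coact := (π : H →ₗ[k] C).rTensor H ∘ₗ Coalgebra.comul
  coassoc := by
    have h1 : (Coalgebra.comul (R := k) (A := C)).rTensor H ∘ₗ (π : H →ₗ[k] C).rTensor H =
        (TensorProduct.map (π : H →ₗ[k] C) (π : H →ₗ[k] C)).rTensor H ∘ₗ
          (Coalgebra.comul (R := k) (A := H)).rTensor H := by
      rw [← LinearMap.rTensor_comp, ← LinearMap.rTensor_comp, CoalgHomClass.map_comp_comul]
    have h2 : (TensorProduct.assoc k C C H).toLinearMap ∘ₗ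
        (TensorProduct.map (π : H →ₗ[k] C) (π : H →ₗ[k] C)).rTensor H =
        TensorProduct.map (π : H →ₗ[k] C) ((π : H →ₗ[k] C).rTensor H) ∘ₗ
          (TensorProduct.assoc k H H H).toLinearMap := by
      ext a b c; simp
    have h3 : ((π : H →ₗ[k] C).rTensor H ∘ₗ Coalgebra.comul (R := k)).lTensor C ∘ₗ
        (π : H →ₗ[k] C).rTensor H =
        TensorProduct.map (π : H →ₗ[k] C) ((π : H →ₗ[k] C).rTensor H) ∘ₗ
          (Coalgebra.comul (R := k) (A := H)).lTensor H := by
      ext a b; simp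
    rw [← LinearMap.comp_assoc (Coalgebra.comul (R := k) (A := H)), h1, LinearMap.comp_assoc,
      ← LinearMap.comp_assoc, h2, LinearMap.comp_assoc, Coalgebra.coassoc,
      ← LinearMap.comp_assoc, ← h3, LinearMap.comp_assoc]
  counit_coact := by
    rw [← LinearMap.comp_assoc (Coalgebra.comul (R := k) (A := H)), ← LinearMap.rTensor_comp,
      CoalgHomClass.counit_comp, Coalgebra.rTensor_counit_comp_comul]
    ext x; simp

/-- For a coalgebra homomorphism `π : H → C`, the right `C`-comodule structure
`(id ⊗ π) ∘ Δ` on `H`. -/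
def rightCoactionOf (π : H →ₗc[k] C) : RightCoaction k C H where
  coact := (π : H →ₗ[k] C).lTensor H ∘ₗ Coalgebra.comul
  coassoc := by
    have h1 : (Coalgebra.comul (R := k) (A := C)).lTensor H ∘ₗ (π : H →ₗ[k] C).lTensor H =
        (TensorProduct.map (π : H →ₗ[k] C) (π : H →ₗ[k] C)).lTensor H ∘ₗ
          (Coalgebra.comul (R := k) (A := H)).lTensor H := by
      rw [← LinearMap.lTensor_comp, ← LinearMap.lTensor_comp, CoalgHomClass.map_comp_comul]
    have h2 : (TensorProduct.assoc k H C C).toLinearMap ∘ₗ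
        ((π : H →ₗ[k] C).lTensor H ∘ₗ Coalgebra.comul (R := k)).rTensor C ∘ₗ
        (π : H →ₗ[k] C).lTensor H =
        (TensorProduct.map (π : H →ₗ[k] C) (π : H →ₗ[k] C)).lTensor H ∘ₗ
          (TensorProduct.assoc k H H H).toLinearMap ∘ₗ
          (Coalgebra.comul (R := k) (A := H)).rTensor H := by
      ext a b
      simp only [TensorProduct.AlgebraTensorModule.curry_apply, TensorProduct.curry_apply,
        LinearMap.restrictScalars_self, LinearMap.comp_apply, LinearMap.lTensor_tmul,
        LinearMap.rTensor_tmul, LinearEquiv.coe_coe]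
      generalize Coalgebra.comul (R := k) a = y
      induction y with
      | zero => simp
      | tmul p q => simp
      | add p q hp hq => simp only [map_add, TensorProduct.add_tmul, hp, hq]
    have h3 : (Coalgebra.comul (R := k) (A := C)).lTensor H ∘ₗ (π : H →ₗ[k] C).lTensor H ∘ₗ
        Coalgebra.comul (R := k) (A := H) = (TensorProduct.map (π : H →ₗ[k] C)
          (π : H →ₗ[k] C)).lTensor H ∘ₗ (Coalgebra.comul (R := k) (A := H)).lTensor H ∘ₗ
        Coalgebra.comul (R := k) (A := H) := by
      rw [← LinearMap.comp_assoc, h1, LinearMap.comp_assoc]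
    rw [h3, ← Coalgebra.coassoc]
    simpa only [LinearMap.comp_assoc] using
      congrArg (fun F => F ∘ₗ Coalgebra.comul (R := k) (A := H)) h2
  counit_coact := by
    rw [← LinearMap.comp_assoc (Coalgebra.comul (R := k) (A := H)), ← LinearMap.lTensor_comp,
      CoalgHomClass.counit_comp, Coalgebra.lTensor_counit_comp_comul]
    ext x; simp

end Comodule

/-! ### Coinvariants -/

section Coinvariants

variable {k : Type u} [Field k] {H : Type v} [Ring H] [HopfAlgebra k H]
  {C : Type v} [AddCommGroup C] [Module k C] [Coalgebra k C] [Module H C]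
  [IsScalarTower k H C]

/-- The subalgebra `A = {h ∈ H | (π ⊗ id)(Δ h) = π(1) ⊗ h}` of left `C`-coinvariants of `H`, for a
left `H`-linear coalgebra homomorphism `π : H → C`. -/
def leftCoinvariants (π : H →ₗc[k] C) (hπ : ∀ h x : H, π (h * x) = h • π x) :
    Subalgebra k H where
  carrier := {h | (leftCoactionOf π).coact h = π 1 ⊗ₜ[k] h}
  mul_mem' := by
    intro a b ha hb
    simp only [Set.mem_ofPred_eq, leftCoactionOf, LinearMap.comp_apply] at ha hb ⊢
    rw [Bialgebra.comul_mul]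
    have h1 : ∀ p q : H, ∀ t : H ⊗[k] H, (π : H →ₗ[k] C).rTensor H ((p ⊗ₜ[k] q) * t) =
        TensorProduct.map (Algebra.lsmul k k C p) (LinearMap.mulLeft k q)
          ((π : H →ₗ[k] C).rTensor H t) := by
      intro p q t
      induction t with
      | zero => simp
      | tmul x y => simp [hπ]
      | add x y hx hy => rw [mul_add, map_add, map_add, map_add, hx, hy]
    have h2 : ∀ s : H ⊗[k] H, (π : H →ₗ[k] C).rTensor H (s * Coalgebra.comul (R := k) b) =
        (LinearMap.mulRight k b).lTensor C ((π : H →ₗ[k] C).rTensor H s) := by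
      intro s
      induction s with
      | zero => simp
      | tmul p q => rw [h1, hb]; simp [← hπ]
      | add x y hx hy => rw [add_mul, map_add, map_add, map_add, hx, hy]
    rw [h2, ha]
    simp
  one_mem' := by simp [leftCoactionOf, Algebra.TensorProduct.one_def]
  add_mem' := by
    intro a b ha hb
    simp only [Set.mem_ofPred_eq] at ha hb ⊢
    rw [map_add, ha, hb, TensorProduct.tmul_add]
  zero_mem' := by simp
  algebraMap_mem' := by
    intro r
    have h : (leftCoactionOf π).coact 1 = π 1 ⊗ₜ[k] 1 := by
      simp [leftCoactionOf, Algebra.TensorProduct.one_def]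
    rw [Set.mem_ofPred_eq, Algebra.algebraMap_eq_smul_one, map_smul, h, TensorProduct.tmul_smul]

end Coinvariants

end Takeuchi

end

/-!
Throughout, `A` is the algebra of left coinvariants, `S` the antipode and `□` the cotensor product
over `C`.

**The comodules `P ⊗_A H`.** Transport along `S` turns the right `C`-comodule `H` into the
*twisted* comodule with the coaction `S(h) ↦ S(h₁) ⊗ π(h₂)`, which is linear for left
multiplication by `A` (`twistedCoaction_mul`). So `P ⊗_A H` is a right `C`-comodule for each right
`A`-module `P`. The Galois bijection `g ⊗ h ↦ g h₁ ⊗ h₂` identifies the cotensor product of the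
twisted comodule with `H` with `A ⊗ H`. As `? □ H` is right exact, it follows that
`p ⊗ h ↦ (p ⊗ S(h₁)) ⊗ h₂` is an isomorphism `P ⊗ H ≅ (P ⊗_A H) □ H` (`unitMap_injective`,
`exists_unitMap_eq`). Consequently, left faithful coflatness over `C` implies left faithful
flatness over `A` (`isLeftFaithfullyFlat_of_isFaithfullyCoflat`).

**Left faithful coflatness.** Two facts about a finite-dimensional right `C`-comodule `V` are used.
* Right flatness commutes `H ⊗_A ?` with cotensor products, so a nonzero colinear map
  `V → H ⊗_A H` yields a nonzero colinear map `V → H` (`exists_isColinear_ne_zero`).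
* If `f : V → H` is colinear and nonzero, take a finite-dimensional `H`-subcomodule `W` of `H`
  containing the image of `f`, and its left dual `X`. Then `f` induces a surjection from the
  comodule `X ⊗ V` onto the trivial comodule `k`, and by coflatness the element `1` of `k □ H = A`
  lifts to `(X ⊗ V) □ H`. In coordinates this gives `t j ∈ V □ H` and colinear maps `F j : V → H`
  for which the values of `v ⊗ h ↦ S(F j v) h` at `t j` add up to `1`
  (`exists_sum_antipode_mul_eq_one`). In particular `V □ H ≠ 0`.

Applied to finite-dimensional subcomodules of `H ⊗_A H`, these show that `x ↦ x₁ ⊗ S(x₂)` vanishes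
on the kernel of `π`: by the isomorphism above, a subcomodule annihilated by the multiplication
`H ⊗_A H → H` has zero cotensor product with `H` (`translationMap_eq_zero`). Hence `C` embeds into
the comodule `H ⊗_A H`. Every nonzero finite-dimensional `V` has a nonzero colinear map to `C`,
therefore to `H`, and so `V □ H ≠ 0` (`isFaithfullyCoflat`).

**The right-hand side.** The same embedding of `C` shows `H ⊗_A (H □ V) ≅ H ⊗ V` for left
`C`-comodules `V` (`cotensorCounit_injective`, `cotensorCounit_surjective`), so right faithful
flatness over `A` implies right faithful coflatness over `C` (`isRightFaithfullyCoflat`). What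
remains is that `H ⊗_A N ≠ 0` for every left `A`-module `N ≠ 0`.
* Given a coideal `R ≠ C` of finite codimension, apply the second fact to `V = C / R`. Since
  `H = C □ H → V □ H` is onto, the maps `v ⊗ h ↦ S(F j v) h` become right `A`-linear maps `H → A`
  whose images generate the unit ideal of `A` (`nontrivial_tensorOver_of_isRightCoideal`).
* If simple modules are finite-dimensional, `N` may be assumed so. If `H ⊗_A N = 0`, then
  `H ⊗_A (N ⊗ W) = 0` for every representation `W` of `H`, where `A` acts diagonally on `N ⊗ W`.
  For `W = N* ⊗_A H`, which is nonzero by left faithful flatness, the tensor given by dual bases is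
  a nonzero element of `N ⊗ W` on which `A` acts by the counit. But flatness does not allow
  `H ⊗_A ?` to kill such an element (`nontrivial_tensorOver_of_finiteDimensional`).
-/

noncomputable section

namespace Takeuchi

set_option linter.unusedSectionVars false

/-! ### Right comodules -/
section Generic
variable {k : Type u} [Field k] {C : Type v} [AddCommGroup C] [Module k C] [Coalgebra k C]

theorem rTensor_lTensor_apply {M M' N N' : Type*} [AddCommGroup M] [Module k M] [AddCommGroup M']
    [Module k M'] [AddCommGroup N] [Module k N] [AddCommGroup N'] [Module k N']
    (f : M →ₗ[k] M') (g : N →ₗ[k] N') (t : M ⊗[k] N) :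
    f.rTensor N' (g.lTensor M t) = g.lTensor M' (f.rTensor N t) := by
  rw [← LinearMap.comp_apply, ← LinearMap.comp_apply, LinearMap.rTensor_comp_lTensor,
    LinearMap.lTensor_comp_rTensor]

namespace RightCoaction
variable {V W Q : Type v} [AddCommGroup V] [Module k V] [AddCommGroup W] [Module k W]
  [AddCommGroup Q] [Module k Q]

theorem rTensor_assoc_natural (f : V →ₗ[k] W) (t : (V ⊗[k] C) ⊗[k] C) :
    TensorProduct.assoc k W C C ((f.rTensor C).rTensor C t) =
      f.rTensor (C ⊗[k] C) (TensorProduct.assoc k V C C t) := by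
  have : (TensorProduct.assoc k W C C).toLinearMap ∘ₗ (f.rTensor C).rTensor C =
      f.rTensor (C ⊗[k] C) ∘ₗ (TensorProduct.assoc k V C C).toLinearMap := by
    ext; simp
  exact LinearMap.congr_fun this t

theorem coassoc_apply (ρ : RightCoaction k C V) (v : V) :
    TensorProduct.assoc k V C C (ρ.coact.rTensor C (ρ.coact v)) =
      (Coalgebra.comul (R := k) (A := C)).lTensor V (ρ.coact v) :=
  LinearMap.congr_fun ρ.coassoc v

theorem counit_coact_apply (ρ : RightCoaction k C V) (v : V) :
    TensorProduct.rid k V ((Coalgebra.counit (R := k) (A := C)).lTensor V (ρ.coact v)) = v :=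
  LinearMap.congr_fun ρ.counit_coact v

theorem IsColinear.apply {ρ : RightCoaction k C V} {σ : RightCoaction k C W} {f : V →ₗ[k] W}
    (h : ρ.IsColinear σ f) (v : V) : σ.coact (f v) = f.rTensor C (ρ.coact v) :=
  LinearMap.congr_fun h v

/-- The comodule structure on the target of a surjection `q` along which the structure map
descends. -/
def ofSurjective (ρ : RightCoaction k C V) (q : V →ₗ[k] Q) (hq : Function.Surjective q)
    (δ : Q →ₗ[k] Q ⊗[k] C) (h : ∀ v, δ (q v) = q.rTensor C (ρ.coact v)) :
    RightCoaction k C Q where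
  coact := δ
  coassoc := by
    ext x
    obtain ⟨v, rfl⟩ := hq x
    have h' : δ ∘ₗ q = q.rTensor C ∘ₗ ρ.coact := LinearMap.ext h
    have h1 : δ.rTensor C (q.rTensor C (ρ.coact v)) =
        (q.rTensor C).rTensor C (ρ.coact.rTensor C (ρ.coact v)) := by
      rw [← LinearMap.rTensor_comp_apply, ← LinearMap.rTensor_comp_apply, h']
    simp only [LinearMap.comp_apply, LinearEquiv.coe_coe, h]
    rw [h1, rTensor_assoc_natural, coassoc_apply, rTensor_lTensor_apply]
  counit_coact := by
    ext x
    obtain ⟨v, rfl⟩ := hq x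
    simp only [LinearMap.comp_apply, LinearEquiv.coe_coe, h, LinearMap.id_apply]
    rw [← LinearMap.comp_apply, LinearMap.lTensor_comp_rTensor, ← LinearMap.rTensor_comp_lTensor,
      LinearMap.comp_apply]
    have : ∀ t : V ⊗[k] k, TensorProduct.rid k Q (q.rTensor k t) = q (TensorProduct.rid k V t) := by
      intro t
      induction t with
      | zero => simp
      | tmul => simp
      | add x y hx hy => simp only [map_add, hx, hy]
    rw [this, counit_coact_apply]

/-- The comodule structure on the source of an injection `i` to which the structure map
restricts. -/
def ofInjective (σ : RightCoaction k C W) (i : V →ₗ[k] W) (hi : Function.Injective i)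
    (δ : V →ₗ[k] V ⊗[k] C) (h : ∀ v, σ.coact (i v) = i.rTensor C (δ v)) :
    RightCoaction k C V where
  coact := δ
  coassoc := by
    ext v
    have h' : σ.coact ∘ₗ i = i.rTensor C ∘ₗ δ := LinearMap.ext h
    apply Module.Flat.rTensor_preserves_injective_linearMap (M := C ⊗[k] C) i hi
    have h1 : (i.rTensor C).rTensor C (δ.rTensor C (δ v)) =
        σ.coact.rTensor C (i.rTensor C (δ v)) := by
      rw [← LinearMap.rTensor_comp_apply, ← LinearMap.rTensor_comp_apply, h']
    simp only [LinearMap.comp_apply, LinearEquiv.coe_coe]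
    rw [← rTensor_assoc_natural, h1, ← h, coassoc_apply, h, rTensor_lTensor_apply]
  counit_coact := by
    ext v
    apply hi
    have : ∀ t : V ⊗[k] k, i (TensorProduct.rid k V t) = TensorProduct.rid k W (i.rTensor k t) := by
      intro t
      induction t with
      | zero => simp
      | tmul => simp
      | add x y hx hy => simp only [map_add, hx, hy]
    simp only [LinearMap.comp_apply, LinearEquiv.coe_coe, LinearMap.id_apply]
    rw [this, ← LinearMap.comp_apply, LinearMap.rTensor_comp_lTensor,
      ← LinearMap.lTensor_comp_rTensor, LinearMap.comp_apply, ← h, counit_coact_apply]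

/-- A subspace `U` of a right comodule is a subcomodule: `ρ(U) ⊆ U ⊗ C`. -/
def IsSubcomodule (ρ : RightCoaction k C V) (U : Submodule k V) : Prop :=
  ∀ u ∈ U, ρ.coact u ∈ LinearMap.range (U.subtype.rTensor C)

theorem mem_range_rTensor_iff (U : Submodule k V) (t : V ⊗[k] C) :
    t ∈ LinearMap.range (U.subtype.rTensor C) ↔ U.mkQ.rTensor C t = 0 := by
  have := Module.Flat.rTensor_exact C (f := U.subtype) (g := U.mkQ)
    (LinearMap.exact_subtype_mkQ U)
  exact (this t).symm

/-- The restriction of a coaction to a subcomodule. -/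
def sub (ρ : RightCoaction k C V) (U : Submodule k V) (hU : ρ.IsSubcomodule U) :
    RightCoaction k C U :=
  ofInjective ρ U.subtype U.injective_subtype
    ((LinearEquiv.ofInjective (U.subtype.rTensor C)
      (Module.Flat.rTensor_preserves_injective_linearMap _ U.injective_subtype)).symm.toLinearMap ∘ₗ
      (ρ.coact ∘ₗ U.subtype).codRestrict _ (fun u => hU u u.2)) (by
    intro v
    simp only [LinearMap.comp_apply, LinearEquiv.coe_coe]
    rw [← LinearEquiv.ofInjective_apply (h := Module.Flat.rTensor_preserves_injective_linearMap _
      U.injective_subtype), LinearEquiv.apply_symm_apply]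
    rfl)

theorem sub_isColinear (ρ : RightCoaction k C V) (U : Submodule k V) (hU : ρ.IsSubcomodule U) :
    (ρ.sub U hU).IsColinear ρ U.subtype := by
  ext v
  simp only [LinearMap.comp_apply, sub, ofInjective, LinearEquiv.coe_coe]
  rw [← LinearEquiv.ofInjective_apply (h := Module.Flat.rTensor_preserves_injective_linearMap _
      U.injective_subtype), LinearEquiv.apply_symm_apply]
  rfl

/-- The quotient of a right comodule by a subcomodule. -/
def quot (ρ : RightCoaction k C V) (U : Submodule k V) (hU : ρ.IsSubcomodule U) :
    RightCoaction k C (V ⧸ U) :=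
  ofSurjective ρ U.mkQ U.mkQ_surjective
    (U.liftQ (U.mkQ.rTensor C ∘ₗ ρ.coact) (fun u hu => by
      simpa using (mem_range_rTensor_iff U _).1 (hU u hu)))
    (fun v => by simp)

theorem quot_isColinear (ρ : RightCoaction k C V) (U : Submodule k V) (hU : ρ.IsSubcomodule U) :
    ρ.IsColinear (ρ.quot U hU) U.mkQ := by
  ext v
  simp [quot, ofSurjective]

theorem isSubcomodule_ker {ρ : RightCoaction k C V} {σ : RightCoaction k C W} {f : V →ₗ[k] W}
    (hf : ρ.IsColinear σ f) : ρ.IsSubcomodule (LinearMap.ker f) := by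
  intro u hu
  have := Module.Flat.rTensor_exact C (f := (LinearMap.ker f).subtype) (g := f)
    (LinearMap.exact_subtype_ker_map f)
  exact (this _).1 (by rw [← hf.apply, LinearMap.mem_ker.1 hu, map_zero])

theorem isSubcomodule_range {ρ : RightCoaction k C V} {σ : RightCoaction k C W} {f : V →ₗ[k] W}
    (hf : ρ.IsColinear σ f) : σ.IsSubcomodule (LinearMap.range f) := by
  rintro _ ⟨v, rfl⟩
  refine ⟨f.rangeRestrict.rTensor C (ρ.coact v), ?_⟩
  rw [hf.apply, ← LinearMap.comp_apply, ← LinearMap.rTensor_comp]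
  rfl

/-- The slice `v ⊗ c ↦ φ(c) v` of an element of `V ⊗ C`. -/
def slice (φ : C →ₗ[k] k) : V ⊗[k] C →ₗ[k] V :=
  (TensorProduct.rid k V).toLinearMap ∘ₗ φ.lTensor V

@[simp] theorem slice_tmul (φ : C →ₗ[k] k) (v : V) (c : C) : slice φ (v ⊗ₜ[k] c) = φ c • v := by
  simp [slice]

theorem slice_rTensor (φ : C →ₗ[k] k) (f : V →ₗ[k] W) (t : V ⊗[k] C) :
    slice φ (f.rTensor C t) = f (slice φ t) := by
  induction t with
  | zero => simp
  | tmul => simp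
  | add x y hx hy => simp only [map_add, hx, hy]

theorem slice_counit (ρ : RightCoaction k C V) (v : V) :
    slice (Coalgebra.counit (R := k) (A := C)) (ρ.coact v) = v := ρ.counit_coact_apply v

theorem eq_zero_of_slice {t : V ⊗[k] C} (h : ∀ φ : C →ₗ[k] k, slice φ t = 0) : t = 0 := by
  classical
  let b := Module.Basis.ofVectorSpace k C
  let e := TensorProduct.equivFinsuppOfBasisRight (M := V) b
  apply e.injective
  rw [map_zero]
  ext i
  have : ∀ t : V ⊗[k] C, e t i = slice (b.coord i) t := by
    intro t
    induction t with
    | zero => simp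
    | tmul x y => simp [e]
    | add x y hx hy => simp only [map_add, Finsupp.add_apply, hx, hy]
  rw [this, h]; rfl

/-- An element of `V ⊗ C` lies in `U ⊗ C` as soon as all its slices lie in `U`. -/
theorem mem_range_of_slice (U : Submodule k V) {t : V ⊗[k] C}
    (h : ∀ φ : C →ₗ[k] k, slice φ t ∈ U) : t ∈ LinearMap.range (U.subtype.rTensor C) := by
  rw [mem_range_rTensor_iff]
  apply eq_zero_of_slice
  intro φ
  rw [slice_rTensor]
  simpa using h φ

theorem slice_coact_slice (ρ : RightCoaction k C V) (φ ψ : C →ₗ[k] k) (v : V) :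
    slice ψ (ρ.coact (slice φ (ρ.coact v))) =
      slice (LinearMap.mul' k k ∘ₗ TensorProduct.map ψ φ ∘ₗ Coalgebra.comul) (ρ.coact v) := by
  have h1 : ∀ t : V ⊗[k] C, slice ψ (ρ.coact (slice φ t)) =
      TensorProduct.rid k V ((LinearMap.mul' k k ∘ₗ TensorProduct.map ψ φ).lTensor V
        (TensorProduct.assoc k V C C (ρ.coact.rTensor C t))) := by
    intro t
    induction t with
    | zero => simp
    | add x y hx hy => simp only [map_add, hx, hy]
    | tmul x y =>
      simp only [slice_tmul, map_smul, LinearMap.rTensor_tmul]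
      generalize ρ.coact x = s
      induction s with
      | zero => simp
      | add x y hx hy => simp only [map_add, hx, hy, smul_add, TensorProduct.add_tmul]
      | tmul p q => simp [smul_smul, mul_comm]
  rw [h1, coassoc_apply, ← LinearMap.comp_apply, ← LinearMap.lTensor_comp]
  rfl

/-- The subcomodule generated by a set, given as the span of all slices of `ρ(v)` for `v` in the
set. -/
def hull (ρ : RightCoaction k C V) (s : Set V) : Submodule k V :=
  Submodule.span k {x | ∃ v ∈ s, ∃ φ : C →ₗ[k] k, x = slice φ (ρ.coact v)}

theorem subset_hull (ρ : RightCoaction k C V) (s : Set V) : s ⊆ ρ.hull s := fun v hv =>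
  Submodule.subset_span ⟨v, hv, Coalgebra.counit, (slice_counit ρ v).symm⟩

theorem isSubcomodule_hull (ρ : RightCoaction k C V) (s : Set V) :
    ρ.IsSubcomodule (ρ.hull s) := by
  intro u hu
  refine mem_range_of_slice _ fun ψ => ?_
  induction hu using Submodule.span_induction with
  | zero => simp
  | add x y _ _ hx hy => simpa only [map_add] using add_mem hx hy
  | smul a x _ hx => simpa only [map_smul] using Submodule.smul_mem _ a hx
  | mem x hx =>
    obtain ⟨v, hv, φ, rfl⟩ := hx
    exact Submodule.subset_span ⟨v, hv, _, slice_coact_slice ρ φ ψ v⟩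

/-- The fundamental theorem of comodules: finitely many elements generate a finite-dimensional
subcomodule. -/
theorem finiteDimensional_hull (ρ : RightCoaction k C V) {s : Set V} (hs : s.Finite) :
    FiniteDimensional k (ρ.hull s) := by
  obtain ⟨M, hM, hsM⟩ := TensorProduct.exists_finite_submodule_left_of_setFinite
    (ρ.coact '' s) (hs.image _)
  have : ρ.hull s ≤ M := by
    refine Submodule.span_le.2 ?_
    rintro _ ⟨v, hv, φ, rfl⟩
    obtain ⟨t, ht⟩ := hsM ⟨v, hv, rfl⟩
    rw [← ht]
    rw [slice_rTensor]
    exact (slice φ t).2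
  exact Submodule.finiteDimensional_of_le this

theorem hull_le {ρ : RightCoaction k C V} {s : Set V} {U : Submodule k V}
    (hU : ρ.IsSubcomodule U) (hs : s ⊆ U) : ρ.hull s ≤ U := by
  refine Submodule.span_le.2 ?_
  rintro _ ⟨v, hv, φ, rfl⟩
  obtain ⟨t, ht⟩ := hU v (hs hv)
  rw [← ht, slice_rTensor]
  exact (slice φ t).2

/-- The comodule `P ⊗ V` for a vector space `P`, with the coaction of `V`. -/
def lTensor (P : Type v) [AddCommGroup P] [Module k P] (ρ : RightCoaction k C V) :
    RightCoaction k C (P ⊗[k] V) where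
  coact := (TensorProduct.assoc k P V C).symm.toLinearMap ∘ₗ ρ.coact.lTensor P
  coassoc := by
    ext p v
    have h := ρ.coassoc_apply v
    have h1 : ∀ t : V ⊗[k] C, TensorProduct.assoc k (P ⊗[k] V) C C
        (LinearMap.rTensor C ((TensorProduct.assoc k P V C).symm.toLinearMap ∘ₗ ρ.coact.lTensor P)
          ((TensorProduct.assoc k P V C).symm (p ⊗ₜ t))) =
        (TensorProduct.assoc k P V (C ⊗[k] C)).symm
          (p ⊗ₜ TensorProduct.assoc k V C C (ρ.coact.rTensor C t)) := by
      intro t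
      induction t with
      | zero => simp
      | add x y hx hy => simp only [map_add, hx, hy, TensorProduct.tmul_add]
      | tmul x y =>
        simp only [TensorProduct.assoc_symm_tmul, LinearMap.rTensor_tmul, LinearMap.comp_apply,
          LinearMap.lTensor_tmul, LinearEquiv.coe_coe]
        generalize ρ.coact x = s
        induction s with
        | zero => simp
        | add x y hx hy => simp only [map_add, hx, hy, TensorProduct.tmul_add,
            TensorProduct.add_tmul]
        | tmul p q => simp
    have h2 : ∀ t : V ⊗[k] C, (Coalgebra.comul (R := k) (A := C)).lTensor (P ⊗[k] V)
          ((TensorProduct.assoc k P V C).symm (p ⊗ₜ t)) =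
        (TensorProduct.assoc k P V (C ⊗[k] C)).symm
          (p ⊗ₜ (Coalgebra.comul (R := k) (A := C)).lTensor V t) := by
      intro t
      induction t with
      | zero => simp
      | add x y hx hy => simp only [map_add, hx, hy, TensorProduct.tmul_add]
      | tmul x y => simp
    simp only [TensorProduct.AlgebraTensorModule.curry_apply, TensorProduct.curry_apply,
        LinearMap.restrictScalars_self, LinearMap.comp_apply, LinearMap.lTensor_tmul,
        LinearEquiv.coe_coe]
    rw [h1, h2, h]
  counit_coact := by
    ext p v
    have h1 : ∀ t : V ⊗[k] C, TensorProduct.rid k (P ⊗[k] V)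
          ((Coalgebra.counit (R := k) (A := C)).lTensor (P ⊗[k] V)
          ((TensorProduct.assoc k P V C).symm (p ⊗ₜ t))) =
          p ⊗ₜ TensorProduct.rid k V ((Coalgebra.counit (R := k) (A := C)).lTensor V t) := by
      intro t
      induction t with
      | zero => simp
      | add x y hx hy => simp only [map_add, hx, hy, TensorProduct.tmul_add]
      | tmul x y => simp
    simp only [TensorProduct.AlgebraTensorModule.curry_apply, TensorProduct.curry_apply,
        LinearMap.restrictScalars_self, LinearMap.comp_apply, LinearMap.lTensor_tmul,
        LinearEquiv.coe_coe, h1, counit_coact_apply, LinearMap.id_apply]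

/-- A vector space with the trivial coaction given by a group-like element `g`. -/
def trivial (V : Type v) [AddCommGroup V] [Module k V] (g : C)
    (hg : Coalgebra.comul (R := k) g = g ⊗ₜ[k] g) (hg' : Coalgebra.counit (R := k) g = 1) :
    RightCoaction k C V where
  coact := (TensorProduct.mk k V C).flip g
  coassoc := by ext v; simp [hg]
  counit_coact := by ext v; simp [hg']

end RightCoaction
end Generic

/-! ### Cotensor products and coflatness -/
section Cotensor
variable {k : Type u} [Field k] {C : Type v} [AddCommGroup C] [Module k C] [Coalgebra k C]
variable {V W Q M N : Type v} [AddCommGroup V] [Module k V] [AddCommGroup W] [Module k W]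
  [AddCommGroup Q] [Module k Q] [AddCommGroup M] [Module k M] [AddCommGroup N] [Module k N]

theorem mem_cotensor {ρ : RightCoaction k C V} {σ : LeftCoaction k C M} {t : V ⊗[k] M} :
    t ∈ cotensor ρ σ ↔
      TensorProduct.assoc k V C M (ρ.coact.rTensor M t) = σ.coact.lTensor V t := Iff.rfl

theorem rTensor_mem_cotensor {ρ : RightCoaction k C V} {τ : RightCoaction k C W}
    {σ : LeftCoaction k C M} {f : V →ₗ[k] W} (hf : ρ.IsColinear τ f) {t : V ⊗[k] M}
    (ht : t ∈ cotensor ρ σ) : f.rTensor M t ∈ cotensor τ σ :=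
  (cotensorMapLeft ρ τ σ f hf ⟨t, ht⟩).2

theorem lTensor_mem_cotensor {ρ : RightCoaction k C V} {σ : LeftCoaction k C M}
    {τ : LeftCoaction k C N} {f : M →ₗ[k] N} (hf : σ.IsColinear τ f) {t : V ⊗[k] M}
    (ht : t ∈ cotensor ρ σ) : f.lTensor V t ∈ cotensor ρ τ :=
  (cotensorMapRight ρ σ τ f hf ⟨t, ht⟩).2

theorem LeftCoaction.IsCoflat.exists_lift {σ : LeftCoaction k C M} (hσ : σ.IsCoflat)
    {ρ₁ : RightCoaction k C V} {ρ₂ : RightCoaction k C W} {ρ₃ : RightCoaction k C Q}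
    {f : V →ₗ[k] W} {g : W →ₗ[k] Q} (hf : ρ₁.IsColinear ρ₂ f) (hg : ρ₂.IsColinear ρ₃ g)
    (hfg : Function.Exact f g) {t : W ⊗[k] M} (ht : t ∈ cotensor ρ₂ σ)
    (h0 : g.rTensor M t = 0) : ∃ s ∈ cotensor ρ₁ σ, f.rTensor M s = t := by
  obtain ⟨s, hs⟩ := (hσ V W Q ρ₁ ρ₂ ρ₃ f g hf hg hfg ⟨t, ht⟩).1 (Subtype.ext h0)
  exact ⟨s.1, s.2, congrArg Subtype.val hs⟩

/-- The zero comodule. -/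
def RightCoaction.zero : RightCoaction k C PUnit.{v + 1} where
  coact := 0
  coassoc := by ext x; simp
  counit_coact := by ext x

/-- The functor `? □ M` of a coflat comodule `M` preserves surjections. -/
theorem LeftCoaction.IsCoflat.exists_lift_of_surjective {σ : LeftCoaction k C M} (hσ : σ.IsCoflat)
    {ρ₁ : RightCoaction k C V} {ρ₂ : RightCoaction k C W}
    {f : V →ₗ[k] W} (hf : ρ₁.IsColinear ρ₂ f) (hs : Function.Surjective f)
    {t : W ⊗[k] M} (ht : t ∈ cotensor ρ₂ σ) : ∃ s ∈ cotensor ρ₁ σ, f.rTensor M s = t := by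
  refine hσ.exists_lift (ρ₃ := RightCoaction.zero) (g := 0) hf ?_ ?_ ht ?_
  · ext x; simp [RightCoaction.zero]
  · intro x
    simpa using hs x
  · simp

/-- For a subcomodule `V` of `W`, the space `V □ M` is the intersection of `W □ M` with
`V ⊗ M`. -/
theorem mem_cotensor_of_injective {ρ : RightCoaction k C V} {τ : RightCoaction k C W}
    {σ : LeftCoaction k C M} {i : V →ₗ[k] W} (hi : ρ.IsColinear τ i)
    (hinj : Function.Injective i) {t : V ⊗[k] M} (ht : i.rTensor M t ∈ cotensor τ σ) :
    t ∈ cotensor ρ σ := by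
  rw [mem_cotensor] at ht ⊢
  apply Module.Flat.rTensor_preserves_injective_linearMap (M := C ⊗[k] M) i hinj
  have h2 : ∀ y : (V ⊗[k] C) ⊗[k] M, TensorProduct.assoc k W C M ((i.rTensor C).rTensor M y) =
      i.rTensor (C ⊗[k] M) (TensorProduct.assoc k V C M y) := by
    intro y
    rw [← LinearEquiv.coe_coe, ← LinearEquiv.coe_coe, ← LinearMap.comp_apply,
      ← LinearMap.comp_apply]
    congr 1
    ext a b c
    simp
  rw [← h2, ← LinearMap.rTensor_comp_apply, ← hi, LinearMap.rTensor_comp_apply, ht,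
    rTensor_lTensor_apply]

/-- The functor `? □ M` of a faithfully coflat comodule `M` reflects exactness. -/
theorem exact_of_cotensor {σ : LeftCoaction k C M} (hσ : σ.IsCoflat)
    (hf' : ∀ (V : Type v) [AddCommGroup V] [Module k V] (ρ : RightCoaction k C V),
      Nontrivial V → Nontrivial (cotensor ρ σ))
    {ρ₁ : RightCoaction k C V} {ρ₂ : RightCoaction k C W} {ρ₃ : RightCoaction k C Q}
    {f : V →ₗ[k] W} {g : W →ₗ[k] Q} (hf : ρ₁.IsColinear ρ₂ f) (hg : ρ₂.IsColinear ρ₃ g)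
    (hgf : g ∘ₗ f = 0)
    (h : ∀ t ∈ cotensor ρ₂ σ, g.rTensor M t = 0 → t ∈ LinearMap.range (f.rTensor M)) :
    Function.Exact f g := by
  intro y
  refine ⟨fun hy => ?_, fun ⟨x, hx⟩ => hx ▸ LinearMap.congr_fun hgf x⟩
  -- the homology `ker g'` of the sequence is a comodule; if it is nonzero, so is its cotensor
  -- product with `M`, which by coflatness is contained in that of the quotient `W ⧸ range f`
  have hR := RightCoaction.isSubcomodule_range hf
  set R := LinearMap.range f
  let τ := ρ₂.quot R hR
  let g' : (W ⧸ R) →ₗ[k] Q := R.liftQ g (by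
    rintro _ ⟨x, rfl⟩
    exact LinearMap.congr_fun hgf x)
  have hg' : τ.IsColinear ρ₃ g' := by
    apply LinearMap.ext
    intro z
    obtain ⟨w, rfl⟩ := R.mkQ_surjective z
    have h1 := (ρ₂.quot_isColinear R hR).apply w
    rw [LinearMap.comp_apply, LinearMap.comp_apply, h1, ← LinearMap.rTensor_comp_apply]
    have h2 : g' ∘ₗ R.mkQ = g := by ext; simp [g']
    rw [h2, ← hg.apply, ← h2]
    rfl
  have hK := RightCoaction.isSubcomodule_ker hg'
  by_contra hy'
  have hnt : Nontrivial (LinearMap.ker g') := by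
    refine ⟨⟨R.mkQ y, ?_⟩, 0, ?_⟩
    · simpa [g'] using hy
    · intro h0
      exact hy' ((Submodule.Quotient.mk_eq_zero R).1 (congrArg Subtype.val h0))
  have := hf' _ (τ.sub _ hK) hnt
  obtain ⟨t, ht⟩ := exists_ne (0 : cotensor (τ.sub _ hK) σ)
  have hti := rTensor_mem_cotensor (τ.sub_isColinear _ hK) t.2
  obtain ⟨s, hs, hst⟩ := hσ.exists_lift_of_surjective (ρ₂.quot_isColinear R hR)
    R.mkQ_surjective hti
  have hgs : g.rTensor M s = 0 := by
    have h2 : g' ∘ₗ R.mkQ = g := by ext; simp [g']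
    rw [← h2, LinearMap.rTensor_comp_apply, hst, ← LinearMap.rTensor_comp_apply]
    have : g' ∘ₗ (LinearMap.ker g').subtype = 0 := by ext x; exact x.2
    simp [this]
  obtain ⟨u, rfl⟩ := h s hs hgs
  apply ht
  apply Subtype.ext
  apply Module.Flat.rTensor_preserves_injective_linearMap (M := M) (LinearMap.ker g').subtype
    (Submodule.injective_subtype _)
  rw [← hst, ← LinearMap.rTensor_comp_apply]
  have : R.mkQ ∘ₗ f = 0 := by
    ext x
    exact (Submodule.Quotient.mk_eq_zero R).2 ⟨x, rfl⟩
  simp [this]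

end Cotensor

/-! ### Coefficient matrices of finite-dimensional comodules -/
section Comatrix
variable {k : Type u} [Field k] {C : Type v} [AddCommGroup C] [Module k C] [Coalgebra k C]
variable {V : Type v} [AddCommGroup V] [Module k V] {n : ℕ}

/-- The coefficients `c i j` of a comodule with basis `b`: `ρ(b j) = ∑ i, b i ⊗ c i j`. -/
def RightCoaction.coeff (ρ : RightCoaction k C V) (b : Module.Basis (Fin n) k V) (i j : Fin n) :
    C := TensorProduct.lid k C ((b.coord i).rTensor C (ρ.coact (b j)))

theorem RightCoaction.tensor_eq_sum (b : Module.Basis (Fin n) k V) (t : V ⊗[k] C) :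
    t = ∑ i, b i ⊗ₜ[k] TensorProduct.lid k C ((b.coord i).rTensor C t) := by
  induction t with
  | zero => simp
  | add x y hx hy =>
    simp only [map_add, TensorProduct.tmul_add, Finset.sum_add_distrib]
    rw [← hx, ← hy]
  | tmul v c =>
    simp only [LinearMap.rTensor_tmul, TensorProduct.lid_tmul, TensorProduct.tmul_smul,
      TensorProduct.smul_tmul', ← TensorProduct.sum_tmul]
    simp [b.sum_repr]

theorem RightCoaction.coact_basis (ρ : RightCoaction k C V) (b : Module.Basis (Fin n) k V)
    (j : Fin n) : ρ.coact (b j) = ∑ i, b i ⊗ₜ[k] ρ.coeff b i j :=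
  RightCoaction.tensor_eq_sum b _

/-- Comparison of coefficients in `V ⊗ X` with respect to a basis of `V`. -/
theorem basis_tmul_injective {X : Type*} [AddCommGroup X] [Module k X]
    (b : Module.Basis (Fin n) k V) {x y : Fin n → X}
    (h : ∑ i, b i ⊗ₜ[k] x i = ∑ i, b i ⊗ₜ[k] y i) (i : Fin n) : x i = y i := by
  have := congrArg (fun t => TensorProduct.lid k X ((b.coord i).rTensor X t)) h
  simpa [map_sum, Finsupp.single_apply, ite_smul] using this

theorem RightCoaction.comul_coeff (ρ : RightCoaction k C V) (b : Module.Basis (Fin n) k V)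
    (i j : Fin n) : Coalgebra.comul (R := k) (ρ.coeff b i j) =
      ∑ l, ρ.coeff b i l ⊗ₜ[k] ρ.coeff b l j := by
  have h := ρ.coassoc_apply (b j)
  rw [ρ.coact_basis b j] at h
  simp only [map_sum, LinearMap.rTensor_tmul, LinearMap.lTensor_tmul, ρ.coact_basis b,
    TensorProduct.sum_tmul, TensorProduct.assoc_tmul] at h
  rw [Finset.sum_comm] at h
  simp only [← TensorProduct.tmul_sum] at h
  exact (basis_tmul_injective b h i).symm

theorem RightCoaction.counit_coeff (ρ : RightCoaction k C V) (b : Module.Basis (Fin n) k V)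
    (i j : Fin n) : Coalgebra.counit (R := k) (ρ.coeff b i j) = if i = j then 1 else 0 := by
  have h := ρ.counit_coact_apply (b j)
  rw [ρ.coact_basis b j] at h
  simp only [map_sum, LinearMap.lTensor_tmul, TensorProduct.rid_tmul] at h
  have := congrArg (b.repr · i) h
  simpa [Finsupp.single_apply, eq_comm] using this

end Comatrix

/-! ### The antipode -/
section Antipode
variable {k : Type u} [Field k] {H : Type v} [Ring H] [HopfAlgebra k H]

open Coalgebra HopfAlgebra

/-- `S(y₁) y₂ ⊗ y₃ = 1 ⊗ y`. -/
theorem antipode_mul_tmul (y : H) :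
    (LinearMap.mul' k H ∘ₗ (antipode k).rTensor H).rTensor H
      ((TensorProduct.assoc k H H H).symm (comul.lTensor H (comul (R := k) y))) =
      (1 : H) ⊗ₜ[k] y := by
  rw [coassoc_symm_apply, ← LinearMap.rTensor_comp_apply, LinearMap.comp_assoc,
    mul_antipode_rTensor_comul, LinearMap.rTensor_comp_apply, rTensor_counit_comul]
  simp

/-- `y₁ S(y₂) ⊗ y₃ = 1 ⊗ y`. -/
theorem mul_antipode_tmul (y : H) :
    (LinearMap.mul' k H ∘ₗ (antipode k).lTensor H).rTensor H
      ((TensorProduct.assoc k H H H).symm (comul.lTensor H (comul (R := k) y))) =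
      (1 : H) ⊗ₜ[k] y := by
  rw [coassoc_symm_apply, ← LinearMap.rTensor_comp_apply, LinearMap.comp_assoc,
    mul_antipode_lTensor_comul, LinearMap.rTensor_comp_apply, rTensor_counit_comul]
  simp

/-- `y₁ ⊗ S(y₂) y₃ = y ⊗ 1`. -/
theorem tmul_antipode_mul (y : H) :
    (LinearMap.mul' k H ∘ₗ (antipode k).rTensor H).lTensor H
      (TensorProduct.assoc k H H H (comul.rTensor H (comul (R := k) y))) =
      y ⊗ₜ[k] (1 : H) := by
  rw [coassoc_apply, ← LinearMap.lTensor_comp_apply, LinearMap.comp_assoc,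
    mul_antipode_rTensor_comul, LinearMap.lTensor_comp_apply, lTensor_counit_comul]
  simp

/-- `y₁ ⊗ y₂ S(y₃) = y ⊗ 1`. -/
theorem tmul_mul_antipode (y : H) :
    (LinearMap.mul' k H ∘ₗ (antipode k).lTensor H).lTensor H
      (TensorProduct.assoc k H H H (comul.rTensor H (comul (R := k) y))) =
      y ⊗ₜ[k] (1 : H) := by
  rw [coassoc_apply, ← LinearMap.lTensor_comp_apply, LinearMap.comp_assoc,
    mul_antipode_lTensor_comul, LinearMap.lTensor_comp_apply, lTensor_counit_comul]
  simp

/-- The antipode reverses the comultiplication. -/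
theorem comul_antipode (x : H) : comul (R := k) (antipode k x) =
    TensorProduct.map (antipode k) (antipode k) (TensorProduct.comm k H H (comul x)) := by
  let G : H →ₗ[k] H ⊗[k] H := TensorProduct.map (antipode k) (antipode k) ∘ₗ
    (TensorProduct.comm k H H).toLinearMap ∘ₗ comul
  have key : WithConv.toConv G * WithConv.toConv (comul (R := k) (A := H)) = 1 := by
    ext x
    rw [LinearMap.convMul_apply, LinearMap.convOne_apply]
    -- `G(x₁) Δ(x₂) = (1 ⊗ S(x₁)) · (S(x₂) x₃ ⊗ x₄)`
    let L : H ⊗[k] H →ₗ[k] H ⊗[k] H :=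
      (LinearMap.mul' k H ∘ₗ (antipode k).rTensor H).rTensor H ∘ₗ
        (TensorProduct.assoc k H H H).symm.toLinearMap ∘ₗ comul.lTensor H
    have hL : L ∘ₗ comul = TensorProduct.mk k H H 1 := LinearMap.ext antipode_mul_tmul
    have h1 : ∀ t : H ⊗[k] H, LinearMap.mul' k (H ⊗[k] H) (TensorProduct.map G comul t) =
        LinearMap.mul' k (H ⊗[k] H) (TensorProduct.map (TensorProduct.mk k H H 1 ∘ₗ antipode k) L
          (TensorProduct.assoc k H H H (comul.rTensor H t))) := by
      intro t
      induction t with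
      | zero => simp
      | add x y hx hy => simp only [map_add, hx, hy]
      | tmul p q =>
        simp only [TensorProduct.map_tmul, LinearMap.rTensor_tmul, G, L, LinearMap.comp_apply,
          LinearEquiv.coe_coe]
        generalize comul (R := k) p = s
        induction s with
        | zero => simp
        | add x y hx hy => simp only [map_add, TensorProduct.add_tmul, hx, hy]
        | tmul a b =>
          simp only [TensorProduct.comm_tmul, TensorProduct.map_tmul, TensorProduct.assoc_tmul,
            LinearMap.comp_apply, LinearMap.lTensor_tmul, LinearMap.mul'_apply]
          generalize comul (R := k) q = r
          induction r with
          | zero => simp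
          | add x y hx hy => simp only [map_add, TensorProduct.tmul_add, mul_add, hx, hy]
          | tmul c d => simp
    have h2 : ∀ t : H ⊗[k] H,
        LinearMap.mul' k (H ⊗[k] H) (TensorProduct.map (TensorProduct.mk k H H 1 ∘ₗ antipode k)
          (TensorProduct.mk k H H 1) t) =
        TensorProduct.mk k H H 1 (LinearMap.mul' k H ((antipode k).rTensor H t)) := by
      intro t
      induction t with
      | zero => simp
      | add x y hx hy => simp only [map_add, hx, hy]
      | tmul a b => simp
    rw [h1, coassoc_apply, ← LinearMap.comp_apply (TensorProduct.map _ _),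
      LinearMap.map_comp_lTensor, hL, h2, mul_antipode_rTensor_comul_apply]
    simp [Algebra.algebraMap_eq_smul_one,
      Algebra.TensorProduct.one_def]
  have := left_inv_eq_right_inv key LinearMap.comul_right_inv
  exact (LinearMap.congr_fun (congrArg WithConv.ofConv this) x).symm

end Antipode

/-! ### The Galois map and the twisted comodule -/
section Twisted
variable {k : Type u} [Field k] {H : Type v} [Ring H] [HopfAlgebra k H]
  {C : Type v} [AddCommGroup C] [Module k C] [Coalgebra k C] [Module H C] [IsScalarTower k H C]

open Coalgebra HopfAlgebra

/-- The map `g ⊗ h ↦ g h₁ ⊗ h₂`. -/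
def galoisMap : H ⊗[k] H →ₗ[k] H ⊗[k] H :=
  (LinearMap.mul' k H).rTensor H ∘ₗ (TensorProduct.assoc k H H H).symm.toLinearMap ∘ₗ
    comul.lTensor H

/-- The map `g ⊗ h ↦ g S(h₁) ⊗ h₂`. -/
def galoisInv : H ⊗[k] H →ₗ[k] H ⊗[k] H :=
  (LinearMap.mul' k H ∘ₗ (antipode k).lTensor H).rTensor H ∘ₗ
    (TensorProduct.assoc k H H H).symm.toLinearMap ∘ₗ comul.lTensor H

theorem galoisMap_tmul (g h : H) :
    galoisMap (k := k) (g ⊗ₜ h) = (LinearMap.mulLeft k g).rTensor H (comul h) := by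
  simp only [galoisMap, LinearMap.comp_apply, LinearMap.lTensor_tmul, LinearEquiv.coe_coe]
  generalize comul (R := k) h = t
  induction t with
  | zero => simp
  | add x y hx hy => simp only [map_add, TensorProduct.tmul_add, hx, hy]
  | tmul a b => simp

theorem galoisInv_tmul (g h : H) : galoisInv (k := k) (g ⊗ₜ h) =
    (LinearMap.mulLeft k g).rTensor H ((antipode k).rTensor H (comul h)) := by
  simp only [galoisInv, LinearMap.comp_apply, LinearMap.lTensor_tmul, LinearEquiv.coe_coe]
  generalize comul (R := k) h = t
  induction t with
  | zero => simp
  | add x y hx hy => simp only [map_add, TensorProduct.tmul_add, hx, hy]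
  | tmul a b => simp

theorem galoisMap_mulLeft (g : H) (t : H ⊗[k] H) :
    galoisMap ((LinearMap.mulLeft k g).rTensor H t) =
      (LinearMap.mulLeft k g).rTensor H (galoisMap t) := by
  induction t with
  | zero => simp
  | add x y hx hy => simp only [map_add, hx, hy]
  | tmul a b =>
    rw [LinearMap.rTensor_tmul, galoisMap_tmul, galoisMap_tmul, LinearMap.mulLeft_apply,
      LinearMap.mulLeft_mul, LinearMap.rTensor_comp_apply]

theorem galoisInv_mulLeft (g : H) (t : H ⊗[k] H) :
    galoisInv ((LinearMap.mulLeft k g).rTensor H t) =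
      (LinearMap.mulLeft k g).rTensor H (galoisInv t) := by
  induction t with
  | zero => simp
  | add x y hx hy => simp only [map_add, hx, hy]
  | tmul a b =>
    rw [LinearMap.rTensor_tmul, galoisInv_tmul, galoisInv_tmul, LinearMap.mulLeft_apply,
      LinearMap.mulLeft_mul, LinearMap.rTensor_comp_apply]

theorem galoisMap_galoisInv (t : H ⊗[k] H) : galoisMap (galoisInv t) = t := by
  induction t with
  | zero => simp
  | add x y hx hy => simp only [map_add, hx, hy]
  | tmul g h =>
    rw [galoisInv_tmul, galoisMap_mulLeft]
    have h1 : ∀ t : H ⊗[k] H, galoisMap ((antipode k).rTensor H t) =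
        (LinearMap.mul' k H ∘ₗ (antipode k).rTensor H).rTensor H
          ((TensorProduct.assoc k H H H).symm (comul.lTensor H t)) := by
      intro t
      induction t with
      | zero => simp
      | add x y hx hy => simp only [map_add, hx, hy]
      | tmul a b =>
        simp only [LinearMap.rTensor_tmul, galoisMap_tmul, LinearMap.lTensor_tmul]
        generalize comul (R := k) b = s
        induction s with
        | zero => simp
        | add x y hx hy => simp only [map_add, TensorProduct.tmul_add, hx, hy]
        | tmul a b => simp
    rw [h1, antipode_mul_tmul]
    simp

theorem galoisInv_galoisMap (t : H ⊗[k] H) : galoisInv (galoisMap t) = t := by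
  induction t with
  | zero => simp
  | add x y hx hy => simp only [map_add, hx, hy]
  | tmul g h =>
    rw [galoisMap_tmul, galoisInv_mulLeft, galoisInv, LinearMap.comp_apply, LinearMap.comp_apply,
      LinearEquiv.coe_coe, mul_antipode_tmul]
    simp

/-- The action `H ⊗ C → C`. -/
def actionMap : H ⊗[k] C →ₗ[k] C :=
  TensorProduct.lift (Algebra.lsmul k k C : H →ₐ[k] _).toLinearMap

@[simp] theorem actionMap_tmul (h : H) (c : C) : actionMap (k := k) (h ⊗ₜ c) = h • c := rfl

/-- The map `g ⊗ c ↦ g₁ c ⊗ g₂`. -/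
def diagMap : H ⊗[k] C →ₗ[k] C ⊗[k] H :=
  (actionMap (k := k)).rTensor H ∘ₗ (TensorProduct.rightComm k H H C).toLinearMap ∘ₗ
    (comul (R := k) (A := H)).rTensor C

variable (π : H →ₗc[k] C)

theorem diagMap_tmul (hπ : ∀ h x : H, π (h * x) = h • π x) (g x : H) :
    diagMap (k := k) (g ⊗ₜ π x) =
      ((π : H →ₗ[k] C) ∘ₗ LinearMap.mulRight k x).rTensor H (comul (R := k) g) := by
  simp only [diagMap, LinearMap.comp_apply, LinearMap.rTensor_tmul, LinearEquiv.coe_coe]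
  generalize comul (R := k) g = t
  induction t with
  | zero => simp
  | add x y hx hy => simp only [map_add, TensorProduct.add_tmul, hx, hy]
  | tmul a b => simp [hπ]

variable (hS : Function.Bijective (antipode k (A := H)))

/-- The antipode as a linear automorphism. -/
def antipodeEquiv : H ≃ₗ[k] H := LinearEquiv.ofBijective (antipode k) hS

/-- The right `C`-comodule `H` with the structure map `S(h) ↦ S(h₁) ⊗ π(h₂)`; it is obtained from
`rightCoactionOf π` by transport along the antipode. -/
def twistedCoaction : RightCoaction k C H :=
  (rightCoactionOf π).ofSurjective (antipode k) hS.2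
    ((antipode k).rTensor C ∘ₗ (rightCoactionOf π).coact ∘ₗ (antipodeEquiv hS).symm.toLinearMap)
    (fun v => by
      simp only [LinearMap.comp_apply, LinearEquiv.coe_coe]
      rw [show antipode k v = antipodeEquiv hS v from rfl, LinearEquiv.symm_apply_apply])

theorem twistedCoaction_isColinear :
    (rightCoactionOf π).IsColinear (twistedCoaction π hS) (antipode k) := by
  ext v
  simp only [twistedCoaction, RightCoaction.ofSurjective, LinearMap.comp_apply,
    LinearEquiv.coe_coe]
  rw [show antipode k v = antipodeEquiv hS v from rfl, LinearEquiv.symm_apply_apply]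

theorem twistedCoaction_antipode (x : H) : (twistedCoaction π hS).coact (antipode k x) =
    TensorProduct.map (antipode k) (π : H →ₗ[k] C) (comul x) := by
  rw [(twistedCoaction_isColinear π hS).apply]
  simp only [rightCoactionOf, LinearMap.comp_apply]
  rw [← LinearMap.comp_apply, LinearMap.rTensor_comp_lTensor]

/-- If `∑ g' ⊗ c` is the twisted coaction of `g`, then `∑ g'₁ c ⊗ g'₂ = π(1) ⊗ g`. -/
theorem diagMap_twistedCoaction (hπ : ∀ h x : H, π (h * x) = h • π x) (g : H) :
    diagMap ((twistedCoaction π hS).coact g) = π 1 ⊗ₜ[k] g := by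
  obtain ⟨h, rfl⟩ := hS.2 g
  rw [twistedCoaction_antipode]
  have h1 : ∀ t : H ⊗[k] H, diagMap (TensorProduct.map (antipode k) (π : H →ₗ[k] C) t) =
      TensorProduct.map (π : H →ₗ[k] C) (antipode k) (TensorProduct.comm k H H
        ((LinearMap.mul' k H ∘ₗ (antipode k).rTensor H).lTensor H
      (TensorProduct.assoc k H H H (comul.rTensor H t)))) := by
    intro t
    induction t with
    | zero => simp
    | add x y hx hy => simp only [map_add, hx, hy]
    | tmul a b =>
      simp only [TensorProduct.map_tmul, LinearMap.rTensor_tmul, LinearMap.coe_coe]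
      rw [diagMap_tmul π hπ, comul_antipode]
      generalize comul (R := k) a = s
      induction s with
      | zero => simp
      | add x y hx hy => simp only [map_add, TensorProduct.add_tmul, hx, hy]
      | tmul a b => simp
  rw [h1, tmul_antipode_mul]
  simp

theorem mem_leftCoinvariants {hπ : ∀ h x : H, π (h * x) = h • π x} {a : H} :
    a ∈ leftCoinvariants π hπ ↔ (leftCoactionOf π).coact a = π 1 ⊗ₜ[k] a := Iff.rfl

/-- If `S(b)` is a left coinvariant, then `b` is a right coinvariant. -/
theorem rightCoinvariant_of_antipode_mem (hS : Function.Injective (antipode k (A := H)))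
    (hπ : ∀ h x : H, π (h * x) = h • π x) {b : H}
    (hb : antipode k b ∈ leftCoinvariants π hπ) :
    (rightCoactionOf π).coact b = b ⊗ₜ[k] π 1 := by
  rw [mem_leftCoinvariants] at hb
  simp only [leftCoactionOf, LinearMap.comp_apply, comul_antipode] at hb
  have h0 : ((π : H →ₗ[k] C) ∘ₗ antipode k).rTensor H (TensorProduct.comm k H H (comul b)) =
      π 1 ⊗ₜ[k] b := by
    apply Module.Flat.lTensor_preserves_injective_linearMap (M := C) (antipode k) hS
    rw [LinearMap.lTensor_tmul, ← hb, ← rTensor_lTensor_apply, LinearMap.rTensor_comp_apply,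
      ← LinearMap.comp_apply (LinearMap.rTensor H (antipode k)),
      LinearMap.rTensor_comp_lTensor]
  let Ω : C ⊗[k] H →ₗ[k] H ⊗[k] C := (actionMap (k := k)).lTensor H ∘ₗ
    (TensorProduct.assoc k H H C).toLinearMap ∘ₗ (comul (R := k) (A := H)).rTensor C ∘ₗ
    (TensorProduct.comm k C H).toLinearMap
  have hΩ : ∀ x h : H, Ω (π x ⊗ₜ h) =
      (π : H →ₗ[k] C).lTensor H ((LinearMap.mulRight k x).lTensor H (comul h)) := by
    intro x h
    simp only [Ω, LinearMap.comp_apply, LinearEquiv.coe_coe, TensorProduct.comm_tmul,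
      LinearMap.rTensor_tmul]
    generalize comul (R := k) h = t
    induction t with
    | zero => simp
    | add x y hx hy => simp only [map_add, TensorProduct.add_tmul, hx, hy]
    | tmul a b => simp [hπ]
  have h1 : ∀ t : H ⊗[k] H,
      Ω (((π : H →ₗ[k] C) ∘ₗ antipode k).rTensor H (TensorProduct.comm k H H t)) =
      (π : H →ₗ[k] C).lTensor H ((LinearMap.mul' k H ∘ₗ (antipode k).lTensor H).lTensor H
      (TensorProduct.assoc k H H H (comul.rTensor H t))) := by
    intro t
    induction t with
    | zero => simp
    | add x y hx hy => simp only [map_add, hx, hy]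
    | tmul a b =>
      simp only [TensorProduct.comm_tmul, LinearMap.rTensor_tmul, LinearMap.comp_apply,
        LinearMap.coe_coe]
      rw [hΩ]
      generalize comul (R := k) a = s
      induction s with
      | zero => simp
      | add x y hx hy => simp only [map_add, TensorProduct.add_tmul, hx, hy]
      | tmul a b => simp
  have h2 := congrArg Ω h0
  rw [h1, tmul_mul_antipode, hΩ] at h2
  simpa [rightCoactionOf] using h2.symm

/-- The twisted coaction is linear for left multiplication by left coinvariants. -/
theorem twistedCoaction_mul (hπ : ∀ h x : H, π (h * x) = h • π x) {a : H}
    (ha : a ∈ leftCoinvariants π hπ) (g : H) : (twistedCoaction π hS).coact (a * g) =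
      (LinearMap.mulLeft k a).rTensor C ((twistedCoaction π hS).coact g) := by
  obtain ⟨b, rfl⟩ := hS.2 a
  obtain ⟨h, rfl⟩ := hS.2 g
  have hb := rightCoinvariant_of_antipode_mem π hS.1 hπ ha
  rw [← antipode_mul_antidistrib, twistedCoaction_antipode, twistedCoaction_antipode,
    Bialgebra.comul_mul]
  simp only [rightCoactionOf, LinearMap.comp_apply] at hb
  have h1 : ∀ p q : H, ∀ t : H ⊗[k] H, TensorProduct.map (antipode k) (π : H →ₗ[k] C)
      ((p ⊗ₜ q) * t) = TensorProduct.map (antipode k ∘ₗ LinearMap.mulLeft k p)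
        (Algebra.lsmul k k C q) ((π : H →ₗ[k] C).lTensor H t) := by
    intro p q t
    induction t with
    | zero => simp
    | add x y hx hy => simp only [map_add, mul_add, hx, hy]
    | tmul a b => simp [hπ]
  generalize comul (R := k) h = s
  induction s with
  | zero => simp
  | add x y hx hy => simp only [map_add, add_mul, hx, hy]
  | tmul p q =>
    rw [h1, hb]
    simp [antipode_mul_antidistrib, ← hπ]

/-- The effect of the left coaction on the first factor of `g h₁ ⊗ h₂`: it is
`g₁ π(h₁) ⊗ (g₂ h₂ ⊗ h₃)`. -/
theorem assoc_coact_galoisMap (hπ : ∀ h x : H, π (h * x) = h • π x) (g h : H) :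
    TensorProduct.assoc k C H H ((leftCoactionOf π).coact.rTensor H (galoisMap (g ⊗ₜ h))) =
      galoisMap.lTensor C (TensorProduct.assoc k C H H (diagMap.rTensor H
        ((TensorProduct.assoc k H C H).symm (g ⊗ₜ (leftCoactionOf π).coact h)))) := by
  let X (t : H ⊗[k] H) : H ⊗[k] (H ⊗[k] H) →ₗ[k] C ⊗[k] (H ⊗[k] H) :=
    (π : H →ₗ[k] C).rTensor (H ⊗[k] H) ∘ₗ
      LinearMap.mul k _ (TensorProduct.assoc k H H H (t ⊗ₜ 1))
  have h1 : ∀ s : H ⊗[k] H, TensorProduct.assoc k C H H ((leftCoactionOf π).coact.rTensor H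
      ((LinearMap.mulLeft k g).rTensor H s)) =
      X (comul g) (TensorProduct.assoc k H H H (comul.rTensor H s)) := by
    intro s
    induction s with
    | zero => simp
    | add x y hx hy => simp only [map_add, hx, hy]
    | tmul a b =>
      simp only [LinearMap.rTensor_tmul, LinearMap.mulLeft_apply, leftCoactionOf,
        LinearMap.comp_apply, Bialgebra.comul_mul, X]
      generalize comul (R := k) g = t
      generalize comul (R := k) a = r
      induction t with
      | zero => simp
      | add x y hx hy => simp only [map_add, add_mul, TensorProduct.add_tmul,
          LinearMap.add_apply, hx, hy]
      | tmul p q =>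
        induction r with
        | zero => simp
        | add x y hx hy => simp only [map_add, mul_add, TensorProduct.add_tmul, hx, hy]
        | tmul a b => simp
  have h2 : ∀ s : H ⊗[k] H, galoisMap.lTensor C (TensorProduct.assoc k C H H (diagMap.rTensor H
        ((TensorProduct.assoc k H C H).symm (g ⊗ₜ (π : H →ₗ[k] C).rTensor H s)))) =
      X (comul g) (comul.lTensor H s) := by
    intro s
    induction s with
    | zero => simp
    | add x y hx hy => simp only [map_add, TensorProduct.tmul_add, hx, hy]
    | tmul a b =>
      simp only [LinearMap.rTensor_tmul, TensorProduct.assoc_symm_tmul, LinearMap.coe_coe,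
        diagMap_tmul π hπ, X, LinearMap.comp_apply, LinearMap.lTensor_tmul]
      generalize comul (R := k) g = t
      induction t with
      | zero => simp
      | add x y hx hy => simp only [map_add, TensorProduct.add_tmul,
          LinearMap.add_apply, hx, hy]
      | tmul p q =>
        simp only [LinearMap.rTensor_tmul, TensorProduct.assoc_tmul, LinearMap.lTensor_tmul,
          galoisMap_tmul, LinearMap.mul_apply']
        generalize comul (R := k) b = r
        induction r with
        | zero => simp
        | add x y hx hy => simp only [map_add, mul_add, TensorProduct.tmul_add, hx, hy]
        | tmul a b => simp
  rw [galoisMap_tmul, h1, coassoc_apply]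
  exact (h2 _).symm

/-- The bijection `g ⊗ h ↦ g h₁ ⊗ h₂` carries the cotensor product of the twisted comodule `H`
with `H` into `A ⊗ H`. -/
theorem galoisMap_mem (hπ : ∀ h x : H, π (h * x) = h • π x) {t : H ⊗[k] H}
    (ht : t ∈ cotensor (twistedCoaction π hS) (leftCoactionOf π)) :
    galoisMap t ∈ LinearMap.range
      ((Subalgebra.toSubmodule (leftCoinvariants π hπ)).subtype.rTensor H) := by
  let δ : H →ₗ[k] C ⊗[k] H := (leftCoactionOf π).coact - TensorProduct.mk k C H (π 1)
  have hex : Function.Exact (Subalgebra.toSubmodule (leftCoinvariants π hπ)).subtype δ := by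
    intro x
    simp [δ, sub_eq_zero, mem_leftCoinvariants]
  refine (Module.Flat.rTensor_exact H hex _).1 ?_
  rw [LinearMap.rTensor_sub, LinearMap.sub_apply, sub_eq_zero]
  apply (TensorProduct.assoc k C H H).injective
  have h1 : ∀ t : H ⊗[k] H, TensorProduct.assoc k C H H
      ((leftCoactionOf π).coact.rTensor H (galoisMap t)) =
      galoisMap.lTensor C (TensorProduct.assoc k C H H (diagMap.rTensor H
        ((TensorProduct.assoc k H C H).symm ((leftCoactionOf π).coact.lTensor H t)))) := by
    intro t
    induction t with
    | zero => simp
    | add x y hx hy => simp only [map_add, hx, hy]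
    | tmul a b => rw [assoc_coact_galoisMap π hπ, LinearMap.lTensor_tmul]
  have h2 : diagMap ∘ₗ (twistedCoaction π hS).coact = TensorProduct.mk k C H (π 1) :=
    LinearMap.ext (diagMap_twistedCoaction π hS hπ)
  have h3 : ∀ s : H ⊗[k] H, TensorProduct.assoc k C H H
      ((TensorProduct.mk k C H (π 1)).rTensor H s) = π 1 ⊗ₜ s := by
    intro s
    induction s with
    | zero => simp
    | add x y hx hy => simp only [map_add, hx, hy, TensorProduct.tmul_add]
    | tmul a b => simp
  rw [h1, ← mem_cotensor.1 ht, LinearEquiv.symm_apply_apply, ← LinearMap.rTensor_comp_apply, h2,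
    h3, h3, LinearMap.lTensor_tmul]

end Twisted

/-! ### Cotensor products of comodules `P ⊗ V` -/
section CotensorFree
variable {k : Type u} [Field k] {C : Type v} [AddCommGroup C] [Module k C] [Coalgebra k C]
variable {V M : Type v} [AddCommGroup V] [Module k V] [AddCommGroup M] [Module k M]

/-- The difference of the two maps `V ⊗ M ⇉ V ⊗ (C ⊗ M)` whose kernel is `V □ M`. -/
def cotensorDiff (ρ : RightCoaction k C V) (σ : LeftCoaction k C M) :
    V ⊗[k] M →ₗ[k] V ⊗[k] (C ⊗[k] M) :=
  (TensorProduct.assoc k V C M).toLinearMap ∘ₗ ρ.coact.rTensor M - σ.coact.lTensor V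

theorem cotensorDiff_eq_zero {ρ : RightCoaction k C V} {σ : LeftCoaction k C M} {t : V ⊗[k] M} :
    cotensorDiff ρ σ t = 0 ↔ t ∈ cotensor ρ σ := by
  simp [cotensorDiff, mem_cotensor, sub_eq_zero]

theorem exact_cotensorDiff (ρ : RightCoaction k C V) (σ : LeftCoaction k C M) :
    Function.Exact (cotensor ρ σ).subtype (cotensorDiff ρ σ) := by
  intro t
  rw [cotensorDiff_eq_zero]
  simp

/-- `(P ⊗ V) □ M = P ⊗ (V □ M)`. -/
theorem mem_cotensor_lTensor (P : Type v) [AddCommGroup P] [Module k P]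
    {ρ : RightCoaction k C V} {σ : LeftCoaction k C M} {t : (P ⊗[k] V) ⊗[k] M} :
    t ∈ cotensor (ρ.lTensor P) σ ↔ TensorProduct.assoc k P V M t ∈
      LinearMap.range ((cotensor ρ σ).subtype.lTensor P) := by
  have hex := Module.Flat.lTensor_exact P (exact_cotensorDiff ρ σ)
  refine Iff.trans ?_ (hex _)
  rw [← cotensorDiff_eq_zero, ← (TensorProduct.assoc k P V (C ⊗[k] M)).map_eq_zero_iff]
  suffices TensorProduct.assoc k P V (C ⊗[k] M) (cotensorDiff (ρ.lTensor P) σ t) =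
    (cotensorDiff ρ σ).lTensor P (TensorProduct.assoc k P V M t) by rw [this]
  have : (TensorProduct.assoc k P V (C ⊗[k] M)).toLinearMap ∘ₗ cotensorDiff (ρ.lTensor P) σ =
    (cotensorDiff ρ σ).lTensor P ∘ₗ (TensorProduct.assoc k P V M).toLinearMap := by
    ext p v m
    simp only [cotensorDiff, RightCoaction.lTensor, TensorProduct.AlgebraTensorModule.curry_apply,
      TensorProduct.curry_apply, LinearMap.restrictScalars_self, LinearMap.comp_apply,
      LinearEquiv.coe_coe, LinearMap.sub_apply, map_sub, LinearMap.rTensor_tmul,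
      LinearMap.lTensor_tmul, TensorProduct.assoc_tmul, LinearMap.lTensor_sub]
    congr 1
    generalize ρ.coact v = s
    induction s with
    | zero => simp
    | add x y hx hy => simp only [map_add, TensorProduct.tmul_add, TensorProduct.add_tmul, hx, hy]
    | tmul a b => simp
  exact LinearMap.congr_fun this t

end CotensorFree

/-! ### The comodules `P ⊗_A H` -/
section TensorComodule
variable {k : Type u} [Field k] {H : Type v} [Ring H] [HopfAlgebra k H]
  {C : Type v} [AddCommGroup C] [Module k C] [Coalgebra k C] [Module H C] [IsScalarTower k H C]

open Coalgebra HopfAlgebra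

theorem TensorOver.mk_smul {A : Type v} [Ring A] [Algebra k A] {M N : Type v} [AddCommGroup M]
    [Module k M] [Module Aᵐᵒᵖ M] [AddCommGroup N] [Module k N] [Module A N] (m : M) (a : A)
    (n : N) : (balancedRel k A M N).mkQ ((MulOpposite.op a • m) ⊗ₜ n) =
      (balancedRel k A M N).mkQ (m ⊗ₜ (a • n)) := by
  rw [← sub_eq_zero, ← map_sub]
  exact (Submodule.Quotient.mk_eq_zero _).2 (Submodule.subset_span ⟨m, a, n, rfl⟩)

variable (π : H →ₗc[k] C) (hπ : ∀ h x : H, π (h * x) = h • π x)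
  (hS : Function.Bijective (antipode k (A := H)))
  (P : Type v) [AddCommGroup P] [Module k P] [Module (leftCoinvariants π hπ)ᵐᵒᵖ P]
  [IsScalarTower k (leftCoinvariants π hπ)ᵐᵒᵖ P]

/-- The projection `P ⊗ H → P ⊗_A H`. -/
abbrev tensorProj : P ⊗[k] H →ₗ[k] TensorOver k (leftCoinvariants π hπ) P H :=
  (balancedRel k (leftCoinvariants π hπ) P H).mkQ

/-- This uses that the twisted coaction is linear over `A`. -/
theorem isSubcomodule_balancedRel : ((twistedCoaction π hS).lTensor P).IsSubcomodule
    (balancedRel k (leftCoinvariants π hπ) P H) := by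
  intro t ht
  rw [RightCoaction.mem_range_rTensor_iff]
  induction ht using Submodule.span_induction with
  | zero => simp
  | add x y _ _ hx hy => simp only [map_add, hx, hy, add_zero]
  | smul r x _ hx => simp only [map_smul, hx, smul_zero]
  | mem x hx =>
    obtain ⟨p, a, h, rfl⟩ := hx
    have : a • h = (a : H) * h := rfl
    simp only [RightCoaction.lTensor, map_sub, LinearMap.comp_apply, LinearMap.lTensor_tmul, this,
      twistedCoaction_mul π hS hπ a.2, LinearEquiv.coe_coe]
    rw [sub_eq_zero]
    generalize (twistedCoaction π hS).coact h = s
    induction s with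
    | zero => simp
    | add x y hx hy => simp only [map_add, TensorProduct.tmul_add, hx, hy]
    | tmul g c =>
      simp only [LinearMap.rTensor_tmul, TensorProduct.assoc_symm_tmul, LinearMap.mulLeft_apply,
        TensorOver.mk_smul]
      rfl

/-- The right `C`-comodule `P ⊗_A H`, a quotient of `P ⊗ H` with the twisted coaction of `H`. -/
def tensorCoaction : RightCoaction k C (TensorOver k (leftCoinvariants π hπ) P H) :=
  ((twistedCoaction π hS).lTensor P).quot _ (isSubcomodule_balancedRel π hπ hS P)

theorem tensorProj_isColinear :
    ((twistedCoaction π hS).lTensor P).IsColinear (tensorCoaction π hπ hS P)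
      (tensorProj π hπ P) :=
  RightCoaction.quot_isColinear _ _ _

/-- The element `S(h₁) ⊗ h₂` lies in the cotensor product of the twisted comodule with `H`. -/
theorem galoisInv_one_mem (h : H) : galoisInv (1 ⊗ₜ h) ∈
    cotensor (twistedCoaction π hS) (leftCoactionOf π) := by
  rw [mem_cotensor, galoisInv_tmul, LinearMap.mulLeft_one, LinearMap.rTensor_id,
    LinearMap.id_apply]
  have h1 : ∀ t : H ⊗[k] H, TensorProduct.assoc k H C H
      ((twistedCoaction π hS).coact.rTensor H ((antipode k).rTensor H t)) =
      TensorProduct.map (antipode k) ((π : H →ₗ[k] C).rTensor H)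
        (TensorProduct.assoc k H H H (comul.rTensor H t)) := by
    intro t
    induction t with
    | zero => simp
    | add x y hx hy => simp only [map_add, hx, hy]
    | tmul a b =>
      simp only [LinearMap.rTensor_tmul, twistedCoaction_antipode]
      generalize comul (R := k) a = s
      induction s with
      | zero => simp
      | add x y hx hy => simp only [map_add, TensorProduct.add_tmul, hx, hy]
      | tmul a b => simp
  have h2 : ∀ t : H ⊗[k] H, (leftCoactionOf π).coact.lTensor H ((antipode k).rTensor H t) =
      TensorProduct.map (antipode k) ((π : H →ₗ[k] C).rTensor H) (comul.lTensor H t) := by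
    intro t
    induction t with
    | zero => simp
    | add x y hx hy => simp only [map_add, hx, hy]
    | tmul a b => simp [leftCoactionOf]
  rw [h1, h2, coassoc_apply]

/-- The inclusion `A ⊗ H → H ⊗ H`. -/
def inclTensor : leftCoinvariants π hπ ⊗[k] H →ₗ[k] H ⊗[k] H :=
  (Subalgebra.toSubmodule (leftCoinvariants π hπ)).subtype.rTensor H

theorem inclTensor_injective : Function.Injective (inclTensor π hπ) :=
  Module.Flat.rTensor_preserves_injective_linearMap _ (Submodule.injective_subtype _)

@[simp] theorem inclTensor_tmul (a : leftCoinvariants π hπ) (h : H) :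
    inclTensor π hπ (a ⊗ₜ h) = (a : H) ⊗ₜ h := rfl

/-- The elements of `(P ⊗ H) □ H` are the sums of elements `p ⊗ a S(h₁) ⊗ h₂`. -/
theorem exists_of_mem_cotensor_lTensor (P : Type v) [AddCommGroup P] [Module k P]
    {t : (P ⊗[k] H) ⊗[k] H}
    (ht : t ∈ cotensor ((twistedCoaction π hS).lTensor P) (leftCoactionOf π)) :
    ∃ u : P ⊗[k] (leftCoinvariants π hπ ⊗[k] H),
      TensorProduct.assoc k P H H t = (galoisInv ∘ₗ inclTensor π hπ).lTensor P u := by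
  obtain ⟨s, hs⟩ := (mem_cotensor_lTensor P).1 ht
  rw [← hs]
  clear hs
  induction s with
  | zero => exact ⟨0, by simp⟩
  | add x y hx hy =>
    obtain ⟨u, hu⟩ := hx
    obtain ⟨w, hw⟩ := hy
    exact ⟨u + w, by rw [map_add, map_add, hu, hw]⟩
  | tmul p w =>
    obtain ⟨u, hu⟩ := galoisMap_mem π hS hπ w.2
    refine ⟨p ⊗ₜ u, ?_⟩
    rw [LinearMap.lTensor_tmul, LinearMap.lTensor_tmul, LinearMap.comp_apply, inclTensor, hu,
      galoisInv_galoisMap]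
    rfl

/-- The map `P ⊗ H → (P ⊗_A H) □ H`, `p ⊗ h ↦ (p ⊗ S(h₁)) ⊗ h₂`. -/
def unitMap : P ⊗[k] H →ₗ[k] TensorOver k (leftCoinvariants π hπ) P H ⊗[k] H :=
  (tensorProj π hπ P).rTensor H ∘ₗ (TensorProduct.assoc k P H H).symm.toLinearMap ∘ₗ
    (galoisInv ∘ₗ TensorProduct.mk k H H 1).lTensor P

/-- The elements `p ⊗ S(h₁) ⊗ h₂` lifting the values of `unitMap` lie in `(P ⊗ H) □ H`. -/
theorem lift_unitMap_mem (w : P ⊗[k] H) : (TensorProduct.assoc k P H H).symm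
    ((galoisInv ∘ₗ TensorProduct.mk k H H 1).lTensor P w) ∈
      cotensor ((twistedCoaction π hS).lTensor P) (leftCoactionOf π) := by
  rw [mem_cotensor_lTensor, LinearEquiv.apply_symm_apply]
  induction w with
  | zero => simp
  | add x y hx hy => simpa only [map_add] using add_mem hx hy
  | tmul p h => exact ⟨p ⊗ₜ ⟨_, galoisInv_one_mem π hS h⟩, by simp⟩

/-- The unit `P ⊗ H → (P ⊗_A H) □ H` is surjective: by coflatness, an element of the target lifts to
`(P ⊗ H) □ H`, where it is a sum of elements `p ⊗ a S(h₁) ⊗ h₂`, and `p a ⊗ h` is mapped to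
the class of the latter. -/
theorem exists_unitMap_eq (hcoflat : (leftCoactionOf π).IsCoflat)
    {t : TensorOver k (leftCoinvariants π hπ) P H ⊗[k] H}
    (ht : t ∈ cotensor (tensorCoaction π hπ hS P) (leftCoactionOf π)) :
    ∃ w, unitMap π hπ P w = t := by
  obtain ⟨s, hs, rfl⟩ := hcoflat.exists_lift_of_surjective (tensorProj_isColinear π hπ hS P)
    (Submodule.mkQ_surjective _) ht
  obtain ⟨u, hu⟩ := exists_of_mem_cotensor_lTensor π hπ hS P hs
  rw [← LinearEquiv.eq_symm_apply] at hu
  rw [hu]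
  change _ ∈ LinearMap.range (unitMap π hπ P)
  clear hu hs
  induction u with
  | zero => simp
  | add x y hx hy => simpa only [map_add] using add_mem hx hy
  | tmul p z =>
    induction z with
    | zero => simp
    | add x y hx hy => simpa only [map_add, TensorProduct.tmul_add] using add_mem hx hy
    | tmul a h =>
      refine ⟨(MulOpposite.op a • p) ⊗ₜ h, ?_⟩
      simp only [unitMap, LinearMap.comp_apply, LinearMap.lTensor_tmul, TensorProduct.mk_apply,
        LinearEquiv.coe_coe, galoisInv_tmul, inclTensor_tmul]
      generalize (antipode k).rTensor H (comul (R := k) h) = r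
      induction r with
      | zero => simp
      | add x y hx hy => simp only [map_add, TensorProduct.tmul_add, hx, hy]
      | tmul a b =>
        simp only [LinearMap.rTensor_tmul, LinearMap.mulLeft_apply, one_mul,
          TensorProduct.assoc_symm_tmul, TensorOver.mk_smul]
        rfl

/-- The action `P ⊗ A → P`. -/
def rightAct : P ⊗[k] leftCoinvariants π hπ →ₗ[k] P :=
  TensorProduct.lift (LinearMap.mk₂ k (fun p a => MulOpposite.op a • p)
    (fun p q a => smul_add _ p q)
    (fun c p a => smul_comm _ c p)
    (fun p a b => by rw [MulOpposite.op_add, add_smul])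
    (fun c p a => by rw [MulOpposite.op_smul, smul_assoc]))

@[simp] theorem rightAct_tmul (p : P) (a : leftCoinvariants π hπ) :
    rightAct π hπ P (p ⊗ₜ a) = MulOpposite.op a • p := rfl

end TensorComodule

/-! ### The isomorphism `P ⊗ H ≅ (P ⊗_A H) □ H` and left faithful flatness -/
section Unit
variable {k : Type u} [Field k] {H : Type v} [Ring H] [HopfAlgebra k H]
  {C : Type v} [AddCommGroup C] [Module k C] [Coalgebra k C] [Module H C] [IsScalarTower k H C]

open Coalgebra HopfAlgebra

variable (π : H →ₗc[k] C) (hπ : ∀ h x : H, π (h * x) = h • π x)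
  (hS : Function.Bijective (antipode k (A := H)))
  (P : Type v) [AddCommGroup P] [Module k P] [Module (leftCoinvariants π hπ)ᵐᵒᵖ P]
  [IsScalarTower k (leftCoinvariants π hπ)ᵐᵒᵖ P]

/-- The action `A ⊗ H → H`. -/
def leftAct : leftCoinvariants π hπ ⊗[k] H →ₗ[k] H :=
  (LinearMap.mul' k H) ∘ₗ inclTensor π hπ

/-- The difference `p ⊗ a ⊗ h ↦ p a ⊗ h - p ⊗ a h`, whose cokernel is `P ⊗_A H`. -/
def balancedDiff : (P ⊗[k] leftCoinvariants π hπ) ⊗[k] H →ₗ[k] P ⊗[k] H :=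
  (rightAct π hπ P).rTensor H -
    (leftAct π hπ).lTensor P ∘ₗ (TensorProduct.assoc k P _ H).toLinearMap

@[simp] theorem balancedDiff_tmul (p : P) (a : leftCoinvariants π hπ) (h : H) :
    balancedDiff π hπ P ((p ⊗ₜ a) ⊗ₜ h) =
      (MulOpposite.op a • p) ⊗ₜ h - p ⊗ₜ ((a : H) * h) := rfl

theorem exact_balancedDiff : Function.Exact (balancedDiff π hπ P) (tensorProj π hπ P) := by
  rw [LinearMap.exact_iff, Submodule.ker_mkQ]
  apply le_antisymm
  · refine Submodule.span_le.2 ?_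
    rintro _ ⟨p, a, h, rfl⟩
    exact ⟨(p ⊗ₜ a) ⊗ₜ h, rfl⟩
  · rintro _ ⟨u, rfl⟩
    induction u with
    | zero => simp
    | add x y hx hy => simpa only [map_add] using add_mem hx hy
    | tmul z h =>
      induction z with
      | zero => simp
      | add x y hx hy => simpa only [map_add, TensorProduct.add_tmul] using add_mem hx hy
      | tmul p a => exact Submodule.subset_span ⟨p, a, h, rfl⟩

/-- This uses that the twisted coaction is linear over `A`. -/
theorem balancedDiff_isColinear :
    ((twistedCoaction π hS).lTensor (P ⊗[k] leftCoinvariants π hπ)).IsColinear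
      ((twistedCoaction π hS).lTensor P) (balancedDiff π hπ P) := by
  ext p a h
  simp only [RightCoaction.lTensor, TensorProduct.AlgebraTensorModule.curry_apply,
      TensorProduct.curry_apply, LinearMap.restrictScalars_self, LinearMap.comp_apply,
      LinearEquiv.coe_coe, balancedDiff_tmul, LinearMap.lTensor_tmul, map_sub,
      twistedCoaction_mul π hS hπ a.2]
  generalize (twistedCoaction π hS).coact h = s
  induction s with
  | zero => simp
  | add x y hx hy =>
    simp only [map_add, TensorProduct.tmul_add, ← hx, ← hy]
    abel
  | tmul g c => simp [TensorProduct.sub_tmul]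

/-- The unit `P ⊗ H → (P ⊗_A H) □ H` is injective: as `? □ H` is right exact, both sides are the
cokernel of `(P ⊗ A ⊗ H) □ H → (P ⊗ H) □ H`. -/
theorem unitMap_injective (hS : Function.Bijective (antipode k (A := H)))
    (hcoflat : (leftCoactionOf π).IsCoflat) :
    Function.Injective (unitMap π hπ P) := by
  rw [injective_iff_map_eq_zero]
  intro w hw
  obtain ⟨s, hs, hst⟩ := hcoflat.exists_lift (balancedDiff_isColinear π hπ hS P)
    (tensorProj_isColinear π hπ hS P) (exact_balancedDiff π hπ P) (lift_unitMap_mem π hS P w) hw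
  obtain ⟨u, hu⟩ := exists_of_mem_cotensor_lTensor π hπ hS _ hs
  rw [← LinearEquiv.eq_symm_apply] at hu
  -- `D` is `p ⊗ a ⊗ (b ⊗ h) ↦ p a ⊗ (b ⊗ h) - p ⊗ (a b ⊗ h)`, the map corresponding to
  -- `balancedDiff` under the identifications of the cotensor products with `? ⊗ A ⊗ H`
  let D : (P ⊗[k] leftCoinvariants π hπ) ⊗[k] (leftCoinvariants π hπ ⊗[k] H) →ₗ[k]
      P ⊗[k] (leftCoinvariants π hπ ⊗[k] H) :=
    (rightAct π hπ P).rTensor (leftCoinvariants π hπ ⊗[k] H) -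
      ((LinearMap.mul' k (leftCoinvariants π hπ)).rTensor H ∘ₗ
        (TensorProduct.assoc k (leftCoinvariants π hπ) (leftCoinvariants π hπ)
          H).symm.toLinearMap).lTensor P ∘ₗ
      (TensorProduct.assoc k P (leftCoinvariants π hπ)
        (leftCoinvariants π hπ ⊗[k] H)).toLinearMap
  -- `w` corresponds to the image of `u` under `balancedDiff`
  have h1 : (inclTensor π hπ).lTensor P
      ((TensorProduct.mk k (leftCoinvariants π hπ) H 1).lTensor P w) =
      (inclTensor π hπ).lTensor P (D u) := by
    have h2 := congrArg
      (fun t => (galoisMap (k := k)).lTensor P (TensorProduct.assoc k P H H t)) hst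
    simp only [LinearEquiv.apply_symm_apply, ← LinearMap.lTensor_comp_apply] at h2
    rw [← LinearMap.comp_assoc, LinearMap.ext (f := galoisMap ∘ₗ galoisInv) (g := LinearMap.id)
      galoisMap_galoisInv, LinearMap.id_comp, hu] at h2
    rw [← LinearMap.lTensor_comp_apply]
    refine (h2.symm.trans ?_)
    clear h2 hu hst hs
    induction u with
    | zero => simp
    | add x y hx hy => simp only [map_add, hx, hy]
    | tmul z y =>
      induction z with
      | zero => simp
      | add x y hx hy => simp only [map_add, TensorProduct.add_tmul, hx, hy]
      | tmul p a =>
        have h3 : ∀ r : H ⊗[k] H, (TensorProduct.assoc k P H H)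
          ((balancedDiff π hπ P).rTensor H
            ((TensorProduct.assoc k (P ⊗[k] leftCoinvariants π hπ) H H).symm ((p ⊗ₜ a) ⊗ₜ r))) =
            (MulOpposite.op a • p) ⊗ₜ r -
              p ⊗ₜ ((LinearMap.mulLeft k (a : H)).rTensor H r) := by
          intro r
          induction r with
          | zero => simp
          | add x y hx hy =>
            simp only [map_add, TensorProduct.tmul_add, hx, hy]
            abel
          | tmul g h => simp [TensorProduct.sub_tmul]
        rw [LinearMap.lTensor_tmul, h3, map_sub, LinearMap.lTensor_tmul, LinearMap.lTensor_tmul,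
          galoisMap_mulLeft, LinearMap.comp_apply, galoisMap_galoisInv]
        simp only [D, LinearMap.sub_apply, map_sub, LinearMap.rTensor_tmul, rightAct_tmul,
          LinearMap.lTensor_tmul, LinearMap.comp_apply, LinearEquiv.coe_coe,
          TensorProduct.assoc_tmul]
        congr 2
        induction y with
        | zero => simp only [LinearMap.map_zero, LinearEquiv.map_zero, TensorProduct.tmul_zero]
        | add x y hx hy => simp only [map_add, TensorProduct.tmul_add, hx, hy]
        | tmul b h => simp
  have h4 := Module.Flat.lTensor_preserves_injective_linearMap (M := P) _
    (inclTensor_injective π hπ) h1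
  -- the map `p ⊗ (a ⊗ h) ↦ p a ⊗ h` recovers `w` and annihilates the image of `D`
  have h5 := congrArg ((rightAct π hπ P).rTensor H ∘ₗ
    (TensorProduct.assoc k P (leftCoinvariants π hπ) H).symm.toLinearMap) h4
  have h6 : ((rightAct π hπ P).rTensor H ∘ₗ
      (TensorProduct.assoc k P (leftCoinvariants π hπ) H).symm.toLinearMap)
      ((TensorProduct.mk k (leftCoinvariants π hπ) H 1).lTensor P w) = w := by
    clear h5 h4 h1 hst hw
    induction w with
    | zero => simp
    | add x y hx hy => simp only [map_add, hx, hy]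
    | tmul p h => simp
  have h7 : ((rightAct π hπ P).rTensor H ∘ₗ
      (TensorProduct.assoc k P (leftCoinvariants π hπ) H).symm.toLinearMap)
      (D u) = 0 := by
    clear h6 h5 h4 h1 hu
    induction u with
    | zero => simp
    | add x y hx hy => simp only [map_add, hx, hy, add_zero]
    | tmul z y =>
      induction z with
      | zero => simp
      | add x y hx hy => simp only [map_add, TensorProduct.add_tmul, hx, hy, add_zero]
      | tmul p a =>
        induction y with
        | zero => simp
        | add x y hx hy => simp only [map_add, TensorProduct.tmul_add, hx, hy, add_zero]
        | tmul b h => simp [D, mul_smul]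
  rw [← h6, h5, h7]

/-- The maps `P ⊗_A H → P' ⊗_A H` are colinear. -/
theorem mapLeft_isColinear {P' : Type v} [AddCommGroup P'] [Module k P']
    [Module (leftCoinvariants π hπ)ᵐᵒᵖ P'] [IsScalarTower k (leftCoinvariants π hπ)ᵐᵒᵖ P']
    (f : P →ₗ[(leftCoinvariants π hπ)ᵐᵒᵖ] P') :
    (tensorCoaction π hπ hS P).IsColinear (tensorCoaction π hπ hS P')
      (TensorOver.mapLeft k (leftCoinvariants π hπ) H f) := by
  apply LinearMap.ext
  intro x
  obtain ⟨t, rfl⟩ := Submodule.mkQ_surjective _ x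
  have h1 := (tensorProj_isColinear π hπ hS P).apply t
  have h2 := (tensorProj_isColinear π hπ hS P').apply ((f.restrictScalars k).rTensor H t)
  have h3 : TensorOver.mapLeft k (leftCoinvariants π hπ) H f ∘ₗ tensorProj π hπ P =
      tensorProj π hπ P' ∘ₗ (f.restrictScalars k).rTensor H := by ext; rfl
  rw [LinearMap.comp_apply, LinearMap.comp_apply, h1, ← LinearMap.rTensor_comp_apply, h3]
  refine h2.trans ?_
  rw [LinearMap.rTensor_comp_apply]
  congr 1
  clear h1 h2
  induction t with
  | zero => simp
  | add x y hx hy => simp only [map_add, hx, hy]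
  | tmul p h =>
    simp only [RightCoaction.lTensor, LinearMap.comp_apply, LinearMap.lTensor_tmul,
      LinearMap.rTensor_tmul, LinearEquiv.coe_coe]
    generalize (twistedCoaction π hS).coact h = s
    induction s with
    | zero => simp
    | add x y hx hy => simp only [map_add, TensorProduct.tmul_add, hx, hy]
    | tmul g c => simp

theorem mapLeft_unitMap {P' : Type v} [AddCommGroup P'] [Module k P']
    [Module (leftCoinvariants π hπ)ᵐᵒᵖ P'] [IsScalarTower k (leftCoinvariants π hπ)ᵐᵒᵖ P']
    (f : P →ₗ[(leftCoinvariants π hπ)ᵐᵒᵖ] P') (w : P ⊗[k] H) :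
    (TensorOver.mapLeft k (leftCoinvariants π hπ) H f).rTensor H (unitMap π hπ P w) =
      unitMap π hπ P' ((f.restrictScalars k).rTensor H w) := by
  induction w with
  | zero => simp
  | add x y hx hy => simp only [map_add, hx, hy]
  | tmul p h =>
    simp only [unitMap, LinearMap.comp_apply, LinearMap.lTensor_tmul, LinearMap.rTensor_tmul,
      LinearEquiv.coe_coe, TensorProduct.mk_apply]
    generalize galoisInv (k := k) ((1 : H) ⊗ₜ h) = s
    induction s with
    | zero => simp
    | add x y hx hy => simp only [map_add, TensorProduct.tmul_add, hx, hy]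
    | tmul g c =>
      simp only [TensorProduct.assoc_symm_tmul, LinearMap.rTensor_tmul]
      rfl

theorem nontrivial_hopf (k : Type u) [Field k] (H : Type v) [Ring H] [HopfAlgebra k H] :
    Nontrivial H := by
  refine ⟨1, 0, fun h => ?_⟩
  have := congrArg (counit (R := k)) h
  simp at this

/-- If `H` is left faithfully coflat over `C`, then it is left faithfully flat over `A`: the
functor `(? ⊗_A H) □ H` is isomorphic to `? ⊗ H`. -/
theorem isLeftFaithfullyFlat_of_isFaithfullyCoflat
    (hS : Function.Bijective (antipode k (A := H)))
    (h : (leftCoactionOf π).IsFaithfullyCoflat) :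
    IsLeftFaithfullyFlat k (leftCoinvariants π hπ) H := by
  constructor
  · intro M₁ M₂ M₃ _ _ _ _ _ _ _ _ _ _ _ _ f g hfg
    refine exact_of_cotensor h.1 h.2 (mapLeft_isColinear π hπ hS M₁ f)
      (mapLeft_isColinear π hπ hS M₂ g) ?_ ?_
    · ext m x
      change (balancedRel k (leftCoinvariants π hπ) M₃ H).mkQ (g (f m) ⊗ₜ x) = 0
      rw [hfg.apply_apply_eq_zero]
      simp
    · intro t ht h0
      obtain ⟨w, rfl⟩ := exists_unitMap_eq π hπ hS M₂ h.1 ht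
      rw [mapLeft_unitMap] at h0
      have hw := (injective_iff_map_eq_zero _).1 (unitMap_injective π hπ M₃ hS h.1) _ h0
      have hex : Function.Exact (f.restrictScalars k) (g.restrictScalars k) := hfg
      obtain ⟨w', rfl⟩ := (Module.Flat.rTensor_exact H hex _).1 hw
      exact ⟨unitMap π hπ M₁ w', mapLeft_unitMap π hπ M₁ f w'⟩
  · intro M _ _ _ _ hM
    by_contra hT
    rw [not_nontrivial_iff_subsingleton] at hT
    have := nontrivial_hopf k H
    obtain ⟨x, hx⟩ := exists_ne (0 : M ⊗[k] H)
    exact hx (unitMap_injective π hπ M hS h.1 (Subsingleton.elim _ _))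

end Unit

/-! ### Left duals of finite-dimensional comodules -/
section Dual
variable {k : Type u} [Field k] {C : Type v} [AddCommGroup C] [Module k C] [Coalgebra k C]
variable {V Y W : Type v} [AddCommGroup V] [Module k V] [AddCommGroup Y] [Module k Y]
  [AddCommGroup W] [Module k W] {n : ℕ}

namespace RightCoaction

/-- The left dual of a finite-dimensional right comodule, realized on the same space by means of a
basis: `b i ↦ ∑ j, c i j ⊗ b j` for the coefficients `c` of the comodule. -/
def dual (ρ : RightCoaction k C V) (b : Module.Basis (Fin n) k V) : LeftCoaction k C V where
  coact := b.constr k (fun i => ∑ j, ρ.coeff b i j ⊗ₜ[k] b j)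
  coassoc := by
    refine b.ext fun i => ?_
    simp only [LinearMap.comp_apply, Module.Basis.constr_basis, map_sum, LinearMap.rTensor_tmul,
      LinearMap.lTensor_tmul, LinearEquiv.coe_coe, comul_coeff, TensorProduct.sum_tmul,
      TensorProduct.assoc_tmul, TensorProduct.tmul_sum]
    exact Finset.sum_comm
  counit_coact := by
    refine b.ext fun i => ?_
    simp [counit_coeff, ite_smul]

theorem dual_basis (ρ : RightCoaction k C V) (b : Module.Basis (Fin n) k V) (i : Fin n) :
    (ρ.dual b).coact (b i) = ∑ j, ρ.coeff b i j ⊗ₜ[k] b j := by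
  simp [dual]

/-- `Y □ V*` is the space of colinear maps `V → Y`. -/
theorem sum_tmul_mem_cotensor_dual_iff (ρ : RightCoaction k C V) (b : Module.Basis (Fin n) k V)
    (τ : RightCoaction k C Y) (f : V →ₗ[k] Y) :
    ∑ j, f (b j) ⊗ₜ[k] b j ∈ cotensor τ (ρ.dual b) ↔ ρ.IsColinear τ f := by
  have h1 : ∀ (t : Y ⊗[k] C) (v : V), TensorProduct.assoc k Y C V (t ⊗ₜ v) =
      (TensorProduct.assoc k Y C V).toLinearMap (t ⊗ₜ v) := fun _ _ => rfl
  have h2 : (ρ.dual b).coact.lTensor Y (∑ j, f (b j) ⊗ₜ[k] b j) =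
      TensorProduct.assoc k Y C V (∑ j, f.rTensor C (ρ.coact (b j)) ⊗ₜ[k] b j) := by
    simp only [map_sum, LinearMap.lTensor_tmul, dual_basis, ρ.coact_basis b,
      TensorProduct.tmul_sum, TensorProduct.sum_tmul, LinearMap.rTensor_tmul,
      TensorProduct.assoc_tmul]
    exact Finset.sum_comm
  rw [mem_cotensor, h2, EmbeddingLike.apply_eq_iff_eq]
  simp only [map_sum, LinearMap.rTensor_tmul]
  constructor
  · intro h
    refine b.ext fun j => ?_
    have h3 := congrArg (TensorProduct.comm k (Y ⊗[k] C) V) h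
    simp only [map_sum, TensorProduct.comm_tmul] at h3
    exact basis_tmul_injective b h3 j
  · intro h
    exact Finset.sum_congr rfl fun j _ => by rw [h.apply]

/-- Together with `sum_tmul_mem_cotensor_dual_iff`, this shows that all elements of `Y □ V*` come
from colinear maps. -/
theorem exists_eq_sum_tmul_basis (b : Module.Basis (Fin n) k V) (t : Y ⊗[k] V) :
    ∃ f : V →ₗ[k] Y, t = ∑ j, f (b j) ⊗ₜ[k] b j := by
  induction t with
  | zero => exact ⟨0, by simp⟩
  | add x y hx hy =>
    obtain ⟨f, hf⟩ := hx
    obtain ⟨g, hg⟩ := hy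
    exact ⟨f + g, by simp [hf, hg, TensorProduct.add_tmul, Finset.sum_add_distrib]⟩
  | tmul y v =>
    refine ⟨b.constr k fun j => b.repr v j • y, ?_⟩
    simp only [Module.Basis.constr_basis, TensorProduct.smul_tmul, ← TensorProduct.tmul_sum]
    rw [b.sum_repr]

theorem IsColinear.of_comp_injective {ρ : RightCoaction k C V} {τ : RightCoaction k C Y}
    {σ : RightCoaction k C W} {f : V →ₗ[k] Y} {i : Y →ₗ[k] W} (hi : τ.IsColinear σ i)
    (hinj : Function.Injective i) (h : ρ.IsColinear σ (i ∘ₗ f)) : ρ.IsColinear τ f := by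
  ext v
  apply Module.Flat.rTensor_preserves_injective_linearMap (M := C) i hinj
  change i.rTensor C (τ.coact (f v)) = i.rTensor C (f.rTensor C (ρ.coact v))
  rw [← hi.apply, ← LinearMap.rTensor_comp_apply, ← h.apply]
  rfl

theorem IsColinear.comp {ρ : RightCoaction k C V} {τ : RightCoaction k C Y}
    {σ : RightCoaction k C W} {f : V →ₗ[k] Y} {i : Y →ₗ[k] W} (hi : τ.IsColinear σ i)
    (hf : ρ.IsColinear τ f) : ρ.IsColinear σ (i ∘ₗ f) := by
  ext v
  rw [LinearMap.comp_apply, LinearMap.comp_apply, hi.apply, hf.apply,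
    ← LinearMap.rTensor_comp_apply]
  rfl

end RightCoaction
end Dual

/-! ### Right flatness and maps to `H ⊗_A H` -/
section Flat
variable {k : Type u} [Field k] {H : Type v} [Ring H] [HopfAlgebra k H]
  {C : Type v} [AddCommGroup C] [Module k C] [Coalgebra k C] [Module H C] [IsScalarTower k H C]

open Coalgebra HopfAlgebra

variable (π : H →ₗc[k] C) (hπ : ∀ h x : H, π (h * x) = h • π x)
  (hS : Function.Bijective (antipode k (A := H)))
variable {V : Type v} [AddCommGroup V] [Module k V]

/-- The map `(H ⊗_A H) ⊗ V → H ⊗_A (H ⊗ V)`. -/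
def assocOver (V : Type v) [AddCommGroup V] [Module k V] :
    TensorOver k (leftCoinvariants π hπ) H H ⊗[k] V →ₗ[k]
      TensorOver k (leftCoinvariants π hπ) H (H ⊗[k] V) :=
  TensorProduct.lift ((balancedRel k (leftCoinvariants π hπ) H H).liftQ
    (TensorProduct.curry ((balancedRel k (leftCoinvariants π hπ) H (H ⊗[k] V)).mkQ ∘ₗ
      (TensorProduct.assoc k H H V).toLinearMap)) (by
    refine Submodule.span_le.2 ?_
    rintro _ ⟨m, a, n, rfl⟩
    rw [SetLike.mem_coe, LinearMap.mem_ker, map_sub, sub_eq_zero]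
    ext v
    exact TensorOver.mk_smul m a (n ⊗ₜ[k] v)))

/-- The map `H ⊗_A (H ⊗ V) → (H ⊗_A H) ⊗ V`. -/
def assocOverInv (V : Type v) [AddCommGroup V] [Module k V] :
    TensorOver k (leftCoinvariants π hπ) H (H ⊗[k] V) →ₗ[k]
      TensorOver k (leftCoinvariants π hπ) H H ⊗[k] V :=
  (balancedRel k (leftCoinvariants π hπ) H (H ⊗[k] V)).liftQ
    ((tensorProj π hπ H).rTensor V ∘ₗ (TensorProduct.assoc k H H V).symm.toLinearMap) (by
    refine Submodule.span_le.2 ?_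
    rintro _ ⟨m, a, n, rfl⟩
    rw [SetLike.mem_coe, LinearMap.mem_ker, map_sub, sub_eq_zero]
    induction n with
    | zero => simp
    | add x y hx hy => simp only [map_add, TensorProduct.tmul_add, smul_add, hx, hy]
    | tmul y v =>
      have : a • (y ⊗ₜ[k] v) = (a • y) ⊗ₜ[k] v := rfl
      simp only [this, LinearMap.comp_apply, LinearEquiv.coe_coe, TensorProduct.assoc_symm_tmul,
        LinearMap.rTensor_tmul, TensorOver.mk_smul])

theorem assocOverInv_assocOver (w : TensorOver k (leftCoinvariants π hπ) H H ⊗[k] V) :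
    assocOverInv π hπ V (assocOver π hπ V w) = w := by
  induction w with
  | zero => simp
  | add x y hx hy => simp only [map_add, hx, hy]
  | tmul z v =>
    obtain ⟨t, rfl⟩ := Submodule.mkQ_surjective _ z
    induction t with
    | zero => simp
    | add x y hx hy => simp only [map_add, TensorProduct.add_tmul, hx, hy]
    | tmul x y => rfl

/-- `cotensorDiff` for the twisted comodule `H` as a homomorphism of left `A`-modules. -/
def twistedDiff (σ : LeftCoaction k C V) :
    H ⊗[k] V →ₗ[leftCoinvariants π hπ] H ⊗[k] (C ⊗[k] V) where
  toFun := cotensorDiff (twistedCoaction π hS) σ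
  map_add' := map_add _
  map_smul' a t := by
    induction t with
    | zero => simp
    | add x y hx hy => simp only [smul_add, map_add, hx, hy]
    | tmul y v =>
      have : a • (y ⊗ₜ[k] v) = ((a : H) * y) ⊗ₜ[k] v := rfl
      simp only [cotensorDiff, LinearMap.sub_apply, LinearMap.comp_apply,
        LinearMap.rTensor_tmul, LinearMap.lTensor_tmul, this, twistedCoaction_mul π hS hπ a.2,
        RingHom.id_apply, smul_sub, LinearEquiv.coe_coe]
      congr 1
      generalize (twistedCoaction π hS).coact y = s
      induction s with
      | zero => simp
      | add x y hx hy => simp only [map_add, TensorProduct.add_tmul, smul_add, hx, hy]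
      | tmul g c => rfl

/-- Under `(H ⊗_A H) ⊗ V ≅ H ⊗_A (H ⊗ V)`, the equations defining `(H ⊗_A H) □ V` are obtained from
those defining `H □ V` by applying `H ⊗_A ?`. -/
theorem mapRight_twistedDiff (σ : LeftCoaction k C V)
    (w : TensorOver k (leftCoinvariants π hπ) H H ⊗[k] V) :
    TensorOver.mapRight k (leftCoinvariants π hπ) H (twistedDiff π hπ hS σ)
      (assocOver π hπ V w) =
    assocOver π hπ (C ⊗[k] V) (cotensorDiff (tensorCoaction π hπ hS H) σ w) := by
  induction w with
  | zero => simp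
  | add x y hx hy => simp only [map_add, hx, hy]
  | tmul z v =>
    obtain ⟨t, rfl⟩ := Submodule.mkQ_surjective _ z
    induction t with
    | zero => simp
    | add x y hx hy => simp only [map_add, TensorProduct.add_tmul, hx, hy]
    | tmul x y =>
      have h1 : (tensorCoaction π hπ hS H).coact (tensorProj π hπ H (x ⊗ₜ y)) = _ :=
        (tensorProj_isColinear π hπ hS H).apply (x ⊗ₜ y)
      have h2 : TensorOver.mapRight k (leftCoinvariants π hπ) H (twistedDiff π hπ hS σ)
        (assocOver π hπ V (tensorProj π hπ H (x ⊗ₜ y) ⊗ₜ v)) =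
        (balancedRel k (leftCoinvariants π hπ) H (H ⊗[k] (C ⊗[k] V))).mkQ
          (x ⊗ₜ cotensorDiff (twistedCoaction π hS) σ (y ⊗ₜ v)) := rfl
      rw [h2]
      simp only [cotensorDiff, LinearMap.sub_apply, LinearMap.comp_apply, LinearMap.rTensor_tmul,
        LinearMap.lTensor_tmul, LinearEquiv.coe_coe, map_sub, TensorProduct.tmul_sub]
      rw [h1]
      congr 1
      · simp only [RightCoaction.lTensor, LinearMap.comp_apply, LinearMap.lTensor_tmul,
          LinearEquiv.coe_coe]
        generalize (twistedCoaction π hS).coact y = s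
        induction s with
        | zero => simp
        | add x y hx hy => simp only [map_add, TensorProduct.tmul_add, TensorProduct.add_tmul,
            hx, hy]
        | tmul g c => rfl

/-- Right flatness of `H` over `A` in terms of cotensor products: the projection
`H ⊗ H → H ⊗_A H` induces a surjection on cotensor products with any left comodule `V`. -/
theorem exists_lift_of_isRightFlat (hflat : IsRightFlat k (leftCoinvariants π hπ) H)
    (σ : LeftCoaction k C V) {w : TensorOver k (leftCoinvariants π hπ) H H ⊗[k] V}
    (hw : w ∈ cotensor (tensorCoaction π hπ hS H) σ) :
    ∃ s : H ⊗[k] cotensor (twistedCoaction π hS) σ,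
      (tensorProj π hπ H).rTensor V ((TensorProduct.assoc k H H V).symm
        ((cotensor (twistedCoaction π hS) σ).subtype.lTensor H s)) = w := by
  let δ := twistedDiff π hπ hS σ
  have hex : Function.Exact (LinearMap.ker δ).subtype δ := LinearMap.exact_subtype_ker_map δ
  -- `H □ V` is the kernel of `δ`, and by flatness `H ⊗_A ?` preserves this kernel
  have h1 := (hflat (LinearMap.ker δ) (H ⊗[k] V) (H ⊗[k] (C ⊗[k] V)) (LinearMap.ker δ).subtype δ hex
    (assocOver π hπ V w)).1 (by
    rw [mapRight_twistedDiff, cotensorDiff_eq_zero.2 hw, map_zero])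
  obtain ⟨z, hz⟩ := h1
  obtain ⟨u, rfl⟩ := Submodule.mkQ_surjective _ z
  let j : LinearMap.ker δ →ₗ[k] cotensor (twistedCoaction π hS) σ :=
    ((LinearMap.ker δ).subtype.restrictScalars k).codRestrict _
      (fun x => cotensorDiff_eq_zero.1 x.2)
  refine ⟨j.lTensor H u, ?_⟩
  rw [← assocOverInv_assocOver π hπ w, ← hz, ← LinearMap.lTensor_comp_apply]
  rfl

/-- If a finite-dimensional right comodule has a nonzero colinear map to `H ⊗_A H`, then it has
a nonzero colinear map to `H`. -/
theorem exists_isColinear_ne_zero (hS : Function.Bijective (antipode k (A := H)))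
    (hflat : IsRightFlat k (leftCoinvariants π hπ) H)
    [FiniteDimensional k V] (ρ : RightCoaction k C V)
    {j : V →ₗ[k] TensorOver k (leftCoinvariants π hπ) H H}
    (hj : ρ.IsColinear (tensorCoaction π hπ hS H) j) (hj0 : j ≠ 0) :
    ∃ f : V →ₗ[k] H, ρ.IsColinear (rightCoactionOf π) f ∧ f ≠ 0 := by
  let b := Module.finBasis k V
  have hw := (ρ.sum_tmul_mem_cotensor_dual_iff b (tensorCoaction π hπ hS H) j).2 hj
  obtain ⟨s, hs⟩ := exists_lift_of_isRightFlat π hπ hS hflat _ hw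
  have hnt : Nontrivial (cotensor (twistedCoaction π hS) (ρ.dual b)) := by
    by_contra hn
    rw [not_nontrivial_iff_subsingleton] at hn
    apply hj0
    have h0 : (cotensor (twistedCoaction π hS) (ρ.dual b)).subtype = 0 :=
      LinearMap.ext fun x => by rw [Subsingleton.elim x 0]; simp
    rw [h0, LinearMap.lTensor_zero, LinearMap.zero_apply, map_zero, map_zero] at hs
    refine b.ext fun i => ?_
    have h3 := congrArg (TensorProduct.comm k _ V) hs
    simp only [map_sum, TensorProduct.comm_tmul, map_zero] at h3
    exact (basis_tmul_injective b (x := 0) (y := fun i => j (b i)) (by simpa using h3) i).symm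
  obtain ⟨⟨g, hg⟩, hg0⟩ := exists_ne (0 : cotensor (twistedCoaction π hS) (ρ.dual b))
  obtain ⟨f, rfl⟩ := RightCoaction.exists_eq_sum_tmul_basis b g
  rw [RightCoaction.sum_tmul_mem_cotensor_dual_iff] at hg
  refine ⟨(antipodeEquiv hS).symm.toLinearMap ∘ₗ f, ?_, ?_⟩
  · refine RightCoaction.IsColinear.of_comp_injective (twistedCoaction_isColinear π hS) hS.1 ?_
    convert hg using 1
    ext v
    exact (antipodeEquiv hS).apply_symm_apply _
  · intro h0
    apply hg0
    apply Subtype.ext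
    change ∑ j, f (b j) ⊗ₜ[k] b j = 0
    refine Finset.sum_eq_zero fun i _ => ?_
    have := LinearMap.congr_fun h0 (b i)
    rw [LinearMap.comp_apply, LinearEquiv.coe_coe, LinearMap.zero_apply,
      LinearEquiv.map_eq_zero_iff] at this
    rw [this, TensorProduct.zero_tmul]

/-- The map `H → H ⊗_A H`, `x ↦ x₁ ⊗ S(x₂)`. -/
def translationMap : H →ₗ[k] TensorOver k (leftCoinvariants π hπ) H H :=
  tensorProj π hπ H ∘ₗ (antipode k).lTensor H ∘ₗ comul

/-- The coaction on `H ⊗_A H` comes from the twisted coaction `S(x₂) ↦ S(x₂) ⊗ π(x₃)` of the second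
factor, so it matches `x ↦ x₁ ⊗ π(x₂)`. -/
theorem translationMap_isColinear :
    (rightCoactionOf π).IsColinear (tensorCoaction π hπ hS H) (translationMap π hπ) := by
  apply LinearMap.ext
  intro x
  have h1 := (tensorProj_isColinear π hπ hS H).apply ((antipode k).lTensor H (comul (R := k) x))
  refine h1.trans ?_
  rw [LinearMap.comp_apply, translationMap, LinearMap.rTensor_comp_apply]
  congr 1
  have h2 : ∀ t : H ⊗[k] H, ((twistedCoaction π hS).lTensor H).coact ((antipode k).lTensor H t) =
      (TensorProduct.assoc k H H C).symm (TensorProduct.map LinearMap.id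
        (TensorProduct.map (antipode k) (π : H →ₗ[k] C)) (comul.lTensor H t)) := by
    intro t
    induction t with
    | zero => simp
    | add x y hx hy => simp only [map_add, hx, hy]
    | tmul a b => simp [RightCoaction.lTensor, twistedCoaction_antipode]
  have h3 : ∀ t : H ⊗[k] H, LinearMap.rTensor C ((antipode k).lTensor H ∘ₗ comul)
      ((π : H →ₗ[k] C).lTensor H t) = (TensorProduct.assoc k H H C).symm
        (TensorProduct.map LinearMap.id
        (TensorProduct.map (antipode k) (π : H →ₗ[k] C))
          (TensorProduct.assoc k H H H (comul.rTensor H t))) := by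
    intro t
    induction t with
    | zero => simp
    | add x y hx hy => simp only [map_add, hx, hy]
    | tmul a b =>
      simp only [LinearMap.rTensor_tmul, LinearMap.lTensor_tmul, LinearMap.comp_apply]
      generalize comul (R := k) a = s
      induction s with
      | zero => simp
      | add x y hx hy => simp only [map_add, TensorProduct.add_tmul, hx, hy]
      | tmul a b => simp
  rw [h2, rightCoactionOf, LinearMap.comp_apply, h3, coassoc_apply]

/-- Modulo the kernel of `π`, a left coinvariant is its counit. -/
theorem apply_mem_leftCoinvariants {a : H} (ha : a ∈ leftCoinvariants π hπ) :
    π a = counit (R := k) a • π 1 := by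
  have h := congrArg (fun t => TensorProduct.rid k C ((counit (R := k) (A := H)).lTensor C t))
    ((mem_leftCoinvariants π).1 ha)
  simp only [LinearMap.lTensor_tmul, TensorProduct.rid_tmul] at h
  rw [← h]
  simp only [leftCoactionOf, LinearMap.comp_apply]
  rw [← rTensor_lTensor_apply, lTensor_counit_comul]
  simp

/-- The map `H ⊗_A H → C`, `x ⊗ y ↦ ε(y) π(x)`. -/
def counitMap : TensorOver k (leftCoinvariants π hπ) H H →ₗ[k] C :=
  (balancedRel k (leftCoinvariants π hπ) H H).liftQ
    ((TensorProduct.rid k C).toLinearMap ∘ₗ TensorProduct.map (π : H →ₗ[k] C) counit) (by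
    refine Submodule.span_le.2 ?_
    rintro _ ⟨m, a, n, rfl⟩
    rw [SetLike.mem_coe, LinearMap.mem_ker, map_sub, sub_eq_zero, op_smul_eq_mul]
    have : a • n = (a : H) * n := rfl
    simp only [this, LinearMap.comp_apply, TensorProduct.map_tmul, LinearEquiv.coe_coe,
      TensorProduct.rid_tmul, LinearMap.coe_coe, hπ, apply_mem_leftCoinvariants π hπ a.2,
      Bialgebra.counit_mul]
    rw [smul_comm m, ← hπ, mul_one, smul_smul, mul_comm])

/-- The map `x ⊗ y ↦ ε(y) π(x)` splits `π(x) ↦ x₁ ⊗ S(x₂)`, which therefore is injective on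
`C`. -/
theorem counitMap_translationMap (x : H) : counitMap π hπ (translationMap π hπ x) = π x := by
  change (TensorProduct.rid k C) (TensorProduct.map (π : H →ₗ[k] C) counit
    ((antipode k).lTensor H (comul (R := k) x))) = π x
  rw [← LinearMap.comp_apply (TensorProduct.map _ _), LinearMap.map_comp_lTensor,
    counit_comp_antipode, ← LinearMap.rTensor_comp_lTensor, LinearMap.comp_apply,
    lTensor_counit_comul]
  simp

/-- The multiplication `H ⊗_A H → H`. -/
def mulOver : TensorOver k (leftCoinvariants π hπ) H H →ₗ[k] H :=
  (balancedRel k (leftCoinvariants π hπ) H H).liftQ (LinearMap.mul' k H) (by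
    refine Submodule.span_le.2 ?_
    rintro _ ⟨m, a, n, rfl⟩
    rw [SetLike.mem_coe, LinearMap.mem_ker, map_sub, sub_eq_zero, op_smul_eq_mul]
    exact mul_assoc _ _ _)

theorem mulOver_translationMap (x : H) :
    mulOver π hπ (translationMap π hπ x) = algebraMap k H (counit x) :=
  mul_antipode_lTensor_comul_apply x

end Flat

/-! ### Averaging along a colinear map to `H` -/
section Averaging
variable {k : Type u} [Field k] {H : Type v} [Ring H] [HopfAlgebra k H]
  {C : Type v} [AddCommGroup C] [Module k C] [Coalgebra k C] [Module H C] [IsScalarTower k H C]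

open Coalgebra HopfAlgebra

variable {n : ℕ} {e : Fin n → Fin n → H}

theorem sum_antipode_mul_coeff (he : ∀ i j, comul (R := k) (e i j) = ∑ l, e i l ⊗ₜ[k] e l j)
    (hε : ∀ i j, counit (R := k) (e i j) = if i = j then 1 else 0) (i j : Fin n) :
    ∑ l, antipode k (e i l) * e l j = if i = j then 1 else 0 := by
  have h := mul_antipode_rTensor_comul_apply (R := k) (e i j)
  rw [he, hε] at h
  simp only [map_sum, LinearMap.rTensor_tmul, LinearMap.mul'_apply] at h
  rw [h]
  split_ifs <;> simp

theorem sum_coeff_mul_antipode (he : ∀ i j, comul (R := k) (e i j) = ∑ l, e i l ⊗ₜ[k] e l j)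
    (hε : ∀ i j, counit (R := k) (e i j) = if i = j then 1 else 0) (i j : Fin n) :
    ∑ l, e i l * antipode k (e l j) = if i = j then 1 else 0 := by
  have h := mul_antipode_lTensor_comul_apply (R := k) (e i j)
  rw [he, hε] at h
  simp only [map_sum, LinearMap.lTensor_tmul, LinearMap.mul'_apply] at h
  rw [h]
  split_ifs <;> simp

theorem comul_antipode_coeff (he : ∀ i j, comul (R := k) (e i j) = ∑ l, e i l ⊗ₜ[k] e l j)
    (i j : Fin n) : comul (R := k) (antipode k (e i j)) =
      ∑ l, antipode k (e l j) ⊗ₜ[k] antipode k (e i l) := by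
  rw [comul_antipode, he]
  simp

variable (π : H →ₗc[k] C)

/-- The action `H ⊗ C → C` is compatible with the comultiplications. -/
theorem comul_smul_of_comul_eq_sum (hπ : ∀ h x : H, π (h * x) = h • π x)
    (hsurj : Function.Surjective π) {g : H} {x y : Fin n → H}
    (hg : comul (R := k) g = ∑ l, x l ⊗ₜ[k] y l) (c : C) : comul (R := k) (g • c) =
      ∑ l, TensorProduct.map (Algebra.lsmul k k C (x l)) (Algebra.lsmul k k C (y l))
        (comul (R := k) c) := by
  obtain ⟨h, rfl⟩ := hsurj c
  rw [← hπ, ← CoalgHomClass.map_comp_comul_apply, ← CoalgHomClass.map_comp_comul_apply,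
    Bialgebra.comul_mul, hg, Finset.sum_mul, map_sum]
  refine Finset.sum_congr rfl fun l _ => ?_
  generalize comul (R := k) h = t
  induction t with
  | zero => simp
  | add x y hx hy => simp only [map_add, mul_add, hx, hy]
  | tmul a b => simp [hπ]

theorem counit_smul (hπ : ∀ h x : H, π (h * x) = h • π x)
    (hsurj : Function.Surjective π) (g : H) (c : C) :
    counit (R := k) (g • c) = counit (R := k) g * counit (R := k) c := by
  obtain ⟨h, rfl⟩ := hsurj c
  rw [← hπ, CoalgHomClass.counit_comp_apply, CoalgHomClass.counit_comp_apply,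
    Bialgebra.counit_mul]

variable {V : Type v} [AddCommGroup V] [Module k V]

/-- The coaction of `X ⊗ V`, for a right `C`-comodule `V` and the left dual `X` of the right
`H`-comodule with coefficients `e`, in coordinates: the `i`-th copy of `v` goes to
`∑ j, v₀ ⊗ S(e i j) v₁`, the `j`-th summand lying in the `j`-th copy. -/
def matrixCoact (e : Fin n → Fin n → H) (ρ : RightCoaction k C V) :
    (Fin n → V) →ₗ[k] (Fin n → V) ⊗[k] C :=
  LinearMap.lsum k (fun _ => V) k fun i => ∑ j, TensorProduct.map
    (LinearMap.single k (fun _ => V) j) (Algebra.lsmul k k C (antipode k (e i j))) ∘ₗ ρ.coact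

theorem matrixCoact_single (e : Fin n → Fin n → H) (ρ : RightCoaction k C V) (i : Fin n) (v : V) :
    matrixCoact e ρ (LinearMap.single k (fun _ => V) i v) =
      ∑ j, TensorProduct.map (LinearMap.single k (fun _ => V) j)
        (Algebra.lsmul k k C (antipode k (e i j))) (ρ.coact v) := by
  simp only [matrixCoact, LinearMap.lsum_apply, LinearMap.sum_apply, LinearMap.comp_apply,
    LinearMap.proj_apply]
  rw [Finset.sum_eq_single i]
  · simp
  · intro j _ hj
    simp [Pi.single_eq_of_ne hj]
  · simp

/-- The comodule with the structure map `matrixCoact`. -/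
def matrixCoaction (hπ : ∀ h x : H, π (h * x) = h • π x) (hsurj : Function.Surjective π)
    (he : ∀ i j, comul (R := k) (e i j) = ∑ l, e i l ⊗ₜ[k] e l j)
    (hε : ∀ i j, counit (R := k) (e i j) = if i = j then 1 else 0) (ρ : RightCoaction k C V) :
    RightCoaction k C (Fin n → V) where
  coact := matrixCoact e ρ
  coassoc := by
    refine LinearMap.pi_ext' fun i => LinearMap.ext fun v => ?_
    simp only [LinearMap.comp_apply, matrixCoact_single, LinearEquiv.coe_coe]
    have h1 : ∀ t : V ⊗[k] C, TensorProduct.assoc k (Fin n → V) C C ((matrixCoact e ρ).rTensor C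
        (∑ j, TensorProduct.map (LinearMap.single k (fun _ => V) j)
          (Algebra.lsmul k k C (antipode k (e i j))) t)) =
        ∑ j, ∑ l, TensorProduct.map (LinearMap.single k (fun _ => V) l)
          (TensorProduct.map (Algebra.lsmul k k C (antipode k (e j l)))
            (Algebra.lsmul k k C (antipode k (e i j))))
          (TensorProduct.assoc k V C C (ρ.coact.rTensor C t)) := by
      intro t
      induction t with
      | zero => simp
      | add x y hx hy => simp only [map_add, Finset.sum_add_distrib, hx, hy]
      | tmul v c =>
        simp only [map_sum, TensorProduct.map_tmul, LinearMap.rTensor_tmul, matrixCoact_single,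
          TensorProduct.sum_tmul]
        refine Finset.sum_congr rfl fun j _ => Finset.sum_congr rfl fun l _ => ?_
        generalize ρ.coact v = s
        induction s with
        | zero => simp
        | add x y hx hy => simp only [map_add, TensorProduct.add_tmul, hx, hy]
        | tmul v c => simp
    have h2 : ∀ t : V ⊗[k] C, (comul (R := k)).lTensor (Fin n → V)
        (∑ j, TensorProduct.map (LinearMap.single k (fun _ => V) j)
          (Algebra.lsmul k k C (antipode k (e i j))) t) =
        ∑ l, ∑ j, TensorProduct.map (LinearMap.single k (fun _ => V) l)
          (TensorProduct.map (Algebra.lsmul k k C (antipode k (e j l)))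
            (Algebra.lsmul k k C (antipode k (e i j)))) (comul.lTensor V t) := by
      intro t
      induction t with
      | zero => simp
      | add x y hx hy => simp only [map_add, Finset.sum_add_distrib, hx, hy]
      | tmul v c =>
        simp only [map_sum, TensorProduct.map_tmul, LinearMap.lTensor_tmul, Algebra.lsmul_coe,
          comul_smul_of_comul_eq_sum π hπ hsurj (comul_antipode_coeff he _ _),
          TensorProduct.tmul_sum]
    rw [h1, h2, ρ.coassoc_apply, Finset.sum_comm]
  counit_coact := by
    refine LinearMap.pi_ext' fun i => LinearMap.ext fun v => ?_
    simp only [LinearMap.comp_apply, matrixCoact_single, LinearEquiv.coe_coe, LinearMap.id_apply]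
    have h1 : ∀ t : V ⊗[k] C, TensorProduct.rid k (Fin n → V) ((counit (R := k)).lTensor (Fin n → V)
        (∑ j, TensorProduct.map (LinearMap.single k (fun _ => V) j)
          (Algebra.lsmul k k C (antipode k (e i j))) t)) =
        LinearMap.single k (fun _ => V) i (TensorProduct.rid k V (counit.lTensor V t)) := by
      intro t
      induction t with
      | zero => simp
      | add x y hx hy => simp only [map_add, Finset.sum_add_distrib, hx, hy]
      | tmul v c =>
        simp only [map_sum, TensorProduct.map_tmul, LinearMap.lTensor_tmul, Algebra.lsmul_coe,
          counit_smul π hπ hsurj, counit_antipode, hε, TensorProduct.rid_tmul, map_smul]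
        simp
    rw [h1, ρ.counit_coact_apply]

theorem proj_matrixCoact (e : Fin n → Fin n → H) (ρ : RightCoaction k C V) (x : Fin n → V)
    (j : Fin n) : (LinearMap.proj (R := k) (φ := fun _ => V) j).rTensor C (matrixCoact e ρ x) =
      ∑ i, (Algebra.lsmul k k C (antipode k (e i j))).lTensor V (ρ.coact (x i)) := by
  simp only [matrixCoact, LinearMap.lsum_apply, LinearMap.sum_apply, LinearMap.comp_apply,
    LinearMap.proj_apply, map_sum]
  refine Finset.sum_congr rfl fun i _ => ?_
  rw [Finset.sum_eq_single j]
  · rw [← LinearMap.comp_apply, LinearMap.rTensor_comp_map, LinearMap.proj_comp_single_same]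
    rfl
  · intro l _ hl
    rw [← LinearMap.comp_apply, LinearMap.rTensor_comp_map,
      LinearMap.proj_comp_single_ne _ _ _ _ hl.symm]
    simp
  · simp

theorem leftCoactionOf_mul_of_comul_eq_sum (hπ : ∀ h x : H, π (h * x) = h • π x)
    {g : H} {x y : Fin n → H} (hg : comul (R := k) g = ∑ l, x l ⊗ₜ[k] y l) (h : H) :
    (leftCoactionOf π).coact (g * h) = ∑ l, TensorProduct.map (Algebra.lsmul k k C (x l))
      (LinearMap.mulLeft k (y l)) ((leftCoactionOf π).coact h) := by
  simp only [leftCoactionOf, LinearMap.comp_apply, Bialgebra.comul_mul, hg, Finset.sum_mul,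
    map_sum]
  refine Finset.sum_congr rfl fun l _ => ?_
  generalize comul (R := k) h = t
  induction t with
  | zero => simp
  | add x y hx hy => simp only [map_add, mul_add, hx, hy]
  | tmul a b => simp [hπ]

/-- The condition for `t` to lie in `(X ⊗ V) □ H`, in coordinates. -/
theorem matrixCoaction_cotensor (hπ : ∀ h x : H, π (h * x) = h • π x)
    (hsurj : Function.Surjective π)
    (he : ∀ i j, comul (R := k) (e i j) = ∑ l, e i l ⊗ₜ[k] e l j)
    (hε : ∀ i j, counit (R := k) (e i j) = if i = j then 1 else 0) (ρ : RightCoaction k C V)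
    {t : (Fin n → V) ⊗[k] H}
    (ht : t ∈ cotensor (matrixCoaction π hπ hsurj he hε ρ) (leftCoactionOf π)) (j : Fin n) :
    (leftCoactionOf π).coact.lTensor V
        ((LinearMap.proj (R := k) (φ := fun _ => V) j).rTensor H t) =
      ∑ i, ((Algebra.lsmul k k C (antipode k (e i j))).rTensor H).lTensor V
        (TensorProduct.assoc k V C H (ρ.coact.rTensor H
          ((LinearMap.proj (R := k) (φ := fun _ => V) i).rTensor H t))) := by
  rw [mem_cotensor] at ht
  rw [← rTensor_lTensor_apply, ← ht]
  clear ht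
  induction t with
  | zero => simp
  | add x y hx hy => simp only [map_add, Finset.sum_add_distrib, hx, hy]
  | tmul x h =>
    have h1 : ∀ s : (Fin n → V) ⊗[k] C, (LinearMap.proj (R := k) (φ := fun _ => V) j).rTensor
        (C ⊗[k] H) (TensorProduct.assoc k (Fin n → V) C H (s ⊗ₜ h)) =
        TensorProduct.assoc k V C H
          ((LinearMap.proj (R := k) (φ := fun _ => V) j).rTensor C s ⊗ₜ h) := by
      intro s
      induction s with
      | zero => simp
      | add x y hx hy => simp only [map_add, TensorProduct.add_tmul, hx, hy]
      | tmul a b => simp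
    simp only [LinearMap.rTensor_tmul, h1]
    rw [show (matrixCoaction π hπ hsurj he hε ρ).coact x = matrixCoact e ρ x from rfl,
      proj_matrixCoact, TensorProduct.sum_tmul, map_sum]
    refine Finset.sum_congr rfl fun i _ => ?_
    rw [LinearMap.proj_apply]
    generalize ρ.coact (x i) = s
    induction s with
    | zero => simp
    | add x y hx hy => simp only [map_add, TensorProduct.add_tmul, hx, hy]
    | tmul a b => simp

/-- Multiplication by the matrix `S²(e)` carries `(X ⊗ V) □ H` into `X ⊗ (V □ H)`. -/
theorem sum_mul_mem_cotensor (hπ : ∀ h x : H, π (h * x) = h • π x)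
    (hsurj : Function.Surjective π)
    (he : ∀ i j, comul (R := k) (e i j) = ∑ l, e i l ⊗ₜ[k] e l j)
    (hε : ∀ i j, counit (R := k) (e i j) = if i = j then 1 else 0) (ρ : RightCoaction k C V)
    {t : (Fin n → V) ⊗[k] H}
    (ht : t ∈ cotensor (matrixCoaction π hπ hsurj he hε ρ) (leftCoactionOf π)) (j : Fin n) :
    ∑ i, (LinearMap.mulLeft k (antipode k (antipode k (e i j)))).lTensor V
      ((LinearMap.proj (R := k) (φ := fun _ => V) i).rTensor H t) ∈
        cotensor ρ (leftCoactionOf π) := by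
  have h1 := matrixCoaction_cotensor π hπ hsurj he hε ρ ht
  generalize hR : (fun i => (LinearMap.proj (R := k) (φ := fun _ => V) i).rTensor H t) = s at h1 ⊢
  have hs : ∀ i, (LinearMap.proj (R := k) (φ := fun _ => V) i).rTensor H t = s i :=
    fun i => congrFun hR i
  simp only [hs] at h1 ⊢
  rw [mem_cotensor, map_sum, map_sum, map_sum]
  have h2 : ∀ i j, comul (R := k) (antipode k (antipode k (e i j))) =
      ∑ l, antipode k (antipode k (e i l)) ⊗ₜ[k] antipode k (antipode k (e l j)) := by
    intro i j
    rw [comul_antipode, comul_antipode_coeff he]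
    simp
  have h3 : ∀ (i) (z : V ⊗[k] H), (leftCoactionOf π).coact.lTensor V
      ((LinearMap.mulLeft k (antipode k (antipode k (e i j)))).lTensor V z) =
      ∑ l, (TensorProduct.map (Algebra.lsmul k k C (antipode k (antipode k (e i l))))
        (LinearMap.mulLeft k (antipode k (antipode k (e l j))))).lTensor V
          ((leftCoactionOf π).coact.lTensor V z) := by
    intro i z
    induction z with
    | zero => simp
    | add x y hx hy => simp only [map_add, Finset.sum_add_distrib, hx, hy]
    | tmul v h =>
      simp only [LinearMap.lTensor_tmul, LinearMap.mulLeft_apply,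
        leftCoactionOf_mul_of_comul_eq_sum π hπ (h2 i j), TensorProduct.tmul_sum]
  have h4 : ∀ (a : H) (z : V ⊗[k] H), TensorProduct.assoc k V C H (ρ.coact.rTensor H
      ((LinearMap.mulLeft k a).lTensor V z)) = ((LinearMap.mulLeft k a).lTensor C).lTensor V
        (TensorProduct.assoc k V C H (ρ.coact.rTensor H z)) := by
    intro a z
    induction z with
    | zero => simp
    | add x y hx hy => simp only [map_add, hx, hy]
    | tmul v h =>
      simp only [LinearMap.lTensor_tmul, LinearMap.mulLeft_apply, LinearMap.rTensor_tmul]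
      generalize ρ.coact v = s
      induction s with
      | zero => simp
      | add x y hx hy => simp only [map_add, TensorProduct.add_tmul, hx, hy]
      | tmul a b => simp
  simp only [h3, h4, h1]
  -- `S²(e i l) S(e m i) = S(e m i S(e i l))`
  have h5 : ∀ (l m : Fin n), ∑ i, antipode k (antipode k (e i l)) * antipode k (e m i) =
      if m = l then 1 else 0 := by
    intro l m
    simp only [← antipode_mul_antidistrib]
    rw [← map_sum, sum_coeff_mul_antipode he hε]
    split_ifs <;> simp
  have h6 : ∀ (a b c : H) (z : V ⊗[k] (C ⊗[k] H)),
      (TensorProduct.map (Algebra.lsmul k k C a) (LinearMap.mulLeft k b)).lTensor V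
        (((Algebra.lsmul k k C c).rTensor H).lTensor V z) =
      (TensorProduct.map (Algebra.lsmul k k C (a * c)) (LinearMap.mulLeft k b)).lTensor V z := by
    intro a b c z
    rw [← LinearMap.lTensor_comp_apply, LinearMap.map_comp_rTensor, map_mul]
    rfl
  simp only [map_sum, h6]
  rw [Finset.sum_comm]
  have h7 : ∀ (l m : Fin n) (z : V ⊗[k] (C ⊗[k] H)),
      ∑ i, (TensorProduct.map (Algebra.lsmul k k C (antipode k (antipode k (e i l)) *
        antipode k (e m i))) (LinearMap.mulLeft k (antipode k (antipode k (e l j))))).lTensor V z =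
      if m = l then ((LinearMap.mulLeft k (antipode k (antipode k (e l j)))).lTensor C).lTensor V z
        else 0 := by
    intro l m z
    have := map_sum ((LinearMap.lTensorHom V (R := k)) ∘ₗ
      (TensorProduct.mapBilinear (RingHom.id k) C H C H).flip
        (LinearMap.mulLeft k (antipode k (antipode k (e l j)))) ∘ₗ
      (Algebra.lsmul k k C : H →ₐ[k] _).toLinearMap)
      (fun i => antipode k (antipode k (e i l)) * antipode k (e m i)) Finset.univ
    rw [h5] at this
    have h8 := LinearMap.congr_fun this z
    rw [LinearMap.sum_apply] at h8
    refine h8.symm.trans ?_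
    split_ifs
    · have h9 : (Algebra.lsmul k k C : H →ₐ[k] _).toLinearMap 1 = LinearMap.id :=
        map_one (Algebra.lsmul k k C : H →ₐ[k] _)
      rw [LinearMap.comp_apply, LinearMap.comp_apply, h9]
      rfl
    · rw [map_zero]; rfl
  have h10 : ∀ l : Fin n, ∑ i, ∑ m, (TensorProduct.map
        (Algebra.lsmul k k C (antipode k (antipode k (e i l)) * antipode k (e m i)))
        (LinearMap.mulLeft k (antipode k (antipode k (e l j))))).lTensor V
        (TensorProduct.assoc k V C H (ρ.coact.rTensor H (s m))) =
      ((LinearMap.mulLeft k (antipode k (antipode k (e l j)))).lTensor C).lTensor V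
        (TensorProduct.assoc k V C H (ρ.coact.rTensor H (s l))) := by
    intro l
    rw [Finset.sum_comm]
    simp only [h7]
    simp
  simp only [h10]

/-- If `F : V → H` is colinear, then `v ⊗ h ↦ S(F v) h` maps `V □ H` to `A`. -/
theorem antipode_mul_mem (hπ : ∀ h x : H, π (h * x) = h • π x)
    (hS : Function.Bijective (antipode k (A := H))) {ρ : RightCoaction k C V} {F : V →ₗ[k] H}
    (hF : ρ.IsColinear (rightCoactionOf π) F) {t : V ⊗[k] H}
    (ht : t ∈ cotensor ρ (leftCoactionOf π)) :
    LinearMap.mul' k H ((antipode k ∘ₗ F).rTensor H t) ∈ leftCoinvariants π hπ := by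
  obtain ⟨u, hu⟩ := galoisMap_mem π hS hπ
    (rTensor_mem_cotensor ((twistedCoaction_isColinear π hS).comp hF) ht)
  have h1 : ∀ s : H ⊗[k] H, TensorProduct.rid k H (counit.lTensor H (galoisMap (k := k) s)) =
      LinearMap.mul' k H s := by
    intro s
    induction s with
    | zero => simp
    | add x y hx hy => simp only [map_add, hx, hy]
    | tmul a b =>
      rw [galoisMap_tmul, ← rTensor_lTensor_apply, lTensor_counit_comul]
      simp
  rw [← h1, ← hu, ← rTensor_lTensor_apply]
  generalize counit.lTensor _ u = r
  induction r with
  | zero => simp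
  | add x y hx hy => simpa only [map_add] using add_mem hx hy
  | tmul a c =>
    rw [LinearMap.rTensor_tmul, TensorProduct.rid_tmul]
    exact Subalgebra.smul_mem _ a.2 c

/-- Let `V` be a finite-dimensional comodule with a nonzero colinear map to `H`. If `H` is left
coflat over `C`, then there are elements of `V □ H` and colinear maps `V → H` such that the
corresponding values of `v ⊗ h ↦ S(F v) h` add up to `1`. -/
theorem exists_sum_antipode_mul_eq_one (hπ : ∀ h x : H, π (h * x) = h • π x)
    (hsurj : Function.Surjective π) (hcoflat : (leftCoactionOf π).IsCoflat)
    [FiniteDimensional k V] (ρ : RightCoaction k C V) {f : V →ₗ[k] H}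
    (hf : ρ.IsColinear (rightCoactionOf π) f) (hf0 : f ≠ 0) :
    ∃ (n : ℕ) (t : Fin n → V ⊗[k] H) (F : Fin n → V →ₗ[k] H),
      (∀ j, t j ∈ cotensor ρ (leftCoactionOf π)) ∧
      (∀ j, ρ.IsColinear (rightCoactionOf π) (F j)) ∧
      ∑ j, LinearMap.mul' k H ((antipode k ∘ₗ F j).rTensor H (t j)) = 1 := by
  -- a finite-dimensional `H`-subcomodule `W` of `H` containing the image of `f`
  let σ := rightCoactionOf (CoalgHom.id k H)
  have hσ : ∀ x, σ.coact x = comul (R := k) x := fun x => by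
    simp only [σ, rightCoactionOf, LinearMap.comp_apply]
    exact LinearMap.congr_fun (LinearMap.lTensor_id H H) _
  let W := σ.hull (Set.range (f ∘ Module.finBasis k V))
  have hWfin : FiniteDimensional k W := σ.finiteDimensional_hull (Set.finite_range _)
  have hW := σ.isSubcomodule_hull (Set.range (f ∘ Module.finBasis k V))
  have hfW : ∀ v, f v ∈ W := by
    intro v
    have : (⊤ : Submodule k V) ≤ W.comap f := by
      rw [← (Module.finBasis k V).span_eq, Submodule.span_le]
      rintro _ ⟨i, rfl⟩
      exact σ.subset_hull _ ⟨i, rfl⟩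
    exact this trivial
  let g : V →ₗ[k] W := f.codRestrict W hfW
  let w := Module.finBasis k W
  let τ := σ.sub W hW
  let e := τ.coeff w
  have he : ∀ i j, comul (R := k) (e i j) = ∑ l, e i l ⊗ₜ[k] e l j := τ.comul_coeff w
  have hε : ∀ i j, counit (R := k) (e i j) = if i = j then 1 else 0 := τ.counit_coeff w
  let φ : Fin (Module.finrank k W) → V →ₗ[k] k := fun i => w.coord i ∘ₗ g
  have hcomul : ∀ j, comul (R := k) (w j : H) = ∑ i, (w i : H) ⊗ₜ[k] e i j := by
    intro j
    rw [← hσ]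
    have := (σ.sub_isColinear W hW).apply (w j)
    rw [show σ.coact (w j : H) = σ.coact (W.subtype (w j)) from rfl, this, τ.coact_basis w]
    simp [e]
  have hφ : ∀ (v : V) (l), TensorProduct.lid k C ((φ l).rTensor C (ρ.coact v)) =
      ∑ i, φ i v • π (e l i) := by
    intro v l
    have h1 : g.rTensor C (ρ.coact v) = ∑ l, w l ⊗ₜ[k] ∑ i, φ i v • π (e l i) := by
      apply Module.Flat.rTensor_preserves_injective_linearMap (M := C) W.subtype
        W.injective_subtype
      rw [← LinearMap.rTensor_comp_apply, show W.subtype ∘ₗ g = f from rfl, ← hf.apply]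
      have h2 : f v = ∑ i, φ i v • (w i : H) := by
        have := congrArg W.subtype (w.sum_repr (g v))
        rw [map_sum] at this
        exact this.symm
      simp only [rightCoactionOf, LinearMap.comp_apply, h2, map_sum, map_smul, hcomul,
        LinearMap.lTensor_tmul, LinearMap.rTensor_tmul, Finset.smul_sum, TensorProduct.tmul_sum,
        TensorProduct.tmul_smul]
      exact Finset.sum_comm
    rw [RightCoaction.tensor_eq_sum w (g.rTensor C (ρ.coact v))] at h1
    have h3 := basis_tmul_injective w h1 l
    rwa [← LinearMap.rTensor_comp_apply] at h3
  -- a surjection from `X ⊗ V` to the trivial comodule `k`, realized as the subalgebra `k · 1`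
  -- of `H` to stay in the universe of the test comodules
  let μ := matrixCoaction π hπ hsurj he hε ρ
  let T := (⊥ : Subalgebra k H)
  have hg1 : comul (R := k) (π 1) = π 1 ⊗ₜ[k] π 1 := by
    rw [← CoalgHomClass.map_comp_comul_apply]
    simp [Algebra.TensorProduct.one_def]
  have hg2 : counit (R := k) (π 1) = 1 := by
    rw [CoalgHomClass.counit_comp_apply]
    simp
  let ι := RightCoaction.trivial T (π 1) hg1 hg2
  let Φ : (Fin (Module.finrank k W) → V) →ₗ[k] k := LinearMap.lsum k (fun _ => V) k φ
  let Ψ := Algebra.linearMap k T ∘ₗ Φ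
  have hΨ : μ.IsColinear ι Ψ := by
    refine LinearMap.pi_ext' fun i => LinearMap.ext fun v => ?_
    have h1 : ∀ j (s : V ⊗[k] C), Ψ.rTensor C (TensorProduct.map (LinearMap.single k (fun _ => V) j)
        (Algebra.lsmul k k C (antipode k (e i j))) s) =
        (1 : T) ⊗ₜ (antipode k (e i j) • TensorProduct.lid k C ((φ j).rTensor C s)) := by
      intro j s
      induction s with
      | zero => simp
      | add x y hx hy => simp only [map_add, smul_add, TensorProduct.tmul_add, hx, hy]
      | tmul v c =>
        have h2 : Φ (Pi.single j v) = φ j v := LinearMap.lsum_piSingle _ _ _ _ _ _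
        simp only [TensorProduct.map_tmul, LinearMap.rTensor_tmul, Ψ, LinearMap.comp_apply,
          LinearMap.single_apply, h2, Algebra.linearMap_apply, Algebra.algebraMap_eq_smul_one,
          TensorProduct.lid_tmul, TensorProduct.smul_tmul, Algebra.lsmul_coe]
        rw [smul_comm]
    have h2 : Φ (Pi.single i v) = φ i v := LinearMap.lsum_piSingle _ _ _ _ _ _
    change ι.coact (Ψ (Pi.single i v)) =
      Ψ.rTensor C (matrixCoact e ρ (LinearMap.single k (fun _ => V) i v))
    rw [matrixCoact_single, map_sum]
    simp only [h1, hφ, ← TensorProduct.tmul_sum]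
    change Ψ (Pi.single i v) ⊗ₜ[k] π 1 = _
    simp only [Ψ, LinearMap.comp_apply, h2, Algebra.linearMap_apply,
      Algebra.algebraMap_eq_smul_one, TensorProduct.smul_tmul]
    congr 1
    simp only [Finset.smul_sum, smul_comm _ (φ _ v)]
    rw [Finset.sum_comm]
    simp only [← Finset.smul_sum, ← hπ, ← map_sum]
    simp only [sum_antipode_mul_coeff he hε]
    rw [Finset.sum_eq_single i]
    · simp
    · intro j _ hj
      simp [hj.symm]
    · simp
  have hΨs : Function.Surjective Ψ := by
    have h1 : ∃ i v, φ i v ≠ 0 := by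
      by_contra! h0
      apply hf0
      ext v
      have h2 : g v = 0 := w.repr.map_eq_zero_iff.1 (Finsupp.ext fun i => h0 i v)
      exact congrArg Subtype.val h2
    obtain ⟨i, v, hv⟩ := h1
    intro y
    obtain ⟨c, hc⟩ := Algebra.mem_bot.1 y.2
    have h2 : Φ (Pi.single i ((c / φ i v) • v)) = φ i ((c / φ i v) • v) :=
      LinearMap.lsum_piSingle _ _ _ _ _ _
    refine ⟨Pi.single i ((c / φ i v) • v), Subtype.ext ?_⟩
    rw [← hc]
    simp only [Ψ, LinearMap.comp_apply, h2, map_smul, smul_eq_mul, div_mul_cancel₀ _ hv]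
    rfl
  have h1mem : (1 : T) ⊗ₜ[k] (1 : H) ∈ cotensor ι (leftCoactionOf π) := by
    rw [mem_cotensor]
    simp [ι, RightCoaction.trivial, leftCoactionOf, Algebra.TensorProduct.one_def]
  obtain ⟨t, ht, ht1⟩ := hcoflat.exists_lift_of_surjective hΨ hΨs h1mem
  -- in coordinates, `t` lifts `1`: its components `t i` satisfy `∑ (φ i ⊗ id)(t i) = 1`
  have hsum : ∑ i, LinearMap.mul' k H ((Algebra.linearMap k H ∘ₗ φ i).rTensor H
      ((LinearMap.proj (R := k) (φ := fun _ => V) i).rTensor H t)) = 1 := by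
    have h2 := congrArg (fun z => LinearMap.mul' k H (T.val.toLinearMap.rTensor H z)) ht1
    simp only [LinearMap.rTensor_tmul, LinearMap.mul'_apply] at h2
    rw [← LinearMap.rTensor_comp_apply] at h2
    have h3 : T.val.toLinearMap ∘ₗ Ψ = ∑ i, (Algebra.linearMap k H ∘ₗ φ i) ∘ₗ
        LinearMap.proj (R := k) (φ := fun _ => V) i := by
      ext i v
      simp [Ψ, Φ]
    have h4 : ∀ s : Finset (Fin (Module.finrank k W)), ∀ z,
        LinearMap.rTensor H (∑ i ∈ s, (Algebra.linearMap k H ∘ₗ φ i) ∘ₗ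
          LinearMap.proj (R := k) (φ := fun _ => V) i) z =
        ∑ i ∈ s, LinearMap.rTensor H ((Algebra.linearMap k H ∘ₗ φ i) ∘ₗ
          LinearMap.proj (R := k) (φ := fun _ => V) i) z := by
      intro s z
      rw [← LinearMap.coe_rTensorHom, map_sum, LinearMap.sum_apply]
    rw [h3, h4, map_sum] at h2
    simp only [LinearMap.rTensor_comp_apply] at h2
    simpa only [LinearMap.rTensor_comp_apply, AlgHom.toLinearMap_apply, map_one, mul_one] using h2
  -- with `F j v = ∑ φ i (v) e j i` and the elements `∑ S²(e i j) t i` of `V □ H`, the sum over `j`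
  -- of the products `S(F j v) S²(e i j) = S(S(e i j) F j v)` collapses to the values of the `φ i`
  let F : Fin (Module.finrank k W) → V →ₗ[k] H := fun j => ∑ i, (φ i).smulRight (e j i)
  refine ⟨_, fun j => ∑ i, (LinearMap.mulLeft k (antipode k (antipode k (e i j)))).lTensor V
      ((LinearMap.proj (R := k) (φ := fun _ => V) i).rTensor H t), F,
    sum_mul_mem_cotensor π hπ hsurj he hε ρ ht, ?_, ?_⟩
  · intro j
    ext v
    have h1 : ∀ s : V ⊗[k] C, (F j).rTensor C s =
        ∑ i, e j i ⊗ₜ TensorProduct.lid k C ((φ i).rTensor C s) := by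
      intro s
      induction s with
      | zero => simp
      | add x y hx hy => simp only [map_add, TensorProduct.tmul_add, Finset.sum_add_distrib, hx, hy]
      | tmul v c => simp [F, TensorProduct.sum_tmul, TensorProduct.smul_tmul]
    rw [LinearMap.comp_apply, LinearMap.comp_apply, h1]
    simp only [hφ, TensorProduct.tmul_sum, F, LinearMap.sum_apply, LinearMap.smulRight_apply,
      map_sum, map_smul, rightCoactionOf, LinearMap.comp_apply, he, LinearMap.lTensor_tmul,
      Finset.smul_sum, TensorProduct.tmul_smul]
    exact Finset.sum_comm
  · rw [← hsum]
    simp only [map_sum]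
    rw [Finset.sum_comm]
    refine Finset.sum_congr rfl fun m _ => ?_
    generalize (LinearMap.proj (R := k) (φ := fun _ => V) m).rTensor H t = z
    induction z with
    | zero => simp
    | add x y hx hy => simp only [map_add, Finset.sum_add_distrib, hx, hy]
    | tmul v h =>
      simp only [LinearMap.lTensor_tmul, LinearMap.rTensor_tmul, LinearMap.mul'_apply,
        LinearMap.mulLeft_apply, LinearMap.comp_apply, F, LinearMap.sum_apply,
        LinearMap.smulRight_apply, map_sum, map_smul, Finset.sum_mul, smul_mul_assoc,
        ← mul_assoc, ← antipode_mul_antidistrib]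
      rw [Finset.sum_comm]
      simp only [← Finset.smul_sum, ← Finset.sum_mul, ← map_sum, sum_antipode_mul_coeff he hε]
      rw [Finset.sum_eq_single m]
      · simp [Algebra.smul_def]
      · intro j _ hj
        simp [hj.symm]
      · simp

end Averaging

/-! ### Colinear maps to the coalgebra -/
section Generic
variable {k : Type u} [Field k] {C : Type v} [AddCommGroup C] [Module k C] [Coalgebra k C]
variable {V : Type v} [AddCommGroup V] [Module k V]

open Coalgebra

/-- `C` as a right comodule over itself. -/
abbrev regularCoaction (k : Type u) [Field k] (C : Type v) [AddCommGroup C] [Module k C]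
    [Coalgebra k C] : RightCoaction k C C := rightCoactionOf (CoalgHom.id k C)

theorem regularCoaction_coact (c : C) : (regularCoaction k C).coact c = comul (R := k) c :=
  LinearMap.congr_fun (LinearMap.lTensor_id C C) _

theorem isColinear_coalgHom {H : Type v} [AddCommGroup H] [Module k H] [Coalgebra k H]
    (π : H →ₗc[k] C) : (rightCoactionOf π).IsColinear (regularCoaction k C) (π : H →ₗ[k] C) := by
  ext x
  simp only [LinearMap.comp_apply, LinearMap.coe_coe]
  rw [regularCoaction_coact, ← CoalgHomClass.map_comp_comul_apply, rightCoactionOf,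
    LinearMap.comp_apply, ← LinearMap.comp_apply (LinearMap.rTensor _ _),
    LinearMap.rTensor_comp_lTensor]

/-- The colinear map `V → C`, `v ↦ φ(v₀) v₁`, for a functional `φ` on `V`. -/
def RightCoaction.toRegular (ρ : RightCoaction k C V) (φ : V →ₗ[k] k) : V →ₗ[k] C :=
  (TensorProduct.lid k C).toLinearMap ∘ₗ φ.rTensor C ∘ₗ ρ.coact

theorem RightCoaction.toRegular_isColinear (ρ : RightCoaction k C V) (φ : V →ₗ[k] k) :
    ρ.IsColinear (regularCoaction k C) (ρ.toRegular φ) := by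
  ext v
  rw [LinearMap.comp_apply, LinearMap.comp_apply, regularCoaction_coact]
  have h1 : ∀ t : V ⊗[k] C, comul (R := k) (TensorProduct.lid k C (φ.rTensor C t)) =
      TensorProduct.lid k (C ⊗[k] C) (φ.rTensor (C ⊗[k] C) (comul.lTensor V t)) := by
    intro t
    induction t with
    | zero => simp
    | add x y hx hy => simp only [map_add, hx, hy]
    | tmul v c => simp
  have h2 : ∀ t : V ⊗[k] C, (ρ.toRegular φ).rTensor C t = TensorProduct.lid k (C ⊗[k] C)
      (φ.rTensor (C ⊗[k] C) (TensorProduct.assoc k V C C (ρ.coact.rTensor C t))) := by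
    intro t
    induction t with
    | zero => simp
    | add x y hx hy => simp only [map_add, hx, hy]
    | tmul v c =>
      simp only [LinearMap.rTensor_tmul, toRegular, LinearMap.comp_apply, LinearEquiv.coe_coe]
      generalize ρ.coact v = s
      induction s with
      | zero => simp
      | add x y hx hy => simp only [map_add, TensorProduct.add_tmul, hx, hy]
      | tmul v c => simp [TensorProduct.smul_tmul']
  rw [h2, ρ.coassoc_apply, ← h1]
  rfl

theorem RightCoaction.counit_toRegular (ρ : RightCoaction k C V) (φ : V →ₗ[k] k) (v : V) :
    counit (R := k) (ρ.toRegular φ v) = φ v := by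
  have h1 : ∀ t : V ⊗[k] C, counit (R := k) (TensorProduct.lid k C (φ.rTensor C t)) =
      φ (TensorProduct.rid k V (counit.lTensor V t)) := by
    intro t
    induction t with
    | zero => simp
    | add x y hx hy => simp only [map_add, hx, hy]
    | tmul v c => simp [mul_comm]
  simp only [toRegular, LinearMap.comp_apply, LinearEquiv.coe_coe]
  rw [h1, ρ.counit_coact_apply]

end Generic

/-! ### Left faithful coflatness -/
section FaithfullyCoflat
variable {k : Type u} [Field k] {H : Type v} [Ring H] [HopfAlgebra k H]
  {C : Type v} [AddCommGroup C] [Module k C] [Coalgebra k C] [Module H C] [IsScalarTower k H C]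
  {V : Type v} [AddCommGroup V] [Module k V]

open Coalgebra HopfAlgebra

variable (π : H →ₗc[k] C) (hπ : ∀ h x : H, π (h * x) = h • π x)

/-- A finite-dimensional comodule with a nonzero colinear map to `H ⊗_A H` has `V □ H ≠ 0`. -/
theorem exists_cotensor_ne_zero (hS : Function.Bijective (antipode k (A := H)))
    (hsurj : Function.Surjective π) (hcoflat : (leftCoactionOf π).IsCoflat)
    (hflat : IsRightFlat k (leftCoinvariants π hπ) H)
    [FiniteDimensional k V] (ρ : RightCoaction k C V)
    {j : V →ₗ[k] TensorOver k (leftCoinvariants π hπ) H H}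
    (hj : ρ.IsColinear (tensorCoaction π hπ hS H) j) (hj0 : j ≠ 0) :
    ∃ t ∈ cotensor ρ (leftCoactionOf π), t ≠ 0 := by
  obtain ⟨f, hf, hf0⟩ := exists_isColinear_ne_zero π hπ hS hflat ρ hj hj0
  obtain ⟨n, t, F, ht, -, h1⟩ := exists_sum_antipode_mul_eq_one π hπ hsurj hcoflat ρ hf hf0
  by_contra! h0
  have := nontrivial_hopf k H
  apply zero_ne_one (α := H)
  rw [← h1]
  symm
  refine Finset.sum_eq_zero fun j _ => ?_
  rw [h0 _ (ht j), map_zero, map_zero]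

/-- Multiplication recovers `g S(h₁) ⊗ h₂` from the element of `(H ⊗_A H) □ H` corresponding to
`g ⊗ h`; so it is injective there. -/
theorem mulOver_unitMap (w : H ⊗[k] H) :
    (mulOver π hπ).rTensor H (unitMap π hπ H w) = galoisInv w := by
  induction w with
  | zero => simp
  | add x y hx hy => simp only [map_add, hx, hy]
  | tmul p h =>
    simp only [unitMap, LinearMap.comp_apply, LinearMap.lTensor_tmul,
      LinearEquiv.coe_coe, TensorProduct.mk_apply, galoisInv_tmul]
    generalize (antipode k).rTensor H (comul (R := k) h) = s
    induction s with
    | zero => simp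
    | add x y hx hy => simp only [map_add, TensorProduct.tmul_add, hx, hy]
    | tmul g c =>
      simp only [LinearMap.rTensor_tmul, TensorProduct.assoc_symm_tmul, LinearMap.mulLeft_apply,
        one_mul]
      rfl

/-- The map `x ↦ x₁ ⊗ S(x₂)` factors through `π`. Otherwise the image of `ker π` contains a
finite-dimensional subcomodule `V ≠ 0`, and `V □ H ≠ 0`; but `V` is annihilated by the
multiplication, which is injective on `(H ⊗_A H) □ H ≅ H ⊗ H`. -/
theorem translationMap_eq_zero (hS : Function.Bijective (antipode k (A := H)))
    (hsurj : Function.Surjective π) (hcoflat : (leftCoactionOf π).IsCoflat)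
    (hflat : IsRightFlat k (leftCoinvariants π hπ) H) {x : H} (hx : π x = 0) :
    translationMap π hπ x = 0 := by
  by_contra hne
  let τ := tensorCoaction π hπ hS H
  have hK := RightCoaction.isSubcomodule_ker (isColinear_coalgHom π)
  let K := LinearMap.ker (π : H →ₗ[k] C)
  let j : K →ₗ[k] TensorOver k (leftCoinvariants π hπ) H H := translationMap π hπ ∘ₗ K.subtype
  have hj : ((rightCoactionOf π).sub K hK).IsColinear τ j :=
    (translationMap_isColinear π hπ hS).comp ((rightCoactionOf π).sub_isColinear K hK)
  have hU := RightCoaction.isSubcomodule_range hj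
  let V := τ.hull {translationMap π hπ x}
  have hV := τ.isSubcomodule_hull {translationMap π hπ x}
  have hVfin : FiniteDimensional k V := τ.finiteDimensional_hull (Set.finite_singleton _)
  have hVU : V ≤ LinearMap.range j := RightCoaction.hull_le hU (by
    rintro _ rfl
    exact ⟨⟨x, hx⟩, rfl⟩)
  obtain ⟨t, ht, ht0⟩ := exists_cotensor_ne_zero π hπ hS hsurj hcoflat hflat (τ.sub V hV)
    (τ.sub_isColinear V hV) (fun h0 => hne (LinearMap.congr_fun h0
      ⟨translationMap π hπ x, τ.subset_hull _ rfl⟩))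
  apply ht0
  apply Module.Flat.rTensor_preserves_injective_linearMap (M := H) V.subtype V.injective_subtype
  obtain ⟨u, hu⟩ := exists_unitMap_eq π hπ hS H hcoflat
    (rTensor_mem_cotensor (τ.sub_isColinear V hV) ht)
  have h0 : mulOver π hπ ∘ₗ V.subtype = 0 := by
    ext v
    obtain ⟨y, hy⟩ := hVU v.2
    change mulOver π hπ (v : TensorOver k (leftCoinvariants π hπ) H H) = 0
    rw [← hy]
    change mulOver π hπ (translationMap π hπ y) = 0
    rw [mulOver_translationMap, ← CoalgHomClass.counit_comp_apply π,
      show π (y : H) = 0 from y.2, map_zero, map_zero]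
  have h1 : galoisInv u = 0 := by
    rw [← mulOver_unitMap π hπ, hu, ← LinearMap.rTensor_comp_apply, h0]
    simp
  have h2 : u = 0 := by rw [← galoisMap_galoisInv u, h1, map_zero]
  rw [← hu, h2, map_zero, map_zero]

/-- A colinear section `C → H ⊗_A H`, `π(x) ↦ x₁ ⊗ S(x₂)`. -/
theorem exists_translation (hS : Function.Bijective (antipode k (A := H)))
    (hsurj : Function.Surjective π) (hcoflat : (leftCoactionOf π).IsCoflat)
    (hflat : IsRightFlat k (leftCoinvariants π hπ) H) :
    ∃ κ : C →ₗ[k] TensorOver k (leftCoinvariants π hπ) H H,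
      (∀ x, κ (π x) = translationMap π hπ x) ∧
      (regularCoaction k C).IsColinear (tensorCoaction π hπ hS H) κ ∧
      ∀ c, counitMap π hπ (κ c) = c := by
  obtain ⟨s, hs⟩ := LinearMap.exists_rightInverse_of_surjective (π : H →ₗ[k] C)
    (LinearMap.range_eq_top.2 hsurj)
  have h1 : ∀ x, translationMap π hπ (s (π x)) = translationMap π hπ x := by
    intro x
    rw [← sub_eq_zero, ← map_sub]
    apply translationMap_eq_zero π hπ hS hsurj hcoflat hflat
    rw [map_sub, sub_eq_zero]
    exact LinearMap.congr_fun hs (π x)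
  refine ⟨translationMap π hπ ∘ₗ s, h1, ?_, ?_⟩
  · ext c
    obtain ⟨x, rfl⟩ := hsurj c
    have h2 := (translationMap_isColinear π hπ hS).apply x
    have h3 := (isColinear_coalgHom π).apply x
    have h4 : (translationMap π hπ ∘ₗ s) ∘ₗ (π : H →ₗ[k] C) = translationMap π hπ :=
      LinearMap.ext h1
    rw [LinearMap.comp_apply, LinearMap.comp_apply, LinearMap.comp_apply, h1, h2]
    rw [show π x = (π : H →ₗ[k] C) x from rfl, h3, ← LinearMap.rTensor_comp_apply, h4]
  · intro c
    obtain ⟨x, rfl⟩ := hsurj c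
    rw [LinearMap.comp_apply, h1, counitMap_translationMap]

/-- Every nonzero finite-dimensional right comodule has a nonzero colinear map to `H`. -/
theorem exists_isColinear_ne_zero_of_nontrivial (hS : Function.Bijective (antipode k (A := H)))
    (hsurj : Function.Surjective π) (hcoflat : (leftCoactionOf π).IsCoflat)
    (hflat : IsRightFlat k (leftCoinvariants π hπ) H)
    [FiniteDimensional k V] [Nontrivial V] (ρ : RightCoaction k C V) :
    ∃ f : V →ₗ[k] H, ρ.IsColinear (rightCoactionOf π) f ∧ f ≠ 0 := by
  obtain ⟨κ, -, hκ, hκ'⟩ := exists_translation π hπ hS hsurj hcoflat hflat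
  obtain ⟨v, hv⟩ := exists_ne (0 : V)
  obtain ⟨φ, hφ⟩ := not_forall.1 (mt (Module.forall_dual_apply_eq_zero_iff k v).1 hv)
  refine exists_isColinear_ne_zero π hπ hS hflat ρ (hκ.comp (ρ.toRegular_isColinear φ)) ?_
  intro h0
  apply hφ
  have h1 := congrArg (fun t => counit (R := k) (counitMap π hπ t)) (LinearMap.congr_fun h0 v)
  simpa only [LinearMap.comp_apply, hκ', ρ.counit_toRegular, LinearMap.zero_apply,
    map_zero] using h1

/-- If `H` is left coflat over `C` and right flat over `A`, then it is left faithfully coflat. -/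
theorem isFaithfullyCoflat (hS : Function.Bijective (antipode k (A := H)))
    (hsurj : Function.Surjective π) (hcoflat : (leftCoactionOf π).IsCoflat)
    (hflat : IsRightFlat k (leftCoinvariants π hπ) H) :
    (leftCoactionOf π).IsFaithfullyCoflat := by
  refine ⟨hcoflat, fun V _ _ ρ hV => ?_⟩
  obtain ⟨v, hv⟩ := exists_ne (0 : V)
  let U := ρ.hull {v}
  have hU := ρ.isSubcomodule_hull {v}
  have hUfin : FiniteDimensional k U := ρ.finiteDimensional_hull (Set.finite_singleton _)
  have hUnt : Nontrivial U :=
    ⟨⟨v, ρ.subset_hull _ rfl⟩, 0, fun h => hv (congrArg Subtype.val h)⟩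
  obtain ⟨f, hf, hf0⟩ := exists_isColinear_ne_zero_of_nontrivial π hπ hS hsurj hcoflat hflat
    (ρ.sub U hU)
  obtain ⟨n, t, F, ht, -, h1⟩ :=
    exists_sum_antipode_mul_eq_one π hπ hsurj hcoflat (ρ.sub U hU) hf hf0
  by_contra hn
  rw [not_nontrivial_iff_subsingleton] at hn
  have := nontrivial_hopf k H
  apply zero_ne_one (α := H)
  rw [← h1]
  symm
  refine Finset.sum_eq_zero fun j _ => ?_
  have h2 : U.subtype.rTensor H (t j) = 0 := congrArg Subtype.val (Subsingleton.elim
    (⟨_, rTensor_mem_cotensor (ρ.sub_isColinear U hU) (ht j)⟩ :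
      cotensor ρ (leftCoactionOf π)) 0)
  have h3 : t j = 0 := Module.Flat.rTensor_preserves_injective_linearMap (M := H) U.subtype
    U.injective_subtype (h2.trans (map_zero _).symm)
  rw [h3, map_zero, map_zero]

end FaithfullyCoflat

/-! ### Right faithfulness from a coideal of finite codimension -/
section Coideal
variable {k : Type u} [Field k] {H : Type v} [Ring H] [HopfAlgebra k H]
  {C : Type v} [AddCommGroup C] [Module k C] [Coalgebra k C] [Module H C] [IsScalarTower k H C]

open Coalgebra HopfAlgebra

variable (π : H →ₗc[k] C) (hπ : ∀ h x : H, π (h * x) = h • π x)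

/-- If the images of right `A`-linear maps `H → A` generate the unit ideal, then `H ⊗_A N ≠ 0`
for every `N ≠ 0`. -/
theorem nontrivial_tensorOver_of_sum_eq_one {n : ℕ}
    {ψ : Fin n → H →ₗ[k] leftCoinvariants π hπ}
    (hψ : ∀ j (x : H) (a : leftCoinvariants π hπ), ψ j (x * a) = ψ j x * a)
    {h : Fin n → H} (h1 : ∑ j, ψ j (h j) = 1)
    (N : Type v) [AddCommGroup N] [Module k N] [Module (leftCoinvariants π hπ) N]
    [IsScalarTower k (leftCoinvariants π hπ) N] [Nontrivial N] :
    Nontrivial (TensorOver k (leftCoinvariants π hπ) H N) := by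
  by_contra hn
  rw [not_nontrivial_iff_subsingleton] at hn
  obtain ⟨y, hy⟩ := exists_ne (0 : N)
  apply hy
  rw [← one_smul (leftCoinvariants π hπ) y, ← h1, Finset.sum_smul]
  refine Finset.sum_eq_zero fun j _ => ?_
  let Θ : TensorOver k (leftCoinvariants π hπ) H N →ₗ[k] N :=
    (balancedRel k (leftCoinvariants π hπ) H N).liftQ
      (TensorProduct.lift ((Algebra.lsmul k k N).toLinearMap ∘ₗ ψ j)) (by
      refine Submodule.span_le.2 ?_
      rintro _ ⟨m, a, n, rfl⟩
      rw [SetLike.mem_coe, LinearMap.mem_ker, map_sub, sub_eq_zero]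
      simp [op_smul_eq_mul, hψ])
  have h2 : Θ ((balancedRel k (leftCoinvariants π hπ) H N).mkQ (h j ⊗ₜ y)) = ψ j (h j) • y := rfl
  rw [← h2, Subsingleton.elim ((balancedRel k (leftCoinvariants π hπ) H N).mkQ _) 0, map_zero]

/-- The left coaction is linear for right multiplication by left coinvariants. -/
theorem leftCoactionOf_mul_right {a : H} (ha : a ∈ leftCoinvariants π hπ) (h : H) :
    (leftCoactionOf π).coact (h * a) =
      (LinearMap.mulRight k a).lTensor C ((leftCoactionOf π).coact h) := by
  rw [mem_leftCoinvariants] at ha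
  simp only [leftCoactionOf, LinearMap.comp_apply, Bialgebra.comul_mul] at ha ⊢
  generalize comul (R := k) h = s
  induction s with
  | zero => simp
  | add x y hx hy => simp only [map_add, add_mul, hx, hy]
  | tmul p q =>
    have h1 : ∀ t : H ⊗[k] H, (π : H →ₗ[k] C).rTensor H ((p ⊗ₜ[k] q) * t) =
        TensorProduct.map (Algebra.lsmul k k C p) (LinearMap.mulLeft k q)
          ((π : H →ₗ[k] C).rTensor H t) := by
      intro t
      induction t with
      | zero => simp
      | tmul x y => simp [hπ]
      | add x y hx hy => rw [mul_add, map_add, map_add, map_add, hx, hy]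
    rw [h1, ha]
    simp [← hπ]

/-- One half of `C □ H = H`: the left coaction maps `H` to `C □ H`. -/
theorem coact_mem_cotensor (h : H) : (leftCoactionOf π).coact h ∈
    cotensor (regularCoaction k C) (leftCoactionOf π) := by
  have h1 := LinearMap.congr_fun (leftCoactionOf π).coassoc h
  rw [mem_cotensor, show (regularCoaction k C).coact = comul from
    LinearMap.ext regularCoaction_coact]
  exact h1

/-- The other half of `C □ H = H`: every element of `C □ H` is in the image of the left coaction. -/
theorem coact_eq_of_mem_cotensor {s : C ⊗[k] H}
    (hs : s ∈ cotensor (regularCoaction k C) (leftCoactionOf π)) :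
    (leftCoactionOf π).coact (TensorProduct.lid k H (counit.rTensor H s)) = s := by
  rw [mem_cotensor, show (regularCoaction k C).coact = comul from
    LinearMap.ext regularCoaction_coact] at hs
  have h1 : ∀ s : C ⊗[k] H, (leftCoactionOf π).coact (TensorProduct.lid k H (counit.rTensor H s)) =
      TensorProduct.lid k (C ⊗[k] H) (counit.rTensor (C ⊗[k] H)
        ((leftCoactionOf π).coact.lTensor C s)) := by
    intro s
    induction s with
    | zero => simp
    | add x y hx hy => simp only [map_add, hx, hy]
    | tmul c h => simp
  have h2 : ∀ s : C ⊗[k] H, TensorProduct.lid k (C ⊗[k] H) (counit.rTensor (C ⊗[k] H)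
        (TensorProduct.assoc k C C H (comul.rTensor H s))) = s := by
    intro s
    induction s with
    | zero => simp
    | add x y hx hy => simp only [map_add, hx, hy]
    | tmul c h =>
      have h3 : ∀ t : C ⊗[k] C, TensorProduct.lid k (C ⊗[k] H) (counit.rTensor (C ⊗[k] H)
        (TensorProduct.assoc k C C H (t ⊗ₜ h))) =
          TensorProduct.lid k C (counit.rTensor C t) ⊗ₜ h := by
        intro t
        induction t with
        | zero => simp
        | add x y hx hy => simp only [map_add, TensorProduct.add_tmul, hx, hy]
        | tmul c d => simp [TensorProduct.smul_tmul']
      rw [LinearMap.rTensor_tmul, h3, rTensor_counit_comul]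
      simp
  rw [h1, ← hs, h2]

/-- If `C` has a proper right coideal of finite codimension, then `H ⊗_A N ≠ 0` for all `N ≠ 0`. -/
theorem nontrivial_tensorOver_of_isRightCoideal (hS : Function.Bijective (antipode k (A := H)))
    (hsurj : Function.Surjective π) (hcoflat : (leftCoactionOf π).IsCoflat)
    (hflat : IsRightFlat k (leftCoinvariants π hπ) H)
    {R : Submodule k C} (hR : IsRightCoideal R) (hR' : R ≠ ⊤) [FiniteDimensional k (C ⧸ R)]
    (N : Type v) [AddCommGroup N] [Module k N] [Module (leftCoinvariants π hπ) N]
    [IsScalarTower k (leftCoinvariants π hπ) N] [Nontrivial N] :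
    Nontrivial (TensorOver k (leftCoinvariants π hπ) H N) := by
  have hsub : (regularCoaction k C).IsSubcomodule R := fun x hx => by
    rw [regularCoaction_coact]
    exact hR x hx
  have hnt : Nontrivial (C ⧸ R) := Submodule.Quotient.nontrivial_iff.2 hR'
  let ρ := (regularCoaction k C).quot R hsub
  have hq := (regularCoaction k C).quot_isColinear R hsub
  obtain ⟨f, hf, hf0⟩ := exists_isColinear_ne_zero_of_nontrivial π hπ hS hsurj hcoflat hflat ρ
  obtain ⟨n, t, F, ht, hF, h1⟩ := exists_sum_antipode_mul_eq_one π hπ hsurj hcoflat ρ hf hf0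
  -- the composites `H = C □ H → (C ⧸ R) □ H → A`
  let ψ : Fin n → H →ₗ[k] leftCoinvariants π hπ := fun j =>
    LinearMap.codRestrict (Subalgebra.toSubmodule (leftCoinvariants π hπ))
      (LinearMap.mul' k H ∘ₗ (antipode k ∘ₗ F j).rTensor H ∘ₗ R.mkQ.rTensor H ∘ₗ
        (leftCoactionOf π).coact)
      (fun h => antipode_mul_mem π hπ hS (hF j) (rTensor_mem_cotensor hq (coact_mem_cotensor π h)))
  have hlift : ∀ j, ∃ h : H, R.mkQ.rTensor H ((leftCoactionOf π).coact h) = t j := by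
    intro j
    obtain ⟨s, hs, hst⟩ := hcoflat.exists_lift_of_surjective hq R.mkQ_surjective (ht j)
    exact ⟨_, by rw [coact_eq_of_mem_cotensor π hs, hst]⟩
  choose h hh using hlift
  refine nontrivial_tensorOver_of_sum_eq_one π hπ (ψ := ψ) (h := h) ?_ ?_ N
  · intro j x a
    apply Subtype.ext
    change LinearMap.mul' k H ((antipode k ∘ₗ F j).rTensor H (R.mkQ.rTensor H
      ((leftCoactionOf π).coact (x * a)))) = LinearMap.mul' k H ((antipode k ∘ₗ F j).rTensor H
        (R.mkQ.rTensor H ((leftCoactionOf π).coact x))) * a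
    rw [leftCoactionOf_mul_right π hπ a.2]
    generalize (leftCoactionOf π).coact x = s
    induction s with
    | zero => simp
    | add x y hx hy => simp only [map_add, add_mul, hx, hy]
    | tmul c h => simp [mul_assoc]
  · apply Subtype.ext
    rw [AddSubmonoidClass.coe_finsetSum, OneMemClass.coe_one, ← h1]
    refine Finset.sum_congr rfl fun j _ => ?_
    rw [← hh j]
    rfl

end Coideal

/-! ### Diagonal actions of `A` -/
section Simple
variable {k : Type u} [Field k] {H : Type v} [Ring H] [HopfAlgebra k H]
  {C : Type v} [AddCommGroup C] [Module k C] [Coalgebra k C] [Module H C] [IsScalarTower k H C]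

open Coalgebra HopfAlgebra

variable (π : H →ₗc[k] C) (hπ : ∀ h x : H, π (h * x) = h • π x)

/-- The left coinvariants form a left coideal: `Δ(A) ⊆ A ⊗ H`. -/
theorem comul_mem_range_inclTensor {a : H} (ha : a ∈ leftCoinvariants π hπ) :
    comul (R := k) a ∈ LinearMap.range (inclTensor π hπ) := by
  let δ : H →ₗ[k] C ⊗[k] H := (leftCoactionOf π).coact - TensorProduct.mk k C H (π 1)
  have hex : Function.Exact (Subalgebra.toSubmodule (leftCoinvariants π hπ)).subtype δ := by
    intro x
    simp [δ, sub_eq_zero, mem_leftCoinvariants]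
  refine (Module.Flat.rTensor_exact H hex _).1 ?_
  rw [LinearMap.rTensor_sub, LinearMap.sub_apply, sub_eq_zero]
  apply (TensorProduct.assoc k C H H).injective
  have h1 : ∀ t : H ⊗[k] H, TensorProduct.assoc k C H H ((leftCoactionOf π).coact.rTensor H t) =
      (π : H →ₗ[k] C).rTensor (H ⊗[k] H) (TensorProduct.assoc k H H H (comul.rTensor H t)) := by
    intro t
    induction t with
    | zero => simp
    | add x y hx hy => simp only [map_add, hx, hy]
    | tmul a b =>
      simp only [LinearMap.rTensor_tmul, leftCoactionOf, LinearMap.comp_apply]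
      generalize comul (R := k) a = s
      induction s with
      | zero => simp
      | add x y hx hy => simp only [map_add, TensorProduct.add_tmul, hx, hy]
      | tmul a b => simp
  have h3 : ∀ s : H ⊗[k] H, TensorProduct.assoc k C H H
      ((TensorProduct.mk k C H (π 1)).rTensor H s) = π 1 ⊗ₜ s := by
    intro s
    induction s with
    | zero => simp
    | add x y hx hy => simp only [map_add, hx, hy, TensorProduct.tmul_add]
    | tmul a b => simp
  have h4 := (mem_leftCoinvariants π).1 ha
  simp only [leftCoactionOf, LinearMap.comp_apply] at h4
  rw [h1, h3, coassoc_apply, rTensor_lTensor_apply, h4, LinearMap.lTensor_tmul]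

/-- The inclusion `A ⊗ H → H ⊗ H` as a homomorphism of algebras. -/
def inclTensorHom : leftCoinvariants π hπ ⊗[k] H →ₐ[k] H ⊗[k] H :=
  Algebra.TensorProduct.map (leftCoinvariants π hπ).val (AlgHom.id k H)

/-- The comultiplication of `H`, restricted to an algebra homomorphism `A → A ⊗ H`. -/
def coinvComul : leftCoinvariants π hπ →ₐ[k] leftCoinvariants π hπ ⊗[k] H :=
  (AlgEquiv.ofInjective (inclTensorHom π hπ) (inclTensor_injective π hπ)).symm.toAlgHom.comp
    (((Bialgebra.comulAlgHom k H).comp (leftCoinvariants π hπ).val).codRestrict _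
      (fun a => comul_mem_range_inclTensor π hπ a.2))

theorem inclTensor_coinvComul (a : leftCoinvariants π hπ) :
    inclTensor π hπ (coinvComul π hπ a) = comul (R := k) (a : H) := by
  have h1 := (AlgEquiv.ofInjective (inclTensorHom π hπ)
    (inclTensor_injective π hπ)).apply_symm_apply (((Bialgebra.comulAlgHom k H).comp (leftCoinvariants π hπ).val).codRestrict _
      (fun a => comul_mem_range_inclTensor π hπ a.2) a)
  exact congrArg Subtype.val h1

/-- `a₁ ⊗ a₂ S(a₃) = a ⊗ 1`, inside `A ⊗ H`. -/
theorem coinvComul_mul_antipode (a : leftCoinvariants π hπ) :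
    (LinearMap.mul' k H ∘ₗ (antipode k).lTensor H).lTensor (leftCoinvariants π hπ)
      (TensorProduct.assoc k (leftCoinvariants π hπ) H H
        ((coinvComul π hπ).toLinearMap.rTensor H (coinvComul π hπ a))) = a ⊗ₜ 1 := by
  apply inclTensor_injective π hπ
  have h1 : ∀ t : leftCoinvariants π hπ ⊗[k] H, inclTensor π hπ
      ((LinearMap.mul' k H ∘ₗ (antipode k).lTensor H).lTensor (leftCoinvariants π hπ)
      (TensorProduct.assoc k (leftCoinvariants π hπ) H H
        ((coinvComul π hπ).toLinearMap.rTensor H t))) =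
      (LinearMap.mul' k H ∘ₗ (antipode k).lTensor H).lTensor H
      (TensorProduct.assoc k H H H (comul.rTensor H (inclTensor π hπ t))) := by
    intro t
    induction t with
    | zero => simp only [map_zero]
    | add x y hx hy => simp only [map_add, hx, hy]
    | tmul a b =>
      simp only [LinearMap.rTensor_tmul, inclTensor_tmul, ← inclTensor_coinvComul,
        AlgHom.toLinearMap_apply]
      generalize coinvComul π hπ a = s
      induction s with
      | zero => simp only [LinearMap.map_zero, LinearEquiv.map_zero, TensorProduct.zero_tmul]
      | add x y hx hy =>
        simp only [LinearMap.map_add, LinearEquiv.map_add, TensorProduct.add_tmul, hx, hy]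
      | tmul a b => simp
  rw [h1, inclTensor_coinvComul, tmul_mul_antipode]
  rfl

/-- The tensor product `N ⊗ W` of a left `A`-module `N` and a representation of `H` on `W`,
as a left `A`-module with the diagonal action `a (n ⊗ w) = a₁ n ⊗ a₂ w`. -/
@[nolint unusedArguments]
def DiagTensor {k : Type u} [Field k] {H : Type v} [Ring H] [HopfAlgebra k H]
    (N W : Type v) [AddCommGroup N] [Module k N] [AddCommGroup W] [Module k W]
    (_ : H →ₐ[k] Module.End k W) : Type v := N ⊗[k] W

variable (N W : Type v) [AddCommGroup N] [Module k N] [Module (leftCoinvariants π hπ) N]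
  [IsScalarTower k (leftCoinvariants π hπ) N] [AddCommGroup W] [Module k W]
  (r : H →ₐ[k] Module.End k W)

instance : AddCommGroup (DiagTensor N W r) := inferInstanceAs (AddCommGroup (N ⊗[k] W))
instance : Module k (DiagTensor N W r) := inferInstanceAs (Module k (N ⊗[k] W))

/-- The action of `A ⊗ H` on `N ⊗ W`. -/
def tensorAct : leftCoinvariants π hπ ⊗[k] H →ₐ[k] Module.End k (N ⊗[k] W) :=
  (Module.endTensorEndAlgHom (R := k) (S := k) (A := k) (M := N) (N := W)).comp
    (Algebra.TensorProduct.map (Algebra.lsmul k k N) r)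

theorem tensorAct_tmul (a : leftCoinvariants π hπ) (h : H) (n : N) (w : W) :
    tensorAct π hπ N W r (a ⊗ₜ h) (n ⊗ₜ w) = (a • n) ⊗ₜ r h w := rfl

instance : Module (leftCoinvariants π hπ) (DiagTensor N W r) :=
  Module.compHom (N ⊗[k] W) ((tensorAct π hπ N W r).comp (coinvComul π hπ)).toRingHom

/-- The identification of `N ⊗ W` with `DiagTensor N W r`. -/
def DiagTensor.of : N ⊗[k] W ≃ₗ[k] DiagTensor N W r := LinearEquiv.refl k (N ⊗[k] W)

instance : IsScalarTower k (leftCoinvariants π hπ) (DiagTensor N W r) where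
  smul_assoc c a x := by
    change tensorAct π hπ N W r (coinvComul π hπ (c • a)) x =
      c • tensorAct π hπ N W r (coinvComul π hπ a) x
    rw [map_smul, map_smul]
    rfl

/-- The canonical map `H × (N ⊗ W) → H ⊗_A (N ⊗ W)`. -/
def diagMk : H →ₗ[k] N ⊗[k] W →ₗ[k]
    TensorOver k (leftCoinvariants π hπ) H (DiagTensor N W r) :=
  ((TensorProduct.mk k H (DiagTensor N W r)).compr₂
    (balancedRel k (leftCoinvariants π hπ) H (DiagTensor N W r)).mkQ).compl₂
      (DiagTensor.of N W r).toLinearMap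

theorem diagMk_mul (h : H) (a : leftCoinvariants π hπ) (x : N ⊗[k] W) :
    diagMk π hπ N W r (h * a) x =
      diagMk π hπ N W r h (tensorAct π hπ N W r (coinvComul π hπ a) x) :=
  TensorOver.mk_smul h a (DiagTensor.of N W r x)

/-- The map `x ⊗ y ↦ x ⊗ (n ⊗ S(y) w)`. -/
def diagAux (n : N) (w : W) :
    H ⊗[k] H →ₗ[k] TensorOver k (leftCoinvariants π hπ) H (DiagTensor N W r) :=
  TensorProduct.lift ((diagMk π hπ N W r).compl₂
    (TensorProduct.mk k N W n ∘ₗ LinearMap.applyₗ w ∘ₗ r.toLinearMap ∘ₗ antipode k))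

theorem diagAux_tmul (n : N) (w : W) (x y : H) : diagAux π hπ N W r n w (x ⊗ₜ y) =
    diagMk π hπ N W r x (n ⊗ₜ[k] r (antipode k y) w) := rfl

/-- The map `h ⊗ n ↦ h₁ ⊗ (n ⊗ S(h₂) w)` is balanced over `A`, by `a₁ ⊗ a₂ S(a₃) = a ⊗ 1`. It
therefore factors through `H ⊗_A N`. -/
theorem diagAux_mul (n : N) (w : W) (h : H) (a : leftCoinvariants π hπ) :
    diagAux π hπ N W r n w (comul (R := k) (h * a)) =
      diagAux π hπ N W r (a • n) w (comul (R := k) h) := by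
  rw [Bialgebra.comul_mul]
  generalize comul (R := k) h = s
  induction s with
  | zero => simp
  | add x y hx hy => simp only [add_mul, map_add, hx, hy]
  | tmul p q =>
    rw [← inclTensor_coinvComul]
    have h1 : ∀ t : leftCoinvariants π hπ ⊗[k] H,
        diagAux π hπ N W r n w ((p ⊗ₜ q) * inclTensor π hπ t) =
        diagMk π hπ N W r p (tensorAct π hπ N W r
            ((LinearMap.mul' k H ∘ₗ (antipode k).lTensor H).lTensor (leftCoinvariants π hπ)
            (TensorProduct.assoc k (leftCoinvariants π hπ) H H
            ((coinvComul π hπ).toLinearMap.rTensor H t)))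
            (n ⊗ₜ[k] r (antipode k q) w)) := by
      intro t
      induction t with
      | zero => simp only [map_zero, mul_zero, LinearMap.zero_apply]
      | add x y hx hy => simp only [mul_add, map_add, hx, hy, LinearMap.add_apply]
      | tmul a b =>
        rw [inclTensor_tmul, Algebra.TensorProduct.tmul_mul_tmul, diagAux_tmul, diagMk_mul,
          LinearMap.rTensor_tmul, AlgHom.toLinearMap_apply]
        congr 1
        generalize coinvComul π hπ a = s
        induction s with
        | zero =>
          simp only [TensorProduct.zero_tmul, LinearEquiv.map_zero, LinearMap.map_zero]
          simp only [map_zero, LinearMap.zero_apply]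
        | add x y hx hy =>
          simp only [TensorProduct.add_tmul, LinearEquiv.map_add, LinearMap.map_add]
          simp only [map_add, LinearMap.add_apply, hx, hy]
        | tmul c d => simp [tensorAct_tmul, antipode_mul_antidistrib]
    rw [h1, coinvComul_mul_antipode, tensorAct_tmul, diagAux_tmul, map_one]
    rfl

/-- If `H ⊗_A N = 0`, then `H ⊗_A (N ⊗ W) = 0`. -/
theorem subsingleton_tensorOver_diagTensor
    (hN : Subsingleton (TensorOver k (leftCoinvariants π hπ) H N)) :
    Subsingleton (TensorOver k (leftCoinvariants π hπ) H (DiagTensor N W r)) := by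
  have htop : balancedRel k (leftCoinvariants π hπ) H N = ⊤ :=
    Submodule.Quotient.subsingleton_iff.1 hN
  have hG : ∀ (w : W) (n : N) (h : H), diagAux π hπ N W r n w (comul (R := k) h) = 0 := by
    intro w n h
    let G : H ⊗[k] N →ₗ[k] TensorOver k (leftCoinvariants π hπ) H (DiagTensor N W r) :=
      TensorProduct.lift (LinearMap.mk₂ k (fun h n => diagAux π hπ N W r n w (comul (R := k) h))
        (fun h h' n => by simp only [map_add])
        (fun c h n => by simp only [map_smul])
        (fun h n n' => by
          generalize comul (R := k) h = s
          induction s with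
          | zero => simp only [map_zero, add_zero]
          | add x y hx hy => simp only [map_add, hx, hy]; abel
          | tmul p q => simp only [diagAux_tmul, TensorProduct.add_tmul, map_add])
        (fun c h n => by
          generalize comul (R := k) h = s
          induction s with
          | zero => simp only [map_zero, smul_zero]
          | add x y hx hy => simp only [map_add, hx, hy, smul_add]
          | tmul p q => simp only [diagAux_tmul, ← TensorProduct.smul_tmul', map_smul]))
    have h1 : balancedRel k (leftCoinvariants π hπ) H N ≤ LinearMap.ker G := by
      refine Submodule.span_le.2 ?_
      rintro _ ⟨m, a, n, rfl⟩
      rw [SetLike.mem_coe, LinearMap.mem_ker, map_sub, sub_eq_zero]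
      exact diagAux_mul π hπ N W r n w m a
    rw [htop] at h1
    exact h1 (x := h ⊗ₜ n) trivial
  refine subsingleton_of_forall_eq 0 fun z => ?_
  obtain ⟨t, rfl⟩ := Submodule.mkQ_surjective _ z
  induction t with
  | zero => simp
  | add x y hx hy => simp only [map_add, hx, hy, add_zero]
  | tmul h x =>
    obtain ⟨x, rfl⟩ := (DiagTensor.of N W r).surjective x
    change diagMk π hπ N W r h x = 0
    induction x with
    | zero => rw [map_zero]
    | add x y hx hy => rw [map_add, hx, hy, add_zero]
    | tmul n w =>
      -- `h ⊗ (n ⊗ w) = ∑ h₁ ⊗ (n ⊗ S(h₂) h₃ w)`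
      let L : H ⊗[k] H →ₗ[k] TensorOver k (leftCoinvariants π hπ) H (DiagTensor N W r) :=
        TensorProduct.lift ((diagMk π hπ N W r).compl₂
          (TensorProduct.mk k N W n ∘ₗ LinearMap.applyₗ w ∘ₗ r.toLinearMap))
      have hL : ∀ x y, L (x ⊗ₜ y) = diagMk π hπ N W r x (n ⊗ₜ[k] r y w) := fun x y => rfl
      have h1 : ∀ t : H ⊗[k] H, L ((LinearMap.mul' k H ∘ₗ (antipode k).rTensor H).lTensor H
          (TensorProduct.assoc k H H H (comul.rTensor H t))) = 0 := by
        intro t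
        induction t with
        | zero => simp only [map_zero]
        | add x y hx hy => simp only [map_add, hx, hy, add_zero]
        | tmul a b =>
          rw [← hG (r b w) n a, LinearMap.rTensor_tmul]
          generalize comul (R := k) a = s
          induction s with
          | zero => simp only [map_zero, TensorProduct.zero_tmul]
          | add x y hx hy => simp only [map_add, TensorProduct.add_tmul, hx, hy]
          | tmul p q =>
            rw [diagAux_tmul, TensorProduct.assoc_tmul, LinearMap.lTensor_tmul, hL]
            simp
      have h2 := h1 (comul h)
      rw [tmul_antipode_mul, hL, map_one] at h2
      exact h2

/-- If `H` is right flat over `A` and `H ⊗_A M = 0`, then `M` has no nonzero element on which `A`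
acts through the counit. -/
theorem eq_zero_of_smul_eq_counit_smul (hflat : IsRightFlat k (leftCoinvariants π hπ) H)
    (M : Type v) [AddCommGroup M] [Module k M] [Module (leftCoinvariants π hπ) M]
    [IsScalarTower k (leftCoinvariants π hπ) M]
    (hM : Subsingleton (TensorOver k (leftCoinvariants π hπ) H M)) {z : M}
    (hz : ∀ a : leftCoinvariants π hπ, a • z = counit (R := k) (a : H) • z) : z = 0 := by
  by_contra hz0
  -- the annihilator of `z` is the augmentation ideal `ker g`; since `H ⊗_A M = 0`, flatness puts
  -- `1 ⊗ 1` in the image of `H ⊗_A ker g`, on which `ε` vanishes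
  let g : leftCoinvariants π hπ →ₗ[leftCoinvariants π hπ] M := LinearMap.toSpanSingleton _ _ z
  obtain ⟨y, hy⟩ := (hflat (LinearMap.ker g) (leftCoinvariants π hπ) M (LinearMap.ker g).subtype g
    (LinearMap.exact_subtype_ker_map g)
    ((balancedRel k (leftCoinvariants π hπ) H (leftCoinvariants π hπ)).mkQ (1 ⊗ₜ 1))).1
    (Subsingleton.elim _ _)
  let E : TensorOver k (leftCoinvariants π hπ) H (leftCoinvariants π hπ) →ₗ[k] k :=
    (balancedRel k (leftCoinvariants π hπ) H (leftCoinvariants π hπ)).liftQ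
      (counit ∘ₗ LinearMap.mul' k H ∘ₗ
        (leftCoinvariants π hπ).val.toLinearMap.lTensor H) (by
      refine Submodule.span_le.2 ?_
      rintro _ ⟨m, a, n, rfl⟩
      rw [SetLike.mem_coe, LinearMap.mem_ker, map_sub, sub_eq_zero]
      simp [op_smul_eq_mul, mul_assoc])
  have h1 : E ((balancedRel k (leftCoinvariants π hπ) H (leftCoinvariants π hπ)).mkQ (1 ⊗ₜ 1)) =
      1 := by
    change counit (R := k) ((1 : H) * 1) = 1
    simp
  rw [← hy] at h1
  obtain ⟨t, rfl⟩ := Submodule.mkQ_surjective _ y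
  apply zero_ne_one (α := k)
  rw [← h1]
  symm
  clear h1 hy
  induction t with
  | zero => simp
  | add x y hx hy => simp only [map_add, hx, hy, add_zero]
  | tmul h a =>
    change counit (R := k) (h * ((a : leftCoinvariants π hπ) : H)) = 0
    have h2 : (a : leftCoinvariants π hπ) • z = 0 := a.2
    rw [hz] at h2
    rw [Bialgebra.counit_mul, (smul_eq_zero.1 h2).resolve_right hz0, mul_zero]

end Simple

/-! ### Dual modules and the augmentation of `A` -/
section Simple
variable {k : Type u} [Field k] {H : Type v} [Ring H] [HopfAlgebra k H]
  {C : Type v} [AddCommGroup C] [Module k C] [Coalgebra k C] [Module H C] [IsScalarTower k H C]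

open Coalgebra HopfAlgebra

/-- The dual of a vector space `N`. To stay in the universe of `N`, the functionals take values
in the copy `k · 1` of `k` inside `H`. -/
def ScalarDual (k : Type u) [Field k] (H : Type v) [Ring H] [Algebra k H]
    (N : Type v) [AddCommGroup N] [Module k N] : Type v := N →ₗ[k] (⊥ : Subalgebra k H)

instance (N : Type v) [AddCommGroup N] [Module k N] : AddCommGroup (ScalarDual k H N) :=
  inferInstanceAs (AddCommGroup (N →ₗ[k] (⊥ : Subalgebra k H)))

instance (N : Type v) [AddCommGroup N] [Module k N] : Module k (ScalarDual k H N) :=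
  inferInstanceAs (Module k (N →ₗ[k] (⊥ : Subalgebra k H)))

variable (π : H →ₗc[k] C) (hπ : ∀ h x : H, π (h * x) = h • π x)
  (N : Type v) [AddCommGroup N] [Module k N] [Module (leftCoinvariants π hπ) N]
  [IsScalarTower k (leftCoinvariants π hπ) N]

/-- The dual of a left `A`-module is a right `A`-module. -/
instance : Module (leftCoinvariants π hπ)ᵐᵒᵖ (ScalarDual k H N) where
  smul a φ := (LinearMap.comp φ (Algebra.lsmul k k N a.unop) : N →ₗ[k] (⊥ : Subalgebra k H))
  one_smul φ := by
    change LinearMap.comp φ (Algebra.lsmul k k N 1) = φ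
    rw [map_one]
    rfl
  mul_smul a b φ := by
    change LinearMap.comp φ (Algebra.lsmul k k N (b.unop * a.unop)) = _
    rw [map_mul]
    rfl
  smul_zero a := LinearMap.zero_comp _
  smul_add a φ ψ := LinearMap.add_comp _ _ _
  add_smul a b φ := by
    change LinearMap.comp φ (Algebra.lsmul k k N (a.unop + b.unop)) = _
    rw [map_add]
    exact LinearMap.comp_add _ _ _
  zero_smul φ := by
    change LinearMap.comp φ (Algebra.lsmul k k N 0) = _
    rw [map_zero]
    exact LinearMap.comp_zero _

theorem scalarDual_smul (a : leftCoinvariants π hπ) (φ : ScalarDual k H N) :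
    MulOpposite.op a • φ =
      (LinearMap.comp φ (Algebra.lsmul k k N a) : N →ₗ[k] (⊥ : Subalgebra k H)) := rfl

instance : IsScalarTower k (leftCoinvariants π hπ)ᵐᵒᵖ (ScalarDual k H N) where
  smul_assoc c a φ := by
    induction a using MulOpposite.rec' with
    | _ a =>
      rw [← MulOpposite.op_smul, scalarDual_smul, map_smul]
      exact LinearMap.comp_smul _ _ _

section AntipodeAct
variable (P : Type v) [AddCommGroup P] [Module k P] [Module (leftCoinvariants π hπ)ᵐᵒᵖ P]

/-- The endomorphism `p ⊗ x ↦ p ⊗ x h` of `P ⊗_A H`. -/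
def mulRightOver (h : H) : Module.End k (TensorOver k (leftCoinvariants π hπ) P H) :=
  Submodule.mapQ _ _ ((LinearMap.mulRight k h).lTensor P) (by
    rw [balancedRel, Submodule.span_le]
    rintro _ ⟨m, a, x, rfl⟩
    refine Submodule.subset_span ⟨m, a, x * h, ?_⟩
    have h1 : ∀ y : H, a • y = (a : H) * y := fun _ => rfl
    simp [h1, mul_assoc])

theorem mulRightOver_mk (h : H) (p : P) (x : H) :
    mulRightOver π hπ P h (tensorProj π hπ P (p ⊗ₜ x)) = tensorProj π hπ P (p ⊗ₜ (x * h)) := rfl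

theorem end_ext {f g : Module.End k (TensorOver k (leftCoinvariants π hπ) P H)}
    (h : ∀ p x, f (tensorProj π hπ P (p ⊗ₜ x)) = g (tensorProj π hπ P (p ⊗ₜ x))) : f = g :=
  Submodule.linearMap_qext _ (TensorProduct.ext' h)

/-- The representation of `H` on `P ⊗_A H` for which `h` acts by right multiplication by `S(h)`. -/
def antipodeAct : H →ₐ[k] Module.End k (TensorOver k (leftCoinvariants π hπ) P H) :=
  AlgHom.ofLinearMap
    { toFun := fun h => mulRightOver π hπ P (antipode k h)
      map_add' := fun h h' => end_ext π hπ P fun p x => by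
        rw [LinearMap.add_apply]
        simp only [mulRightOver_mk, map_add, mul_add, TensorProduct.tmul_add]
      map_smul' := fun c h => end_ext π hπ P fun p x => by
        rw [RingHom.id_apply, LinearMap.smul_apply]
        simp only [mulRightOver_mk, map_smul, mul_smul_comm, TensorProduct.tmul_smul] }
    (end_ext π hπ P fun p x => by
      change mulRightOver π hπ P (antipode k 1) _ = _
      simp only [mulRightOver_mk, antipode_one, mul_one]
      rfl)
    (fun h h' => end_ext π hπ P fun p x => by
      change mulRightOver π hπ P (antipode k (h * h')) (tensorProj π hπ P (p ⊗ₜ x)) =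
        mulRightOver π hπ P (antipode k h)
          (mulRightOver π hπ P (antipode k h') (tensorProj π hπ P (p ⊗ₜ x)))
      simp only [mulRightOver_mk, antipode_mul_antidistrib, mul_assoc])

theorem antipodeAct_mk (h : H) (p : P) (x : H) :
    antipodeAct π hπ P h (tensorProj π hπ P (p ⊗ₜ x)) =
      tensorProj π hπ P (p ⊗ₜ (x * antipode k h)) := rfl

end AntipodeAct

/-- The coordinate functionals of a basis of `N`, as elements of `ScalarDual k H N`. -/
def scalarCoord {n : ℕ} (b : Module.Basis (Fin n) k N) (i : Fin n) : ScalarDual k H N :=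
  (Algebra.linearMap k (⊥ : Subalgebra k H) ∘ₗ b.coord i : N →ₗ[k] (⊥ : Subalgebra k H))

/-- The element of `N ⊗ (N* ⊗_A H)` given by dual bases of `N` and `N*`. -/
def dualBasisTensor {n : ℕ} (b : Module.Basis (Fin n) k N) :
    N ⊗[k] TensorOver k (leftCoinvariants π hπ) (ScalarDual k H N) H :=
  ∑ i, b i ⊗ₜ tensorProj π hπ (ScalarDual k H N) (scalarCoord N b i ⊗ₜ 1)

/-- The algebra `A` acts on the tensor of dual bases through the counit: this tensor is balanced
over `A`, so `∑ a₁ b i ⊗ (b* i ⊗ S(a₂)) = ∑ b i ⊗ (b* i ⊗ a₁ S(a₂))`. -/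
theorem smul_dualBasisTensor {n : ℕ} (b : Module.Basis (Fin n) k N) (a : leftCoinvariants π hπ) :
    tensorAct π hπ N _ (antipodeAct π hπ (ScalarDual k H N)) (coinvComul π hπ a)
      (dualBasisTensor π hπ N b) = counit (R := k) (a : H) • dualBasisTensor π hπ N b := by
  let p : Fin n → ScalarDual k H N := scalarCoord N b
  have hp : ∀ (a : leftCoinvariants π hπ),
      ∑ i, (a • b i) ⊗ₜ[k] p i = ∑ i, b i ⊗ₜ[k] (MulOpposite.op a • p i) := by
    intro a
    have h1 : ∀ i, a • b i = ∑ j, b.coord j (a • b i) • b j := fun i => (b.sum_repr _).symm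
    have h2 : ∀ j, MulOpposite.op a • p j = ∑ i, b.coord j (a • b i) • p i := by
      intro j
      have h3 : (LinearMap.comp (p j) (Algebra.lsmul k k N a) : N →ₗ[k] (⊥ : Subalgebra k H)) =
          ∑ i, b.coord j (a • b i) •
            (Algebra.linearMap k (⊥ : Subalgebra k H) ∘ₗ b.coord i) := by
        refine b.ext fun l => ?_
        simp only [p, scalarCoord, LinearMap.comp_apply, LinearMap.sum_apply, LinearMap.smul_apply,
          Algebra.lsmul_coe]
        rw [Finset.sum_eq_single l]
        · simp [Algebra.algebraMap_eq_smul_one]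
        · intro i _ hi
          simp [hi.symm]
        · simp
      exact h3
    simp only [h2, TensorProduct.tmul_sum, TensorProduct.tmul_smul]
    rw [Finset.sum_comm]
    refine Finset.sum_congr rfl fun i _ => ?_
    conv_lhs => rw [h1]
    simp only [TensorProduct.sum_tmul, TensorProduct.smul_tmul']
  have h1 : ∀ t : leftCoinvariants π hπ ⊗[k] H,
      tensorAct π hπ N _ (antipodeAct π hπ (ScalarDual k H N)) t (dualBasisTensor π hπ N b) =
      ∑ i, b i ⊗ₜ tensorProj π hπ (ScalarDual k H N) (p i ⊗ₜ
        LinearMap.mul' k H ((antipode k).lTensor H (inclTensor π hπ t))) := by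
    intro t
    induction t with
    | zero => simp
    | add x y hx hy =>
      simp only [map_add, LinearMap.add_apply, hx, hy, TensorProduct.tmul_add,
        Finset.sum_add_distrib]
    | tmul a h =>
      simp only [dualBasisTensor, map_sum, tensorAct_tmul, antipodeAct_mk, one_mul,
        inclTensor_tmul, LinearMap.lTensor_tmul, LinearMap.mul'_apply]
      have h2 := congrArg ((tensorProj π hπ (ScalarDual k H N) ∘ₗ
        (TensorProduct.mk k (ScalarDual k H N) H).flip (antipode k h)).lTensor N) (hp a)
      simp only [map_sum, LinearMap.lTensor_tmul, LinearMap.comp_apply, LinearMap.flip_apply,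
        TensorProduct.mk_apply, TensorOver.mk_smul] at h2
      exact h2
  rw [h1, inclTensor_coinvComul, mul_antipode_lTensor_comul_apply]
  simp only [dualBasisTensor, Algebra.algebraMap_eq_smul_one, TensorProduct.tmul_smul, map_smul,
    Finset.smul_sum]
  rfl

/-- If the tensor of dual bases were zero, all `b* i ⊗ 1` would vanish, and these generate
`N* ⊗_A H` under right multiplication by `H`. -/
theorem dualBasisTensor_ne_zero {n : ℕ} (b : Module.Basis (Fin n) k N)
    (hW : Nontrivial (TensorOver k (leftCoinvariants π hπ) (ScalarDual k H N) H)) :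
    dualBasisTensor π hπ N b ≠ 0 := by
  intro h0
  let p : Fin n → ScalarDual k H N := scalarCoord N b
  have h1 : ∀ i, tensorProj π hπ (ScalarDual k H N) (p i ⊗ₜ 1) = 0 :=
    basis_tmul_injective b (x := fun i => tensorProj π hπ (ScalarDual k H N) (p i ⊗ₜ 1))
      (y := 0) (h0.trans (by simp))
  obtain ⟨w, hw⟩ := exists_ne (0 : TensorOver k (leftCoinvariants π hπ) (ScalarDual k H N) H)
  apply hw
  obtain ⟨t, rfl⟩ := Submodule.mkQ_surjective _ w
  clear hw
  induction t with
  | zero => simp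
  | add x y hx hy => simp only [map_add, hx, hy, add_zero]
  | tmul φ h =>
    have h2 : ∀ y : (⊥ : Subalgebra k H), ∃ c : k, algebraMap k (⊥ : Subalgebra k H) c = y := by
      intro y
      obtain ⟨c, hc⟩ := Algebra.mem_bot.1 y.2
      exact ⟨c, Subtype.ext hc⟩
    choose c hc using h2
    let φ' : N →ₗ[k] (⊥ : Subalgebra k H) := φ
    have h3 : φ' = ∑ i, c (φ' (b i)) •
        (Algebra.linearMap k (⊥ : Subalgebra k H) ∘ₗ b.coord i) := by
      refine b.ext fun l => ?_
      simp only [LinearMap.comp_apply, LinearMap.sum_apply, LinearMap.smul_apply]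
      rw [Finset.sum_eq_single l]
      · rw [Algebra.linearMap_apply, b.coord_apply, b.repr_self, Finsupp.single_eq_same, map_one,
          ← Algebra.algebraMap_eq_smul_one, hc]
      · intro i _ hi
        simp [hi.symm]
      · simp
    have h4 : φ = ∑ i, c (φ' (b i)) • p i := h3
    have h5 := fun i => congrArg (mulRightOver π hπ (ScalarDual k H N) h) (h1 i)
    simp only [mulRightOver_mk, map_zero, one_mul] at h5
    rw [h4]
    simp only [TensorProduct.sum_tmul, map_sum, ← TensorProduct.smul_tmul', map_smul, h5,
      smul_zero, Finset.sum_const_zero]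

/-- Here `H ⊗_A N = 0` is impossible because the counit of `A` occurs in the diagonal module
`N ⊗ (N* ⊗_A H)`, which `H ⊗_A ?` would also kill. -/
theorem nontrivial_tensorOver_of_finiteDimensional
    (hflat : IsRightFlat k (leftCoinvariants π hπ) H)
    (hleft : IsLeftFaithfullyFlat k (leftCoinvariants π hπ) H) [FiniteDimensional k N]
    [Nontrivial N] : Nontrivial (TensorOver k (leftCoinvariants π hπ) H N) := by
  by_contra hn
  rw [not_nontrivial_iff_subsingleton] at hn
  let b := Module.finBasis k N
  have := nontrivial_hopf k H
  have hP : Nontrivial (ScalarDual k H N) := by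
    obtain ⟨y, hy⟩ := exists_ne (0 : N)
    obtain ⟨φ, hφ⟩ := not_forall.1 (mt (Module.forall_dual_apply_eq_zero_iff k y).1 hy)
    refine ⟨(Algebra.linearMap k (⊥ : Subalgebra k H) ∘ₗ φ : N →ₗ[k] (⊥ : Subalgebra k H)), 0,
      fun h => hφ ?_⟩
    have h1 : algebraMap k (⊥ : Subalgebra k H) (φ y) = 0 :=
      LinearMap.congr_fun (show Algebra.linearMap k (⊥ : Subalgebra k H) ∘ₗ φ = 0 from h) y
    exact (map_eq_zero _).1 h1
  exact dualBasisTensor_ne_zero π hπ N b (hleft.2 _ hP)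
    (eq_zero_of_smul_eq_counit_smul π hπ hflat
      (DiagTensor N _ (antipodeAct π hπ (ScalarDual k H N)))
      (subsingleton_tensorOver_diagTensor π hπ N _ _ hn)
      (z := DiagTensor.of N _ (antipodeAct π hπ (ScalarDual k H N)) (dualBasisTensor π hπ N b))
      (fun a => smul_dualBasisTensor π hπ N b a))

/-- For flat `H` it is enough to test `H ⊗_A N ≠ 0` on simple modules, since every `N ≠ 0` has a
cyclic submodule, and this has a simple quotient. -/
theorem nontrivial_tensorOver_of_isSimpleModule
    (hflat : IsRightFlat k (leftCoinvariants π hπ) H)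
    (hsimple : ∀ (M : Type v) [AddCommGroup M] [Module k M] [Module (leftCoinvariants π hπ) M]
      [IsScalarTower k (leftCoinvariants π hπ) M], IsSimpleModule (leftCoinvariants π hπ) M →
        Nontrivial (TensorOver k (leftCoinvariants π hπ) H M)) [Nontrivial N] :
    Nontrivial (TensorOver k (leftCoinvariants π hπ) H N) := by
  by_contra hn
  rw [not_nontrivial_iff_subsingleton] at hn
  obtain ⟨y, hy⟩ := exists_ne (0 : N)
  let M := Submodule.span (leftCoinvariants π hπ) {y}
  have hMnt : Nontrivial M := ⟨⟨y, Submodule.mem_span_singleton_self y⟩, 0,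
    fun h => hy (congrArg Subtype.val h)⟩
  have hM : Module.Finite (leftCoinvariants π hπ) M :=
    Module.Finite.iff_fg.2 (Submodule.fg_span_singleton y)
  obtain ⟨L, hL, -⟩ := (eq_top_or_exists_le_coatom
    (⊥ : Submodule (leftCoinvariants π hπ) M)).resolve_left bot_ne_top
  have hsim : IsSimpleModule (leftCoinvariants π hπ) (M ⧸ L) := isSimpleModule_iff_isCoatom.2 hL
  have hsubM : Subsingleton (TensorOver k (leftCoinvariants π hπ) H M) := by
    refine subsingleton_of_forall_eq 0 fun z => ?_
    have hex : Function.Exact (0 : M →ₗ[leftCoinvariants π hπ] M) M.subtype := by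
      intro x
      simp [eq_comm]
    obtain ⟨w, rfl⟩ := (hflat M M N 0 M.subtype hex z).1 (Subsingleton.elim _ _)
    obtain ⟨t, rfl⟩ := Submodule.mkQ_surjective _ w
    induction t with
    | zero => simp
    | add x y hx hy => simp only [map_add, hx, hy, add_zero]
    | tmul h m =>
      change (balancedRel k (leftCoinvariants π hπ) H M).mkQ (h ⊗ₜ 0) = 0
      simp
  have hq := hsimple (M ⧸ L) hsim
  obtain ⟨z, hz⟩ := exists_ne (0 : TensorOver k (leftCoinvariants π hπ) H (M ⧸ L))
  apply hz
  obtain ⟨t, rfl⟩ := Submodule.mkQ_surjective _ z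
  clear hz
  induction t with
  | zero => simp
  | add x y hx hy => simp only [map_add, hx, hy, add_zero]
  | tmul h m =>
    obtain ⟨m, rfl⟩ := L.mkQ_surjective m
    change TensorOver.mapRight k (leftCoinvariants π hπ) H L.mkQ
      ((balancedRel k (leftCoinvariants π hπ) H M).mkQ (h ⊗ₜ m)) = 0
    rw [Subsingleton.elim ((balancedRel k (leftCoinvariants π hπ) H M).mkQ _) 0, map_zero]

end Simple

/-! ### Faithfully flat modules reflect exactness -/
section Reflect
variable {k : Type u} [Field k] {A : Type v} [Ring A] [Algebra k A] (M : Type v) [AddCommGroup M]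
  [Module k M] [Module Aᵐᵒᵖ M]
  {N₁ N₂ N₃ : Type v} [AddCommGroup N₁] [Module k N₁] [Module A N₁] [IsScalarTower k A N₁]
  [AddCommGroup N₂] [Module k N₂] [Module A N₂] [IsScalarTower k A N₂]
  [AddCommGroup N₃] [Module k N₃] [Module A N₃] [IsScalarTower k A N₃]

theorem TensorOver.mapRight_mapRight (g : N₂ →ₗ[A] N₃) (f : N₁ →ₗ[A] N₂)
    (z : TensorOver k A M N₁) : TensorOver.mapRight k A M g (TensorOver.mapRight k A M f z) =
      TensorOver.mapRight k A M (g ∘ₗ f) z := by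
  obtain ⟨t, rfl⟩ := Submodule.mkQ_surjective _ z
  induction t with
  | zero => simp only [map_zero]
  | add x y hx hy => simp only [map_add, hx, hy]
  | tmul m n => rfl

theorem TensorOver.mapRight_zero (z : TensorOver k A M N₁) :
    TensorOver.mapRight k A M (0 : N₁ →ₗ[A] N₂) z = 0 := by
  obtain ⟨t, rfl⟩ := Submodule.mkQ_surjective _ z
  induction t with
  | zero => simp only [map_zero]
  | add x y hx hy => simp only [map_add, hx, hy, add_zero]
  | tmul m n =>
    change (balancedRel k A M N₂).mkQ (m ⊗ₜ 0) = 0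
    simp

theorem TensorOver.mapRight_surjective {f : N₁ →ₗ[A] N₂} (hf : Function.Surjective f) :
    Function.Surjective (TensorOver.mapRight k A M f) := by
  intro z
  obtain ⟨t, rfl⟩ := Submodule.mkQ_surjective _ z
  change _ ∈ LinearMap.range (TensorOver.mapRight k A M f)
  induction t with
  | zero => simp
  | add x y hx hy => simpa only [map_add] using add_mem hx hy
  | tmul m n =>
    obtain ⟨n, rfl⟩ := hf n
    exact ⟨(balancedRel k A M N₁).mkQ (m ⊗ₜ n), rfl⟩

variable {M}

theorem IsRightFlat.mapRight_injective (hM : IsRightFlat k A M) {f : N₁ →ₗ[A] N₂}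
    (hf : Function.Injective f) : Function.Injective (TensorOver.mapRight k A M f) := by
  rw [injective_iff_map_eq_zero]
  intro z hz
  have hex : Function.Exact (0 : N₁ →ₗ[A] N₁) f := by
    intro x
    simp [hf.eq_iff' (map_zero f), eq_comm]
  obtain ⟨w, rfl⟩ := (hM N₁ N₁ N₂ 0 f hex z).1 hz
  rw [TensorOver.mapRight_zero]

/-- The functor `M ⊗_A ?` of a faithfully flat module `M` reflects exactness: by flatness it
commutes with homology. -/
theorem IsRightFaithfullyFlat.exact (hM : IsRightFaithfullyFlat k A M) {f : N₁ →ₗ[A] N₂}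
    {g : N₂ →ₗ[A] N₃} (hgf : g ∘ₗ f = 0)
    (h : ∀ z, TensorOver.mapRight k A M g z = 0 →
      z ∈ LinearMap.range (TensorOver.mapRight k A M f)) : Function.Exact f g := by
  intro y
  refine ⟨fun hy => ?_, fun ⟨x, hx⟩ => hx ▸ LinearMap.congr_fun hgf x⟩
  by_contra hy'
  let K := LinearMap.ker g
  let f' : N₁ →ₗ[A] K := f.codRestrict K (LinearMap.congr_fun hgf)
  let R := LinearMap.range f'
  have hnt : Nontrivial (K ⧸ R) := by
    refine ⟨R.mkQ ⟨y, hy⟩, 0, fun h0 => hy' ?_⟩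
    obtain ⟨x, hx⟩ := (Submodule.Quotient.mk_eq_zero R).1 h0
    exact ⟨x, congrArg Subtype.val hx⟩
  have := hM.2 (K ⧸ R) hnt
  obtain ⟨z, hz⟩ := exists_ne (0 : TensorOver k A M (K ⧸ R))
  apply hz
  obtain ⟨z, rfl⟩ := TensorOver.mapRight_surjective M R.mkQ_surjective z
  obtain ⟨x, hx⟩ := h (TensorOver.mapRight k A M K.subtype z) (by
    rw [TensorOver.mapRight_mapRight, show g ∘ₗ K.subtype = 0 from LinearMap.ext fun x => x.2,
      TensorOver.mapRight_zero])
  have h1 : TensorOver.mapRight k A M f' x = z := by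
    apply hM.1.mapRight_injective K.injective_subtype
    rw [TensorOver.mapRight_mapRight, ← hx]
    rfl
  rw [← h1, TensorOver.mapRight_mapRight, show R.mkQ ∘ₗ f' = 0 from
    LinearMap.ext fun x => (Submodule.Quotient.mk_eq_zero R).2 ⟨x, rfl⟩, TensorOver.mapRight_zero]

end Reflect

/-! ### Right faithful coflatness -/
section RightCoflat
variable {k : Type u} [Field k] {H : Type v} [Ring H] [HopfAlgebra k H]
  {C : Type v} [AddCommGroup C] [Module k C] [Coalgebra k C] [Module H C] [IsScalarTower k H C]

open Coalgebra HopfAlgebra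

variable (π : H →ₗc[k] C) (hπ : ∀ h x : H, π (h * x) = h • π x)
  (hS : Function.Bijective (antipode k (A := H)))

/-- The canonical map `H ⊗_A H → C ⊗ H`, `x ⊗ y ↦ π(x₁) ⊗ x₂ y`. -/
def canonicalMap : TensorOver k (leftCoinvariants π hπ) H H →ₗ[k] C ⊗[k] H :=
  (balancedRel k (leftCoinvariants π hπ) H H).liftQ
    ((LinearMap.mul' k H).lTensor C ∘ₗ (TensorProduct.assoc k C H H).toLinearMap ∘ₗ
      (leftCoactionOf π).coact.rTensor H) (by
    refine Submodule.span_le.2 ?_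
    rintro _ ⟨m, a, n, rfl⟩
    rw [SetLike.mem_coe, LinearMap.mem_ker, map_sub, sub_eq_zero, op_smul_eq_mul]
    have : a • n = (a : H) * n := rfl
    simp only [this, LinearMap.comp_apply, LinearMap.rTensor_tmul,
      leftCoactionOf_mul_right π hπ a.2, LinearEquiv.coe_coe]
    generalize (leftCoactionOf π).coact m = s
    induction s with
    | zero => simp
    | add x y hx hy => simp only [map_add, TensorProduct.add_tmul, hx, hy]
    | tmul c h => simp [mul_assoc])

theorem canonicalMap_mk (x y : H) : canonicalMap π hπ (tensorProj π hπ H (x ⊗ₜ y)) =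
    (LinearMap.mulRight k y).lTensor C ((leftCoactionOf π).coact x) := by
  change (LinearMap.mul' k H).lTensor C (TensorProduct.assoc k C H H
      ((leftCoactionOf π).coact x ⊗ₜ y)) = _
  generalize (leftCoactionOf π).coact x = s
  induction s with
  | zero => simp
  | add x y hx hy => simp only [map_add, TensorProduct.add_tmul, hx, hy]
  | tmul c h => simp

/-- A left inverse of the canonical map is `π(x) ⊗ h ↦ x₁ ⊗ S(x₂) h`, which is well defined because
`x₁ ⊗ S(x₂)` depends only on `π(x)`. -/
theorem canonicalMap_injective {κ : C →ₗ[k] TensorOver k (leftCoinvariants π hπ) H H}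
    (hκ : ∀ x, κ (π x) = translationMap π hπ x) : Function.Injective (canonicalMap π hπ) := by
  let ν : C ⊗[k] H →ₗ[k] TensorOver k (leftCoinvariants π hπ) H H :=
    TensorProduct.lift (LinearMap.mk₂ k (fun c h => mulRightOver π hπ H h (κ c))
      (fun c c' h => by simp only [map_add])
      (fun r c h => by simp only [map_smul])
      (fun c h h' => by
        rw [← LinearMap.add_apply]
        congr 1
        exact end_ext π hπ H fun p x => by
          rw [LinearMap.add_apply]
          simp only [mulRightOver_mk, mul_add, TensorProduct.tmul_add, map_add])
      (fun r c h => by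
        rw [← LinearMap.smul_apply]
        congr 1
        exact end_ext π hπ H fun p x => by
          rw [LinearMap.smul_apply]
          simp only [mulRightOver_mk, mul_smul_comm, TensorProduct.tmul_smul, map_smul]))
  have hν : ∀ c h, ν (c ⊗ₜ h) = mulRightOver π hπ H h (κ c) := fun _ _ => rfl
  refine Function.LeftInverse.injective (g := ν) fun z => ?_
  obtain ⟨t, rfl⟩ := Submodule.mkQ_surjective _ z
  induction t with
  | zero => simp
  | add x y hx hy => simp only [map_add, hx, hy]
  | tmul x y =>
    rw [canonicalMap_mk]
    have h1 : ∀ s : H ⊗[k] H, ν ((LinearMap.mulRight k y).lTensor C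
        ((π : H →ₗ[k] C).rTensor H s)) = tensorProj π hπ H
        (((LinearMap.mulRight k y) ∘ₗ LinearMap.mul' k H ∘ₗ (antipode k).rTensor H).lTensor H
          (TensorProduct.assoc k H H H (comul.rTensor H s))) := by
      intro s
      induction s with
      | zero => simp
      | add x y hx hy => simp only [map_add, hx, hy]
      | tmul p q =>
        simp only [LinearMap.rTensor_tmul, LinearMap.lTensor_tmul, hν, LinearMap.coe_coe, hκ,
          translationMap, LinearMap.comp_apply]
        generalize comul (R := k) p = r
        induction r with
        | zero => simp
        | add x y hx hy => simp only [map_add, TensorProduct.add_tmul, hx, hy]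
        | tmul a b =>
          simp only [LinearMap.lTensor_tmul, mulRightOver_mk, TensorProduct.assoc_tmul,
            LinearMap.comp_apply, LinearMap.rTensor_tmul, LinearMap.mul'_apply,
            LinearMap.mulRight_apply, mul_assoc]
    simp only [leftCoactionOf, LinearMap.comp_apply]
    rw [h1, LinearMap.lTensor_comp_apply, tmul_antipode_mul]
    simp

variable {V V' : Type v} [AddCommGroup V] [Module k V] [AddCommGroup V'] [Module k V']

/-- The cotensor product of the twisted comodule `H` with a left comodule, as a left `A`-module. -/
abbrev cotensorModule (σ : LeftCoaction k C V) :
    Submodule (leftCoinvariants π hπ) (H ⊗[k] V) :=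
  LinearMap.ker (twistedDiff π hπ hS σ)

theorem mem_cotensorModule {σ : LeftCoaction k C V} {t : H ⊗[k] V} :
    t ∈ cotensorModule π hπ hS σ ↔ t ∈ cotensor (twistedCoaction π hS) σ :=
  cotensorDiff_eq_zero

/-- The map `H ⊗_A (H ⊗ V) → H ⊗ V`, `x ⊗ (y ⊗ v) ↦ x y ⊗ v`. -/
def mulOverTensor (V : Type v) [AddCommGroup V] [Module k V] :
    TensorOver k (leftCoinvariants π hπ) H (H ⊗[k] V) →ₗ[k] H ⊗[k] V :=
  (mulOver π hπ).rTensor V ∘ₗ assocOverInv π hπ V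

theorem mulOverTensor_mk (x : H) (t : H ⊗[k] V) : mulOverTensor π hπ V
    ((balancedRel k (leftCoinvariants π hπ) H (H ⊗[k] V)).mkQ (x ⊗ₜ t)) =
      (LinearMap.mulLeft k x).rTensor V t := by
  induction t with
  | zero => simp
  | add x y hx hy => simp only [map_add, TensorProduct.tmul_add, hx, hy]
  | tmul y v => rfl

/-- The counit `H ⊗_A (H □ V) → H ⊗ V`, `x ⊗ (y ⊗ v) ↦ x y ⊗ v`. -/
def cotensorCounit (σ : LeftCoaction k C V) :
    TensorOver k (leftCoinvariants π hπ) H (cotensorModule π hπ hS σ) →ₗ[k] H ⊗[k] V :=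
  mulOverTensor π hπ V ∘ₗ
    TensorOver.mapRight k (leftCoinvariants π hπ) H (cotensorModule π hπ hS σ).subtype

theorem cotensorCounit_mk (σ : LeftCoaction k C V) (x : H) (t : cotensorModule π hπ hS σ) :
    cotensorCounit π hπ hS σ ((balancedRel k (leftCoinvariants π hπ) H
      (cotensorModule π hπ hS σ)).mkQ (x ⊗ₜ t)) =
      (LinearMap.mulLeft k x).rTensor V (t : H ⊗[k] V) :=
  mulOverTensor_mk π hπ x _

theorem assocOver_assocOverInv (w : TensorOver k (leftCoinvariants π hπ) H (H ⊗[k] V)) :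
    assocOver π hπ V (assocOverInv π hπ V w) = w := by
  obtain ⟨t, rfl⟩ := Submodule.mkQ_surjective _ w
  induction t with
  | zero => simp
  | add x y hx hy => simp only [map_add, hx, hy]
  | tmul x t =>
    induction t with
    | zero => simp
    | add y z hy hz => simp only [map_add, TensorProduct.tmul_add, hy, hz]
    | tmul y v => rfl

/-- The action of `H ⊗ H` on `C ⊗ H`. -/
def tensorLeftAct : H ⊗[k] H →ₗ[k] C ⊗[k] H →ₗ[k] C ⊗[k] H :=
  TensorProduct.homTensorHomMap (RingHom.id k) C H C H ∘ₗ
    TensorProduct.map (Algebra.lsmul k k C : H →ₐ[k] _).toLinearMap (LinearMap.mul k H)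

@[simp] theorem tensorLeftAct_tmul (p q h : H) (c : C) :
    tensorLeftAct (k := k) (p ⊗ₜ q) (c ⊗ₜ h) = (p • c) ⊗ₜ (q * h) := rfl

/-- The map `g ⊗ c ↦ g₁ c ⊗ g₂` is `H`-linear for the diagonal action on the target. -/
theorem diagMap_mul (x y : H) (c : C) : diagMap (k := k) ((x * y) ⊗ₜ c) =
    tensorLeftAct (comul x) (diagMap (k := k) (y ⊗ₜ c)) := by
  simp only [diagMap, LinearMap.comp_apply, LinearMap.rTensor_tmul, LinearEquiv.coe_coe,
    Bialgebra.comul_mul]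
  generalize comul (R := k) x = s
  generalize comul (R := k) y = t
  induction s with
  | zero => simp
  | add x y hx hy =>
    simp only [add_mul, map_add, TensorProduct.add_tmul, LinearMap.add_apply, hx, hy]
  | tmul p q =>
    induction t with
    | zero => simp
    | add x y hx hy => simp only [mul_add, map_add, TensorProduct.add_tmul, hx, hy]
    | tmul a b => simp [mul_smul]

/-- By flatness and `canonicalMap_injective`, `H ⊗_A (H □ V)` embeds into `C ⊗ H ⊗ V`. On
elements of `H □ V`, the embedding factors through the product in `H`. -/
theorem cotensorCounit_injective (hS : Function.Bijective (antipode k (A := H)))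
    (hflat : IsRightFlat k (leftCoinvariants π hπ) H)
    {κ : C →ₗ[k] TensorOver k (leftCoinvariants π hπ) H H}
    (hκ : ∀ x, κ (π x) = translationMap π hπ x) (σ : LeftCoaction k C V) :
    Function.Injective (cotensorCounit π hπ hS σ) := by
  rw [injective_iff_map_eq_zero]
  intro w hw
  apply hflat.mapRight_injective (cotensorModule π hπ hS σ).injective_subtype
  rw [map_zero]
  apply Function.LeftInverse.injective (assocOver_assocOverInv π hπ)
  apply Module.Flat.rTensor_preserves_injective_linearMap (M := V) _
    (canonicalMap_injective π hπ hκ)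
  rw [map_zero, map_zero]
  -- on `H ⊗_A (H □ V)` the canonical map is determined by the product in `H`
  have h1 : ∀ w, (canonicalMap π hπ).rTensor V (assocOverInv π hπ V (TensorOver.mapRight k
      (leftCoinvariants π hπ) H (cotensorModule π hπ hS σ).subtype w)) =
      (diagMap (k := k)).rTensor V ((TensorProduct.assoc k H C V).symm (σ.coact.lTensor H
        (cotensorCounit π hπ hS σ w))) := by
    intro w
    obtain ⟨t, rfl⟩ := Submodule.mkQ_surjective _ w
    induction t with
    | zero => simp only [map_zero]
    | add x y hx hy => simp only [map_add, hx, hy]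
    | tmul x t =>
      rw [cotensorCounit_mk]
      -- the action `c ⊗ h ↦ x₁ c ⊗ x₂ h`
      let X : C ⊗[k] H →ₗ[k] C ⊗[k] H := tensorLeftAct (comul x)
      have h2 : ∀ t : H ⊗[k] V, (canonicalMap π hπ).rTensor V (assocOverInv π hπ V
          ((balancedRel k (leftCoinvariants π hπ) H (H ⊗[k] V)).mkQ (x ⊗ₜ t))) =
          X.rTensor V ((diagMap (k := k)).rTensor V
            ((twistedCoaction π hS).coact.rTensor V t)) := by
        intro t
        induction t with
        | zero => simp
        | add x y hx hy => simp only [map_add, TensorProduct.tmul_add, hx, hy]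
        | tmul y v =>
          change (canonicalMap π hπ (tensorProj π hπ H (x ⊗ₜ y))) ⊗ₜ v = _
          simp only [LinearMap.rTensor_tmul, diagMap_twistedCoaction π hS hπ, canonicalMap_mk,
            leftCoactionOf, LinearMap.comp_apply, X]
          congr 1
          generalize comul (R := k) x = s
          induction s with
          | zero => simp
          | add x y hx hy => simp only [map_add, LinearMap.add_apply, hx, hy]
          | tmul p q => simp [← hπ]
      have h3 : ∀ t : H ⊗[k] V, (diagMap (k := k)).rTensor V ((TensorProduct.assoc k H C V).symm
          (σ.coact.lTensor H ((LinearMap.mulLeft k x).rTensor V t))) =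
          X.rTensor V ((diagMap (k := k)).rTensor V ((TensorProduct.assoc k H C V).symm
            (σ.coact.lTensor H t))) := by
        intro t
        induction t with
        | zero => simp
        | add x y hx hy => simp only [map_add, hx, hy]
        | tmul y v =>
          simp only [LinearMap.rTensor_tmul, LinearMap.lTensor_tmul, LinearMap.mulLeft_apply]
          generalize σ.coact v = s
          induction s with
          | zero => simp
          | add x y hx hy => simp only [map_add, TensorProduct.tmul_add, hx, hy]
          | tmul c v =>
            simp only [TensorProduct.assoc_symm_tmul, LinearMap.rTensor_tmul, diagMap_mul, X]
      have h4 := mem_cotensor.1 ((mem_cotensorModule π hπ hS).1 t.2)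
      rw [h3, ← h4, LinearEquiv.symm_apply_apply]
      exact h2 t
  rw [h1, hw]
  simp only [map_zero]

/-- The coaction of `v` is carried by `C → H ⊗_A H` to an element of `(H ⊗_A H) □ V`, which by
flatness comes from `H ⊗ (H □ V)`. Its image in `H ⊗ V` is `ε(v₋₁) ⊗ v₀ = 1 ⊗ v`. -/
theorem cotensorCounit_surjective (hS : Function.Bijective (antipode k (A := H)))
    (hflat : IsRightFlat k (leftCoinvariants π hπ) H) (hsurj : Function.Surjective π)
    {κ : C →ₗ[k] TensorOver k (leftCoinvariants π hπ) H H}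
    (hκ : ∀ x, κ (π x) = translationMap π hπ x)
    (hκ' : (regularCoaction k C).IsColinear (tensorCoaction π hπ hS H) κ)
    (σ : LeftCoaction k C V) : Function.Surjective (cotensorCounit π hπ hS σ) := by
  have hm : ∀ c, mulOver π hπ (κ c) = algebraMap k H (counit c) := by
    intro c
    obtain ⟨x, rfl⟩ := hsurj c
    rw [hκ, mulOver_translationMap, CoalgHomClass.counit_comp_apply]
  intro t
  change _ ∈ LinearMap.range (cotensorCounit π hπ hS σ)
  induction t with
  | zero => simp
  | add x y hx hy => exact add_mem hx hy
  | tmul h v =>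
    have hv : σ.coact v ∈ cotensor (regularCoaction k C) σ := by
      rw [mem_cotensor, show (regularCoaction k C).coact = comul from
        LinearMap.ext regularCoaction_coact]
      exact LinearMap.congr_fun σ.coassoc v
    obtain ⟨s, hs⟩ := exists_lift_of_isRightFlat π hπ hS hflat σ (rTensor_mem_cotensor hκ' hv)
    have h1 := congrArg (fun w => (LinearMap.mulLeft k h).rTensor V ((mulOver π hπ).rTensor V w)) hs
    have h2 : ∀ s : C ⊗[k] V, (LinearMap.mulLeft k h).rTensor V ((mulOver π hπ).rTensor V
        (κ.rTensor V s)) = h ⊗ₜ (TensorProduct.lid k V (counit.rTensor V s)) := by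
      intro s
      induction s with
      | zero => simp
      | add x y hx hy => simp only [map_add, TensorProduct.tmul_add, hx, hy]
      | tmul c v =>
        simp [hm, Algebra.algebraMap_eq_smul_one, TensorProduct.smul_tmul]
    have h3 : TensorProduct.lid k V (counit.rTensor V (σ.coact v)) = v :=
      LinearMap.congr_fun σ.counit_coact v
    simp only [h2, h3] at h1
    rw [← h1]
    clear h1 hs
    induction s with
    | zero => simp
    | add x y hx hy => simpa only [map_add] using add_mem hx hy
    | tmul x t =>
      refine ⟨(balancedRel k (leftCoinvariants π hπ) H (cotensorModule π hπ hS σ)).mkQ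
        ((h * x) ⊗ₜ ⟨t.1, (mem_cotensorModule π hπ hS).2 t.2⟩), ?_⟩
      rw [cotensorCounit_mk]
      obtain ⟨t, ht⟩ := t
      simp only [LinearMap.lTensor_tmul, Submodule.subtype_apply]
      clear ht
      induction t with
      | zero => simp
      | add x y hx hy => simp only [map_add, TensorProduct.tmul_add, hx, hy]
      | tmul y v =>
        simp only [TensorProduct.assoc_symm_tmul, LinearMap.rTensor_tmul,
          LinearMap.mulLeft_apply, mul_assoc]
        rfl

/-- The functor `H □ ?` on morphisms. -/
def cotensorModuleMap {σ : LeftCoaction k C V} {τ : LeftCoaction k C V'} {f : V →ₗ[k] V'}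
    (hf : σ.IsColinear τ f) : cotensorModule π hπ hS σ →ₗ[leftCoinvariants π hπ]
      cotensorModule π hπ hS τ :=
  (TensorProduct.AlgebraTensorModule.lTensor (leftCoinvariants π hπ) H f).restrict
    fun _ ht => (mem_cotensorModule π hπ hS).2
      (lTensor_mem_cotensor hf ((mem_cotensorModule π hπ hS).1 ht))

theorem coe_cotensorModuleMap {σ : LeftCoaction k C V} {τ : LeftCoaction k C V'} {f : V →ₗ[k] V'}
    (hf : σ.IsColinear τ f) (t : cotensorModule π hπ hS σ) :
    (cotensorModuleMap π hπ hS hf t : H ⊗[k] V') = f.lTensor H (t : H ⊗[k] V) := rfl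

/-- The counit `H ⊗_A (H □ V) → H ⊗ V` is natural in `V`. -/
theorem cotensorCounit_mapRight {σ : LeftCoaction k C V} {τ : LeftCoaction k C V'}
    {f : V →ₗ[k] V'} (hf : σ.IsColinear τ f)
    (z : TensorOver k (leftCoinvariants π hπ) H (cotensorModule π hπ hS σ)) :
    cotensorCounit π hπ hS τ (TensorOver.mapRight k (leftCoinvariants π hπ) H
      (cotensorModuleMap π hπ hS hf) z) = f.lTensor H (cotensorCounit π hπ hS σ z) := by
  obtain ⟨t, rfl⟩ := Submodule.mkQ_surjective _ z
  induction t with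
  | zero => simp only [map_zero]
  | add x y hx hy => simp only [map_add, hx, hy]
  | tmul x t =>
    rw [cotensorCounit_mk]
    refine (cotensorCounit_mk π hπ hS τ x (cotensorModuleMap π hπ hS hf t)).trans ?_
    rw [coe_cotensorModuleMap, rTensor_lTensor_apply]

/-- If `H` is right faithfully flat over `A`, then it is right faithfully coflat over `C`: the
functor `H ⊗_A (H □ ?)` is isomorphic to `H ⊗ ?`. -/
theorem isRightFaithfullyCoflat (hS : Function.Bijective (antipode k (A := H)))
    (hsurj : Function.Surjective π) (hcoflat : (leftCoactionOf π).IsCoflat)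
    (hff : IsRightFaithfullyFlat k (leftCoinvariants π hπ) H) :
    (rightCoactionOf π).IsFaithfullyCoflat := by
  obtain ⟨κ, hκ, hκ', -⟩ := exists_translation π hπ hS hsurj hcoflat hff.1
  have hinj : ∀ {V : Type v} [AddCommGroup V] [Module k V] (σ : LeftCoaction k C V),
      Function.Injective (cotensorCounit π hπ hS σ) :=
    fun σ => cotensorCounit_injective π hπ hS hff.1 hκ σ
  have hsur : ∀ {V : Type v} [AddCommGroup V] [Module k V] (σ : LeftCoaction k C V),
      Function.Surjective (cotensorCounit π hπ hS σ) :=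
    fun σ => cotensorCounit_surjective π hπ hS hff.1 hsurj hκ hκ' σ
  have hSinj : ∀ (V : Type v) [AddCommGroup V] [Module k V],
      Function.Injective ((antipode k (A := H)).rTensor V) := fun V _ _ =>
    Module.Flat.rTensor_preserves_injective_linearMap (M := V) _ hS.1
  have hSsur : ∀ (V : Type v) [AddCommGroup V] [Module k V],
      Function.Surjective ((antipode k (A := H)).rTensor V) := fun V _ _ =>
    LinearMap.rTensor_surjective V hS.2
  constructor
  · intro M₁ M₂ M₃ _ _ _ _ _ _ σ₁ σ₂ σ₃ f g hf hg hfg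
    have hex : Function.Exact (cotensorModuleMap π hπ hS hf) (cotensorModuleMap π hπ hS hg) := by
      refine IsRightFaithfullyFlat.exact (N₁ := cotensorModule π hπ hS σ₁)
        (N₂ := cotensorModule π hπ hS σ₂) (N₃ := cotensorModule π hπ hS σ₃) hff ?_ ?_
      · ext t
        change g.lTensor H (f.lTensor H (t : H ⊗[k] M₁)) = 0
        rw [← LinearMap.lTensor_comp_apply, hfg.linearMap_comp_eq_zero]
        simp
      · intro z hz
        have h1 : g.lTensor H (cotensorCounit π hπ hS σ₂ z) = 0 := by
          rw [← cotensorCounit_mapRight π hπ hS hg, hz, map_zero]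
        obtain ⟨y, hy⟩ := (Module.Flat.lTensor_exact H hfg _).1 h1
        obtain ⟨x, rfl⟩ := hsur σ₁ y
        refine ⟨x, hinj σ₂ ?_⟩
        rw [cotensorCounit_mapRight, hy]
    intro t
    constructor
    · intro ht
      have ht' : g.lTensor H (t : H ⊗[k] M₂) = 0 := congrArg Subtype.val ht
      have h1 := (mem_cotensorModule π hπ hS).2
        (rTensor_mem_cotensor (twistedCoaction_isColinear π hS) t.2)
      obtain ⟨s, hs⟩ := (hex ⟨_, h1⟩).1 (by
        apply Subtype.ext
        rw [coe_cotensorModuleMap]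
        change g.lTensor H ((antipode k).rTensor M₂ (t : H ⊗[k] M₂)) = 0
        rw [← rTensor_lTensor_apply, ht', map_zero])
      have hs' : f.lTensor H (s : H ⊗[k] M₁) = (antipode k).rTensor M₂ (t : H ⊗[k] M₂) :=
        congrArg Subtype.val hs
      obtain ⟨u, hu⟩ := hSsur M₁ s
      have hu' : u ∈ cotensor (rightCoactionOf π) σ₁ :=
        mem_cotensor_of_injective (twistedCoaction_isColinear π hS) hS.1 (by
          rw [hu]
          exact (mem_cotensorModule π hπ hS).1 s.2)
      refine ⟨⟨u, hu'⟩, Subtype.ext (hSinj M₂ ?_)⟩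
      change (antipode k).rTensor M₂ (f.lTensor H u) = _
      rw [rTensor_lTensor_apply, hu, hs']
    · rintro ⟨s, rfl⟩
      apply Subtype.ext
      change g.lTensor H (f.lTensor H (s : H ⊗[k] M₁)) = 0
      rw [← LinearMap.lTensor_comp_apply, hfg.linearMap_comp_eq_zero]
      simp
  · intro V _ _ σ hV
    by_contra hn
    rw [not_nontrivial_iff_subsingleton] at hn
    have := nontrivial_hopf k H
    obtain ⟨x, hx⟩ := exists_ne (0 : H ⊗[k] V)
    apply hx
    obtain ⟨z, rfl⟩ := hsur σ x
    obtain ⟨t, rfl⟩ := Submodule.mkQ_surjective _ z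
    clear hx
    induction t with
    | zero => simp
    | add x y hx hy => simp only [map_add, hx, hy, add_zero]
    | tmul x t =>
      obtain ⟨u, hu⟩ := hSsur V t
      have hu' : u ∈ cotensor (rightCoactionOf π) σ :=
        mem_cotensor_of_injective (twistedCoaction_isColinear π hS) hS.1 (by
          rw [hu]
          exact (mem_cotensorModule π hπ hS).1 t.2)
      have hu0 : u = 0 := congrArg Subtype.val
        (Subsingleton.elim (⟨u, hu'⟩ : cotensor (rightCoactionOf π) σ) 0)
      rw [cotensorCounit_mk, ← hu, hu0, map_zero, map_zero]

end RightCoflat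

end Takeuchi

end

theorem theorem7p4 {k : Type u} [Field k] {H : Type v} [Ring H] [HopfAlgebra k H]
    (hS : Function.Bijective (HopfAlgebra.antipode k (A := H)))
    {C : Type v} [AddCommGroup C] [Module k C] [Coalgebra k C] [Module H C] [IsScalarTower k H C]
    (π : H →ₗc[k] C) (hπ : ∀ h x : H, π (h * x) = h • π x) (hsurj : Function.Surjective π)
    (hcoflat : (Takeuchi.leftCoactionOf π).IsCoflat)
    (hflat : Takeuchi.IsRightFlat k (Takeuchi.leftCoinvariants π hπ) H) :
    ((Takeuchi.leftCoactionOf π).IsFaithfullyCoflat ∧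
      Takeuchi.IsLeftFaithfullyFlat k (Takeuchi.leftCoinvariants π hπ) H) ∧
    (((∃ R : Submodule k C, R ≠ ⊤ ∧ Takeuchi.IsRightCoideal R ∧ FiniteDimensional k (C ⧸ R)) ∨
        (∀ (N : Type v) [AddCommGroup N] [Module k N] [Module (Takeuchi.leftCoinvariants π hπ) N]
          [IsScalarTower k (Takeuchi.leftCoinvariants π hπ) N],
          IsSimpleModule (Takeuchi.leftCoinvariants π hπ) N → FiniteDimensional k N)) →
      (Takeuchi.rightCoactionOf π).IsFaithfullyCoflat ∧
        Takeuchi.IsRightFaithfullyFlat k (Takeuchi.leftCoinvariants π hπ) H) := by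
  have hleft := Takeuchi.isFaithfullyCoflat π hπ hS hsurj hcoflat hflat
  have hleft' := Takeuchi.isLeftFaithfullyFlat_of_isFaithfullyCoflat π hπ hS hleft
  refine ⟨⟨hleft, hleft'⟩, fun h => ?_⟩
  have hff : Takeuchi.IsRightFaithfullyFlat k (Takeuchi.leftCoinvariants π hπ) H := by
    refine ⟨hflat, fun N _ _ _ _ hN => ?_⟩
    rcases h with ⟨R, hR, hR', hfin⟩ | h
    · exact Takeuchi.nontrivial_tensorOver_of_isRightCoideal π hπ hS hsurj hcoflat hflat hR' hR N
    · refine Takeuchi.nontrivial_tensorOver_of_isSimpleModule π hπ N hflat fun M _ _ _ _ hM => ?_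
      have := h M hM
      have := IsSimpleModule.nontrivial (Takeuchi.leftCoinvariants π hπ) M
      exact Takeuchi.nontrivial_tensorOver_of_finiteDimensional π hπ M hflat hleft'
  exact ⟨Takeuchi.isRightFaithfullyCoflat π hπ hS hsurj hcoflat hff, hff⟩
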